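/- **Setting.** Let $\Omega\subset\mathbb R^3$ be a bounded connected open set with Lipschitz boundary, and let $\tilde\Omega\subset\mathbb R^3$ be a bounded connected open set containing $\bigcup_{x\in\Omega}\{y:|y-x|\le\epsilon_0\}$ for some $\epsilon_0>0$. Let $T>0$, $\alpha\in(0,1)$, $\mu:[0,\infty)\to(0,\infty)$ continuous, $f\in L^2_{\rm loc}([0,\infty);L^2(\Omega)^3)$, $v^0\in L^2(\Omega)^3$, $\rho^0\in L^\infty(\Omega)$ with $0<\rho^0_*\le\rho^0\le\rho^0_{**}$ a.e. for constants $\rho^0_*,\rho^0_{**}$, and extend $\rho^0$ by $\rho^0_*$ outside $\Omega$. $H^1_{0,\sigma}(\Omega)$ denotes the closure in $H^1(\Omega)^3$ of $C^\infty_{0,\sigma}(\Omega)$, the divergence-free fields in $C_0^\infty(\Omega)^3$. **Grid.** For $h>0$ put $\tau:=h^{2-\alpha}$, $\delta:=(h,\tau)$, and let $N\in\mathbb N$ satisfy $\tau N-\tau\le T<\tau N$. For $x\in h\mathbb Z^3$ let $C^+_h(x)=\prod_{i}[x_i,x_i+h)$ and $C_{4h}(x)=\prod_i[x_i-2h,x_i+2h)$;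 put $\Omega_h=\{x\in\Omega\cap h\mathbb Z^3: C_{4h}(x)\subset\Omega\}$, likewise $\tilde\Omega_h$; for $G\subset h\mathbb Z^3$ let $\partial G$ be the set of $x\in G$ with some neighbour $x\pm he^i\notin G$. Let $D_i^\pm$ be the forward/backward differences, $D_i\phi(x)=\frac{\phi(x+he^i)-\phi(x-he^i)}{2h}$, $D\cdot w=\sum_iD_iw_i$, and $B=\{0,\pm e^1,\pm e^2,\pm e^3\}$. Functions on $\Omega_h$ with values in $\mathbb R^3$ are extended by $0$. For $k\ge0$, $\mathcal A_h^k u(x)$ is the mean of $u(x+hz)$ over $z\in\{-k,\dots,k\}^3$. For such $u$ let $\tilde u:=\mathcal A_h^{k}u$ with the least $k\ge0$ such that $\|\mathcal A_h^ku\|_\infty\le\frac27h^{-1+\alpha}$. For $u:\Omega_h\to\mathbb R^3$, $P_hu:=w$ is the unique $w$ with $w=0$ on $\partial\Omega_h$, $D\cdot w=0$ on $\Omega_h$, and $w+D\phi=u$ on $\Omega_h\setminus\partial\Omega_h$ for some $\phi:\Omega_h\to\mathbb R$. **Discrete problem.** Let $\eta^0(x)=h^{-3}\int_{C_h^+(x)}\rho^0dy$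 on $\tilde\Omega_h$, $u^0(x)=h^{-3}\int_{C_h^+(x)}v^0dy$ on $\Omega_h$, $f^{n+1}(x)=\tau^{-1}h^{-3}\int_{\tau n}^{\tau(n+1)}\int_{C_h^+(x)}f\,dy\,ds$. Let $\tilde u^0$ be the average $\tilde w$ of $w=P_hu^0$, and $\tilde u^n$ that of $u^n$ for $n\ge1$. A solution consists of $\eta^{n+1}:\tilde\Omega_h\to\mathbb R$, $u^{n+1}:\Omega_h\to\mathbb R^3$, $q^{n+1}:\Omega_h\to\mathbb R$ $(0\le n<N)$ such that $$\frac1\tau\Big(\eta^{n+1}(x)-\frac17\sum_{\omega\in B}\eta^n(x+h\omega)\Big)+D\cdot(\eta^n\tilde u^n)(x)=0\ \text{ on }\tilde\Omega_h\setminus\partial\tilde\Omega_h,\qquad \eta^{n+1}=\eta^0\ \text{ on }\partial\tilde\Omega_h,$$ and, for $x\in\Omega_h\setminus\partial\Omega_h$ and $i=1,2,3$, $$\frac1\tau\Big(\eta^{n+1}u_i^{n+1}(x)-\frac17\sum_{\omega\in B}(\eta^nu_i^n)(x+h\omega)\Big)+D\cdot(\eta^n\tilde u^n)(x)\,u_i^{n+1}(x)+\sum_{j=1}^3\frac12\Big((\eta^n\tilde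 u^n_jD_ju_i^{n+1})(x-he^j)+(\eta^n\tilde u^n_jD_ju_i^{n+1})(x+he^j)\Big)$$ $$=\sum_{j=1}^3D_j^-\big\{\mu(\eta^{n+1})(D_j^+u_i^{n+1}+D_i^+u_j^{n+1})\big\}(x)+\eta^{n+1}(x)f_i^{n+1}(x)-D_iq^{n+1}(x),$$ together with $u^{n+1}=0$ on $\partial\Omega_h$ and $D\cdot u^{n+1}=0$ on $\Omega_h$. **Step functions.** For $t\in(n\tau,(n+1)\tau]\cap[0,T]$, $0\le n<N$: $\rho_\delta(t,x)=\eta^{n+1}(y)$ if $x\in C_h^+(y)$, $y\in\tilde\Omega_h$, and $\rho_\delta(t,x)=\rho^0_*$ for all other $x\in\tilde\Omega$; $v_\delta(t,x)=u^{n+1}(y)$ and $w^i_\delta(t,x)=D_i^+u^{n+1}(y)$ if $x\in C_h^+(y)$, $y\in\Omega_h$, and both are $0$ for all other $x\in\Omega$. At $t=0$ the values are those at $t=\tau$. **Proposition.** For all sufficiently small $h>0$ the discrete problem has a solution. Moreover, for every sequence of mesh sizes $h_m>0$ with $h_m\to0$, and any solutions of the discrete problem with mesh sizes $\delta_m=(h_m,h_m^{2-\alpha})$,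 there are a subsequence $\delta\to0$ with strictly decreasing mesh sizes and functions $\rho\in L^2([0,T];L^2(\tilde\Omega))$, $v\in L^2([0,T];H^1_{0,\sigma}(\Omega))$, $\tilde v\in L^2([0,T];L^2(\Omega)^3)$ such that, along this subsequence, $$\rho_\delta\rightharpoonup\rho\ \text{ in }L^2([0,T];L^2(\tilde\Omega)),\qquad v_\delta\rightharpoonup v,\qquad \rho_\delta v_\delta\rightharpoonup\tilde v,\qquad w^i_\delta\rightharpoonup\partial_{x_i}v\ (i=1,2,3)\ \text{ in }L^2([0,T];L^2(\Omega)^3).$$ -/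

import Mathlib

open MeasureTheory Set Filter Topology
open scoped NNReal ENNReal

noncomputable section

namespace FDNavierStokes

/-! ### Function spaces -/

/-- Euclidean three-space. -/
abbrev E3 := EuclideanSpace ℝ (Fin 3)

/-- The standard basis vectors of three-space. -/
def basisVec (i : Fin 3) : E3 := EuclideanSpace.single i 1

/-- `∂Ω` is Lipschitz: near each boundary point, after a rigid motion, `Ω` is the strict
epigraph of a Lipschitz function of the first two coordinates. -/
def HasLipschitzBoundary (Ω : Set E3) : Prop :=
  ∀ p ∈ frontier Ω, ∃ (e : E3 ≃ᵃⁱ[ℝ] E3) (g : EuclideanSpace ℝ (Fin 2) → ℝ) (K : ℝ≥0) (r : ℝ),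
    0 < r ∧ LipschitzWith K g ∧
      ∀ x ∈ Metric.ball p r, (x ∈ Ω ↔ g (!₂[e x 0, e x 1]) < e x 2)

/-- The space `L²(Ω; E)`. -/
abbrev L2On (E : Type) [NormedAddCommGroup E] (Ω : Set E3) := Lp E 2 (volume.restrict Ω)

/-- The Bochner space `L²([0,T]; X)`. -/
abbrev L2Time (X : Type) [NormedAddCommGroup X] (T : ℝ) :=
  Lp X 2 ((volume : Measure ℝ).restrict (Icc 0 T))

/-- `φ ∈ C^∞_0(Ω; E)`: smooth, with compact support contained in `Ω`. -/
def IsTest {E : Type} [NormedAddCommGroup E] [NormedSpace ℝ E] (Ω : Set E3) (φ : E3 → E) : Prop :=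
  ContDiff ℝ ((⊤ : ℕ∞) : WithTop ℕ∞) φ ∧ HasCompactSupport φ ∧ tsupport φ ⊆ Ω

/-- The classical partial derivative `∂φ/∂x_i`. -/
def pderiv {E : Type} [NormedAddCommGroup E] [NormedSpace ℝ E] (i : Fin 3) (φ : E3 → E) (x : E3) :
    E :=
  fderiv ℝ φ x (basisVec i)

/-- `φ ∈ C^∞_{0,σ}(Ω)`: a test vector field with vanishing divergence. -/
def IsSolenoidalTest (Ω : Set E3) (φ : E3 → E3) : Prop :=
  IsTest Ω φ ∧ ∀ x, ∑ i, pderiv i φ x i = 0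

/-- `g` is the weak partial derivative of `u` in the direction `x_i` on `Ω`. -/
def HasWeakPartial (Ω : Set E3) (i : Fin 3) (u g : E3 → E3) : Prop :=
  ∀ φ : E3 → ℝ, IsTest Ω φ → ∫ x in Ω, pderiv i φ x • u x = -∫ x in Ω, φ x • g x

theorem IsTest.integrable_smul {Ω : Set E3} {φ : E3 → ℝ} (hφ : IsTest Ω φ) (u : L2On E3 Ω) :
    Integrable (fun x => φ x • u x) (volume.restrict Ω) := by
  have h1 : MemLp φ 2 (volume.restrict Ω) :=
    (hφ.1.continuous.memLp_of_hasCompactSupport hφ.2.1)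
  exact memLp_one_iff_integrable.1 ((Lp.memLp u).smul h1)

theorem IsTest.integrable_pderiv_smul {Ω : Set E3} {φ : E3 → ℝ} (hφ : IsTest Ω φ) (i : Fin 3)
    (u : L2On E3 Ω) : Integrable (fun x => pderiv i φ x • u x) (volume.restrict Ω) := by
  have hc : Continuous (pderiv i φ) :=
    (hφ.1.continuous_fderiv (by simp)).clm_apply continuous_const
  have hs : HasCompactSupport (pderiv i φ) := hφ.2.1.fderiv_apply ℝ (basisVec i)
  have h1 : MemLp (pderiv i φ) 2 (volume.restrict Ω) := hc.memLp_of_hasCompactSupport hs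
  exact memLp_one_iff_integrable.1 ((Lp.memLp u).smul h1)

/-- The Hilbert space of the families `U` of a vector field `U none` and three candidate partial
derivatives `U (some i)` in `L²(Ω)³`, with norm `(‖U none‖² + ∑ i, ‖U (some i)‖²)^{1/2}`. -/
abbrev Jet (Ω : Set E3) := PiLp 2 (fun _ : Option (Fin 3) => L2On E3 Ω)

/-- The space `H¹(Ω)³`: the families `U` for which `U (some i)` is the weak partial derivative
of `U none` in the direction `x_i`.  Its norm is the one of `Jet Ω`. -/
def H1 (Ω : Set E3) : Submodule ℝ (Jet Ω) where
  carrier := {U | ∀ i : Fin 3, HasWeakPartial Ω i (U none) (U (some i))}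
  zero_mem' := by
    intro i φ _
    have h0 : ∀ o, (((0 : Jet Ω) o : L2On E3 Ω) : E3 → E3)
        =ᵐ[volume.restrict Ω] 0 := fun o => Lp.coeFn_zero _ _ _
    have h1 := integral_congr_ae ((h0 none).mono (fun x hx =>
      show pderiv i φ x • (0 : Jet Ω) none x = (0 : E3) by
        rw [hx]; simp))
    have h2 := integral_congr_ae ((h0 (some i)).mono (fun x hx =>
      show φ x • (0 : Jet Ω) (some i) x = (0 : E3) by
        rw [hx]; simp))
    rw [h1, h2]; simp
  add_mem' := by
    intro U V hU hV i φ hφ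
    have ha : ∀ o, (((U + V) o : L2On E3 Ω) : E3 → E3)
        =ᵐ[volume.restrict Ω] (U o : E3 → E3) + (V o : E3 → E3) := fun o => Lp.coeFn_add _ _
    have h1 := integral_congr_ae ((ha none).mono (fun x hx =>
      show pderiv i φ x • (U + V) none x = pderiv i φ x • U none x + pderiv i φ x • V none x by
        rw [hx]; simp))
    have h2 := integral_congr_ae ((ha (some i)).mono (fun x hx =>
      show φ x • (U + V) (some i) x = φ x • U (some i) x + φ x • V (some i) x by
        rw [hx]; simp))
    rw [h1, h2, integral_add (hφ.integrable_pderiv_smul i _) (hφ.integrable_pderiv_smul i _),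
      integral_add (hφ.integrable_smul _) (hφ.integrable_smul _), hU i φ hφ, hV i φ hφ]
    abel
  smul_mem' := by
    intro c U hU i φ hφ
    have ha : ∀ o, (((c • U) o : L2On E3 Ω) : E3 → E3)
        =ᵐ[volume.restrict Ω] c • (U o : E3 → E3) := fun o => Lp.coeFn_smul _ _
    have h1 := integral_congr_ae ((ha none).mono (fun x hx =>
      show pderiv i φ x • (c • U) none x = c • (pderiv i φ x • U none x) by
        rw [hx, Pi.smul_apply, smul_comm]))
    have h2 := integral_congr_ae ((ha (some i)).mono (fun x hx =>
      show φ x • (c • U) (some i) x = c • (φ x • U (some i) x) by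
        rw [hx, Pi.smul_apply, smul_comm]))
    rw [h1, h2, integral_smul, integral_smul, hU i φ hφ, smul_neg]

/-- The space `H¹_{0,σ}(Ω)`: the closure of `C^∞_{0,σ}(Ω)` in `H¹(Ω)³`.
(The set whose span is taken is already a linear subspace.) -/
def H10sigma (Ω : Set E3) : Submodule ℝ (Jet Ω) :=
  H1 Ω ⊓ (Submodule.span ℝ {U : Jet Ω | U ∈ H1 Ω ∧ ∃ φ : E3 → E3, IsSolenoidalTest Ω φ ∧
    (U none : E3 → E3) =ᵐ[volume.restrict Ω] φ}).topologicalClosure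

/-- The continuous linear maps `v ↦ v` (for `none`) and `v ↦ ∂v/∂x_i` (for `some i`)
from `H¹_{0,σ}(Ω)` to `L²(Ω)³`. -/
def jetComponent (Ω : Set E3) (o : Option (Fin 3)) : H10sigma Ω →L[ℝ] L2On E3 Ω :=
  (PiLp.proj 2 (fun _ : Option (Fin 3) => L2On E3 Ω) o).comp (H10sigma Ω).subtypeL

/-- The inclusion of `L²([0,T]; H¹_{0,σ}(Ω))` in `L²([0,T]; L²(Ω)³)`. -/
def valueL2 {Ω : Set E3} {T : ℝ} (v : L2Time (H10sigma Ω) T) : L2Time (L2On E3 Ω) T :=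
  (jetComponent Ω none).compLp v

/-- The weak derivative `∂v/∂x_i ∈ L²([0,T]; L²(Ω)³)` of `v ∈ L²([0,T]; H¹_{0,σ}(Ω))`. -/
def derivL2 {Ω : Set E3} {T : ℝ} (i : Fin 3) (v : L2Time (H10sigma Ω) T) :
    L2Time (L2On E3 Ω) T :=
  (jetComponent Ω (some i)).compLp v

/-- Weak convergence `F l ⇀ f` in the Hilbert space `L²([0,T]; L²(Ω; E))`, for honest functions
`F l` of `(t, x)`; that each `F l` defines an element of that space is part of the claim. -/
def WeaklyConverges {E : Type} [NormedAddCommGroup E] [InnerProductSpace ℝ E] {Ω : Set E3} {T : ℝ}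
    (F : ℕ → ℝ → E3 → E) (f : L2Time (L2On E Ω) T) : Prop :=
  ∃ G : ℕ → L2Time (L2On E Ω) T,
    (∀ l, ∀ᵐ t ∂((volume : Measure ℝ).restrict (Icc 0 T)),
      (G l t : E3 → E) =ᵐ[volume.restrict Ω] F l t) ∧
    ∀ ψ : L2Time (L2On E Ω) T,
      Tendsto (fun l => inner ℝ (G l) ψ) atTop (𝓝 (inner ℝ f ψ))

/-! ### Grid calculus

A point `h z` of the grid `hℤ³` is encoded by its index `z`, and a function on a part of the grid
by a function of the index. -/

/-- Indices of grid points. -/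
abbrev Idx := Fin 3 → ℤ

/-- The index of the basis vector `e^i`. -/
def unitIdx (i : Fin 3) : Idx := Pi.single i 1

/-- The grid point `h z`. -/
def gridPt (h : ℝ) (z : Idx) : E3 := WithLp.toLp 2 (fun i => h * (z i : ℝ))

/-- The half-open cube `C_s(x)` of side `s` centred at `x`. -/
def cube (s : ℝ) (x : E3) : Set E3 := {y | ∀ i, x i - s / 2 ≤ y i ∧ y i < x i + s / 2}

/-- The half-open cell `C_h^+(x) = [x_1, x_1 + h) × [x_2, x_2 + h) × [x_3, x_3 + h)`
at the grid point `x = h z`. -/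
def cell (h : ℝ) (z : Idx) : Set E3 :=
  {y | ∀ i, gridPt h z i ≤ y i ∧ y i < gridPt h z i + h}

/-- The discrete domain `Ω_h = {x ∈ Ω ∩ hℤ³ | C_{4h}(x) ⊆ Ω}`. -/
def grid (Ω : Set E3) (h : ℝ) : Set Idx := {z | gridPt h z ∈ Ω ∧ cube (4 * h) (gridPt h z) ⊆ Ω}

/-- The discrete boundary: the points of `G` that have a neighbour outside `G`. -/
def gridBoundary (G : Set Idx) : Set Idx :=
  {z | z ∈ G ∧ ∃ i, z + unitIdx i ∉ G ∨ z - unitIdx i ∉ G}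

section Differences

variable {E : Type} [AddCommGroup E] [Module ℝ E]

/-- Forward difference `D_i^+`. -/
def dPlus (h : ℝ) (i : Fin 3) (φ : Idx → E) (z : Idx) : E := h⁻¹ • (φ (z + unitIdx i) - φ z)

/-- Backward difference `D_i^-`. -/
def dMinus (h : ℝ) (i : Fin 3) (φ : Idx → E) (z : Idx) : E := h⁻¹ • (φ z - φ (z - unitIdx i))

/-- Central difference `D_i`. -/
def dCentral (h : ℝ) (i : Fin 3) (φ : Idx → E) (z : Idx) : E :=
  (2 * h)⁻¹ • (φ (z + unitIdx i) - φ (z - unitIdx i))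

/-- The mean over the seven-point stencil `{0, ±e^1, ±e^2, ±e^3}`. -/
def stencilMean (φ : Idx → E) (z : Idx) : E :=
  (1 / 7 : ℝ) • (φ z + ∑ j, (φ (z + unitIdx j) + φ (z - unitIdx j)))

/-- The local average `𝒜_h^k φ`, i.e. the mean of `φ` over the `(2k+1)³` grid points
of the cube centred at the given point. -/
def localAverage (k : ℕ) (φ : Idx → E) (z : Idx) : E :=
  ((2 * (k : ℝ) + 1) ^ 3)⁻¹ •
    ∑ y ∈ Finset.Icc (fun _ : Fin 3 => -(k : ℤ)) (fun _ : Fin 3 => (k : ℤ)), φ (z + y)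

end Differences

/-- The central discrete divergence `D · w`. -/
def dDiv (h : ℝ) (w : Idx → E3) (z : Idx) : ℝ := ∑ j, dCentral h j (fun y => w y j) z

/-- The least `k ≥ 0` with `‖𝒜_h^k u‖_∞ ≤ (2/7) h^{-1+α}`; it is `0` exactly when
`‖u‖_∞` itself obeys this bound, since `𝒜_h^0 u = u`. -/
def truncIndex (α h : ℝ) (u : Idx → E3) : ℕ :=
  sInf {k : ℕ | ∀ z, ‖localAverage k u z‖ ≤ 2 / 7 * h ^ (-1 + α)}

/-- The truncated field `ũ = 𝒜_h^k u`, with `k = truncIndex α h u`. -/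
def truncField (α h : ℝ) (u : Idx → E3) : Idx → E3 := localAverage (truncIndex α h u) u

/-- `w = P_h u` on the grid part `G`, extended by `0` outside `G`: the discrete Helmholtz-Hodge
decomposition `u = w + D φ`.  (The potential `φ` is only determined up to normalization, which
does not affect `w`.) -/
structure IsHelmholtzProjection (G : Set Idx) (h : ℝ) (u w : Idx → E3) : Prop where
  zero_outside : ∀ z, z ∉ G → w z = 0
  zero_boundary : ∀ z ∈ gridBoundary G, w z = 0
  div_free : ∀ z ∈ G, dDiv h w z = 0
  decomposition : ∃ φ : Idx → ℝ, ∀ z ∈ G \ gridBoundary G, ∀ i,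
    w z i + dCentral h i φ z = u z i

/-! ### The discrete problem -/

/-- The time step `τ = h^{2-α}`. -/
def timeStep (α h : ℝ) : ℝ := h ^ (2 - α)

/-- The number `N` of time steps, i.e. the natural number with `τ N - τ ≤ T < τ N`. -/
def numSteps (α h T : ℝ) : ℕ := ⌊T / timeStep α h⌋₊ + 1

open Classical in
/-- The initial density extended by the constant `ρlo` outside `Ω`. -/
def extendDensity {Ω : Set E3} (ρ0 : Lp ℝ ⊤ (volume.restrict Ω)) (ρlo : ℝ) (x : E3) : ℝ :=
  if x ∈ Ω then ρ0 x else ρlo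

/-- The cell average `η⁰` of the initial density. -/
def densityInit {Ω : Set E3} (ρ0 : Lp ℝ ⊤ (volume.restrict Ω)) (ρlo h : ℝ) (z : Idx) : ℝ :=
  (h ^ 3)⁻¹ * ∫ y in cell h z, extendDensity ρ0 ρlo y

/-- The cell average `u⁰` of the initial velocity. -/
def velocityInit {Ω : Set E3} (v0 : L2On E3 Ω) (h : ℝ) (z : Idx) : E3 :=
  (h ^ 3)⁻¹ • ∫ y in cell h z, v0 y

/-- `forceStep f τ h n` is `f^{n+1}`, the mean of `f` over the space-time cell
`[τ n, τ (n+1)] × C_h^+(h z)`. -/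
def forceStep {Ω : Set E3} (f : ℝ → L2On E3 Ω) (τ h : ℝ) (n : ℕ) (z : Idx) : E3 :=
  (τ⁻¹ * (h ^ 3)⁻¹) • ∫ s in (τ * n)..(τ * (n + 1)), ∫ y in cell h z, f s y

/-- `(η, u, q)` solves the discrete problem with mesh size `h`, time step `τ = h^{2-α}` and
data `μ, f, v⁰, ρ⁰` up to the time `τ N > T`; `ũ` denotes the truncated velocities.  The density
lives on the grid of the larger domain `Ω'`, velocity and pressure on the grid of `Ω`. -/
structure IsDiscreteSolution (Ω Ω' : Set E3) (μ : ℝ → ℝ) (f : ℝ → L2On E3 Ω) (v0 : L2On E3 Ω)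
    (ρ0 : Lp ℝ ⊤ (volume.restrict Ω)) (ρlo α T h : ℝ)
    (η : ℕ → Idx → ℝ) (u ũ : ℕ → Idx → E3) (q : ℕ → Idx → ℝ) : Prop where
  /-- The initial density. -/
  density_init : ∀ z ∈ grid Ω' h, η 0 z = densityInit ρ0 ρlo h z
  /-- The initial velocity. -/
  velocity_init : ∀ z ∈ grid Ω h, u 0 z = velocityInit v0 h z
  /-- Velocities are extended by zero outside the grid. -/
  zero_outside : ∀ n, ∀ z, z ∉ grid Ω h → u n z = 0
  /-- The truncated initial velocity, made from the Helmholtz projection of `u⁰`. -/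
  trunc_init : ∃ w, IsHelmholtzProjection (grid Ω h) h (u 0) w ∧ ũ 0 = truncField α h w
  /-- The truncated velocities at the later times. -/
  trunc_succ : ∀ n, ũ (n + 1) = truncField α h (u (n + 1))
  /-- The discrete continuity equation. -/
  continuity : ∀ n < numSteps α h T, ∀ z ∈ grid Ω' h \ gridBoundary (grid Ω' h),
    (η (n + 1) z - stencilMean (η n) z) * (1 / timeStep α h)
      + dDiv h (fun y => η n y • ũ n y) z = 0
  /-- The boundary condition of the density. -/
  density_boundary : ∀ n < numSteps α h T, ∀ z ∈ gridBoundary (grid Ω' h), η (n + 1) z = η 0 z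
  /-- The discrete momentum equation. -/
  momentum : ∀ n < numSteps α h T, ∀ z ∈ grid Ω h \ gridBoundary (grid Ω h), ∀ i : Fin 3,
    (η (n + 1) z * u (n + 1) z i - stencilMean (fun y => η n y * u n y i) z) * (1 / timeStep α h)
      + dDiv h (fun y => η n y • ũ n y) z * u (n + 1) z i
      + ∑ j, 1 / 2 *
          (η n (z - unitIdx j) * ũ n (z - unitIdx j) j
              * dCentral h j (fun y => u (n + 1) y i) (z - unitIdx j)
            + η n (z + unitIdx j) * ũ n (z + unitIdx j) j
              * dCentral h j (fun y => u (n + 1) y i) (z + unitIdx j))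
    = ∑ j, dMinus h j (fun y => μ (η (n + 1) y) *
          (dPlus h j (fun y' => u (n + 1) y' i) y + dPlus h i (fun y' => u (n + 1) y' j) y)) z
      + η (n + 1) z * forceStep f (timeStep α h) h n z i
      - dCentral h i (q (n + 1)) z
  /-- The boundary condition of the velocity. -/
  velocity_boundary : ∀ n < numSteps α h T, ∀ z ∈ gridBoundary (grid Ω h), u (n + 1) z = 0
  /-- The discrete incompressibility constraint. -/
  incompressible : ∀ n < numSteps α h T, ∀ z ∈ grid Ω h, dDiv h (u (n + 1)) z = 0

/-! ### Step functions -/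

/-- The index `z` of the grid point whose cell `C_h^+(h z)` contains `x` (for `h > 0`). -/
def cellIdx (h : ℝ) (x : E3) : Idx := fun i => ⌊x i / h⌋

/-- The index `n + 1` of the interval `(n τ, (n + 1) τ]` containing `t`; it is `1` at `t = 0`. -/
def timeIdx (τ t : ℝ) : ℕ := max 1 ⌈t / τ⌉₊

theorem mem_cell_iff {h : ℝ} (hh : 0 < h) (z : Idx) (x : E3) :
    x ∈ cell h z ↔ cellIdx h x = z := by
  simp only [cell, cellIdx, gridPt, mem_ofPred_eq, funext_iff, Int.floor_eq_iff]
  refine forall_congr' fun i => ?_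
  rw [le_div_iff₀ hh, div_lt_iff₀ hh]
  constructor <;> rintro ⟨h1, h2⟩ <;> constructor <;> linarith

open Classical in
/-- The step function with the value `a (n+1) z` for `t ∈ (n τ, (n + 1) τ]` and
`x ∈ C_h^+(h z)`, where `h z` runs through the grid part `G`, and the value `c` for the
other `x`; its value at `t = 0` is that at `t = τ`. -/
def stepFun {E : Type} (G : Set Idx) (c : E) (h τ : ℝ) (a : ℕ → Idx → E) (t : ℝ) (x : E3) : E :=
  if cellIdx h x ∈ G then a (timeIdx τ t) (cellIdx h x) else c

/-- The step function `ρ_δ`. -/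
def rhoStep (Ω' : Set E3) (ρlo α h : ℝ) (η : ℕ → Idx → ℝ) : ℝ → E3 → ℝ :=
  stepFun (grid Ω' h) ρlo h (timeStep α h) η

/-- The step function `v_δ`. -/
def velStep (Ω : Set E3) (α h : ℝ) (u : ℕ → Idx → E3) : ℝ → E3 → E3 :=
  stepFun (grid Ω h) 0 h (timeStep α h) u

/-- The step function `w^i_δ` of the forward differences of the velocity. -/
def gradStep (Ω : Set E3) (α h : ℝ) (i : Fin 3) (u : ℕ → Idx → E3) : ℝ → E3 → E3 :=
  stepFun (grid Ω h) 0 h (timeStep α h) (fun n => dPlus h i (u n))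

end FDNavierStokes

end

noncomputable section

namespace FDNavierStokes

/-! ### Summation over the grid -/

/-! Existence. Each time step decouples. The new density is explicit: since the truncation bound
`2/7 * h ^ (-1 + α)` and `τ = h ^ (2 - α)` give Courant number at most 1/7, the update is a
combination of the seven stencil values with nonnegative weights, and because `ũ` is discretely
solenoidal the weights sum to one. Hence the density stays between the bounds of the initial data
(`transport_mem_Icc`). With the density known, the momentum equation is a linear saddle point
problem whose multiplier is the pressure. Its operator is positive: the convection term is skew up
to half the divergence of the mass flux, and the continuity equation turns the resulting coefficient
of `‖w‖ ^ 2` into `(η' + stencilMean η) / (2τ)` (`tsum_momentumOp`, `momentumOp_pos`,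
`exists_grid_saddle_point`).

Bounds. Testing the momentum equation with its solution gives the same identity; Young's inequality
absorbs the old momentum, and a discrete Korn inequality bounds all forward differences by the
symmetric ones (`energy_inequality`, `tsum_dPlus_sq_le`). Summation over the steps yields bounds in
discrete `L^∞(L²)` and `L²(H¹)` that do not depend on the mesh (`exists_uniform_bound`).

Limits. Weak compactness of bounded sequences in Hilbert spaces provides limits; what has to be
shown is that the velocity limit lies in `L²(0,T; H¹_{0,σ})` and that its derivatives are the limits
of the difference quotients. For this the grid velocity is smoothed with a product kernel that is
wider in direction `i` for the component `i`. The kernels are made from box averages of one bump, so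
that differentiation of the smoothed field smooths the forward differences with another kernel of
mass one, while its divergence smooths the central discrete divergence and therefore vanishes
exactly. The supports stay inside `Ω`, so each smoothed field is a genuine element of `C^∞_{0,σ}(Ω)`
(`isSolenoidalTest_smear`) with `H¹` norm controlled by the discrete one
(`exists_smoothed_velocity`). A weak limit taken in the Bochner space over `H10sigma Ω` then needs
no further identification. Finally, smoothed and unsmoothed step functions have the same weak limit,
because against a continuous function a kernel of mass one and a cell indicator act alike up to the
modulus of continuity (`smear_sub_gridL2_le`, `weakly_null_smear_sub`). -/

theorem tsum_shift (e : Idx) (F : Idx → ℝ) : ∑' z, F (z + e) = ∑' z, F z :=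
  (Equiv.addRight e).tsum_eq F

theorem summable_of_eq_zero_off {F : Idx → ℝ} {S : Set Idx} (hS : S.Finite)
    (h : ∀ z, z ∉ S → F z = 0) : Summable F :=
  summable_of_hasFiniteSupport (hS.subset fun z hz => by
    by_contra hzS
    exact hz (h z hzS))

theorem summable_of_imp {F G : Idx → ℝ} (hG : G.support.Finite) (h : ∀ z, G z = 0 → F z = 0) :
    Summable F :=
  summable_of_eq_zero_off hG fun z hz => h z (by simpa using hz)

theorem finite_support_shift {E : Type} [Zero E] {w : Idx → E} (hw : w.support.Finite) (e : Idx) :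
    (fun z => w (z + e)).support.Finite :=
  hw.preimage (f := fun z => z + e) (add_left_injective e).injOn

/-- Two sums over the grid agree if their terms differ by a finitely supported difference. -/
theorem tsum_eq_of_telescope {T R W : Idx → ℝ} (e : Idx) (hR : Summable R)
    (hW : W.support.Finite) (h : ∀ z, T z = R z + (W (z + e) - W z)) :
    ∑' z, T z = ∑' z, R z := by
  have h1 : Summable W := summable_of_imp hW fun z h => h
  have h2 : Summable fun z => W (z + e) :=
    summable_of_imp (finite_support_shift hW e) fun z h => h
  rw [tsum_congr h, hR.tsum_add (h2.sub h1), h2.tsum_sub h1, tsum_shift]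
  simp

section SummationByParts

variable (h : ℝ) (j : Fin 3) {w : Idx → ℝ}

theorem tsum_dMinus_mul (hw : w.support.Finite) (X : Idx → ℝ) :
    ∑' z, dMinus h j X z * w z = -∑' z, X z * dPlus h j w z := by
  rw [← tsum_neg]
  refine tsum_eq_of_telescope (W := fun z => h⁻¹ * X (z - unitIdx j) * w z) (unitIdx j) ?_ ?_ ?_
  · refine summable_of_eq_zero_off (hw.union (finite_support_shift hw (unitIdx j))) fun z hz => ?_
    simp only [mem_union, Function.mem_support, not_or, not_not] at hz
    simp [dPlus, hz.1, hz.2]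
  · exact hw.subset fun z hz hz' => hz (by simp [hz'])
  · intro z
    simp only [dMinus, dPlus, smul_eq_mul, add_sub_cancel_right]
    ring

theorem tsum_dCentral_mul (hw : w.support.Finite) (X : Idx → ℝ) :
    ∑' z, dCentral h j X z * w z = -∑' z, X z * dCentral h j w z := by
  rw [← tsum_neg]
  have h2 := finite_support_shift hw (-unitIdx j)
  simp only [← sub_eq_add_neg] at h2
  refine tsum_eq_of_telescope (W := fun z => (2 * h)⁻¹ *
    (X (z - unitIdx j) * w z + X z * w (z - unitIdx j))) (unitIdx j) ?_ ?_ ?_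
  · refine summable_of_eq_zero_off ((finite_support_shift hw (unitIdx j)).union h2) fun z hz => ?_
    simp only [mem_union, Function.mem_support, not_or, not_not] at hz
    simp [dCentral, hz.1, hz.2]
  · refine (hw.union h2).subset fun z hz => ?_
    by_contra hz'
    simp only [mem_union, Function.mem_support, not_or, not_not] at hz'
    exact hz (by simp [hz'.1, hz'.2])
  · intro z
    simp only [dCentral, smul_eq_mul, add_sub_cancel_right]
    ring

/-- Skew-symmetry of the discrete convection term. -/
theorem tsum_convection_mul (hw : w.support.Finite) (F : Idx → ℝ) :
    ∑' z, 1 / 2 * (F (z - unitIdx j) * dCentral h j w (z - unitIdx j)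
        + F (z + unitIdx j) * dCentral h j w (z + unitIdx j)) * w z
      = ∑' z, -(1 / 2) * (dCentral h j F z * w z ^ 2) := by
  have h2 := finite_support_shift hw (-unitIdx j)
  have h1 := finite_support_shift hw (unitIdx j)
  simp only [← sub_eq_add_neg] at h2
  -- The terms with products of two different values of `w` are `P (z + e) - P (z - e)` with `P z =
  -- F z * w (z + e) * w (z - e)` up to the factor `(4 * h)⁻¹`. This is a jump over two cells, so
  -- the telescoping function is `P z + P (z - e)`.
  refine tsum_eq_of_telescope (W := fun z => (4 * h)⁻¹ *
    (F z * w (z + unitIdx j) * w (z - unitIdx j)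
      + F (z - unitIdx j) * w z * w (z - unitIdx j - unitIdx j))) (unitIdx j) ?_ ?_ ?_
  · exact summable_of_imp hw fun z hz => by simp [hz]
  · refine (hw.union h2).subset fun z hz => ?_
    by_contra hz'
    simp only [mem_union, Function.mem_support, not_or, not_not] at hz'
    exact hz (by simp [hz'.1, hz'.2])
  · intro z
    have : (4 * h)⁻¹ = 1 / 2 * (2 * h)⁻¹ := by
      rw [show 4 * h = 2 * (2 * h) by ring, mul_inv]; ring
    simp only [dCentral, smul_eq_mul, add_sub_cancel_right, sub_add_cancel, this]
    ring

/-- Two summations by parts, between which a forward and a backward difference are commuted. It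
turns the mixed terms of the symmetric gradient into products of diagonal differences. -/
theorem tsum_dPlus_mul_dPlus (i : Fin 3) {a b : Idx → ℝ} (ha : a.support.Finite)
    (hb : b.support.Finite) :
    ∑' z, dPlus h j a z * dPlus h i b z = ∑' z, dMinus h i a z * dMinus h j b z := by
  have hs : (dMinus h i a).support.Finite := by
    have h2 := finite_support_shift ha (-unitIdx i)
    refine (ha.union h2).subset fun z hz => ?_
    by_contra hz'
    simp only [mem_union, Function.mem_support, not_or, not_not, ← sub_eq_add_neg] at hz'
    exact hz (by simp [dMinus, hz'.1, hz'.2])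
  have h1 := tsum_dMinus_mul h i hb (dPlus h j a)
  have h2 := tsum_dMinus_mul h j hs b
  rw [eq_neg_iff_add_eq_zero, add_comm, ← eq_neg_iff_add_eq_zero] at h1
  rw [h1, tsum_congr (fun z => mul_comm (dMinus h i a z) _), h2]
  congr 1
  refine tsum_congr fun z => ?_
  simp only [dMinus, dPlus, smul_eq_mul]
  rw [show z - unitIdx i + unitIdx j = z + unitIdx j - unitIdx i by abel]
  ring

end SummationByParts

theorem finite_support_apply {w : Idx → E3} (hw : w.support.Finite) (i : Fin 3) :
    (fun z => w z i).support.Finite :=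
  hw.subset fun z hz hz' => hz (by simp [hz'])

theorem summable_of_imp_field {F : Idx → ℝ} {w : Idx → E3} (hw : w.support.Finite)
    (h : ∀ z, w z = 0 → F z = 0) : Summable F :=
  summable_of_eq_zero_off hw fun z hz => h z (by simpa using hz)

theorem finite_support_dPlus {E : Type} [AddCommGroup E] [Module ℝ E] (h : ℝ) (j : Fin 3)
    {w : Idx → E} (hw : w.support.Finite) : (dPlus h j w).support.Finite := by
  refine (hw.union (finite_support_shift hw (unitIdx j))).subset fun z hz => ?_
  by_contra hz'
  simp only [mem_union, Function.mem_support, not_or, not_not] at hz'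
  exact hz (by simp [dPlus, hz'.1, hz'.2])

theorem dPlus_apply (h : ℝ) (j : Fin 3) (w : Idx → E3) (z : Idx) (i : Fin 3) :
    dPlus h j w z i = dPlus h j (fun y => w y i) z := by
  simp [dPlus]

/-- The discrete pressure gradient is orthogonal to discretely solenoidal fields. -/
theorem tsum_dCentral_inner (h : ℝ) {w : Idx → E3} (hw : w.support.Finite) (q : Idx → ℝ) :
    ∑' z, ∑ i, dCentral h i q z * w z i = -∑' z, q z * dDiv h w z := by
  rw [Summable.tsum_finsetSum fun i _ => summable_of_imp_field hw fun z hz => by simp [hz]]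
  simp_rw [tsum_dCentral_mul h _ (finite_support_apply hw _) q]
  rw [Finset.sum_neg_distrib, ← Summable.tsum_finsetSum]
  · simp [dDiv, Finset.mul_sum]
  · intro i _
    have h2 := finite_support_shift hw (-unitIdx i)
    simp only [← sub_eq_add_neg] at h2
    refine summable_of_eq_zero_off ((finite_support_shift hw (unitIdx i)).union h2) fun z hz => ?_
    simp only [mem_union, Function.mem_support, not_or, not_not] at hz
    simp [dCentral, hz.1, hz.2]

/-- A discrete Korn inequality: the symmetric difference quotients control all of them. -/
theorem tsum_dPlus_sq_le (h : ℝ) {w : Idx → E3} (hw : w.support.Finite) :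
    2 * ∑' z, ∑ j, ‖dPlus h j w z‖ ^ 2 ≤ ∑' z, ∑ i, ∑ j,
      (dPlus h j (fun y => w y i) z + dPlus h i (fun y => w y j) z) ^ 2 := by
  have hp : ∀ i j, (dPlus h j (fun y => w y i)).support.Finite := fun i j =>
    finite_support_dPlus h j (finite_support_apply hw i)
  have hs : ∀ i j k l, Summable fun z =>
      dPlus h j (fun y => w y i) z * dPlus h k (fun y => w y l) z := fun i j k l =>
    summable_of_imp (hp i j) fun z hz => by simp [hz]
  have hm : ∀ i j, Summable fun z =>
      dMinus h i (fun y => w y i) z * dMinus h j (fun y => w y j) z := fun i j => by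
    have h2 := finite_support_shift hw (-unitIdx i)
    simp only [← sub_eq_add_neg] at h2
    refine summable_of_eq_zero_off (hw.union h2) fun z hz => ?_
    simp only [mem_union, Function.mem_support, not_or, not_not] at hz
    simp [dMinus, hz.1, hz.2]
  have e1 : ∑' z, ∑ i, ∑ j,
      (dPlus h j (fun y => w y i) z + dPlus h i (fun y => w y j) z) ^ 2
      = 2 * ∑' z, ∑ j, ‖dPlus h j w z‖ ^ 2
        + 2 * ∑' z, ∑ i, ∑ j, dPlus h j (fun y => w y i) z * dPlus h i (fun y => w y j) z := by
    rw [← tsum_mul_left, ← tsum_mul_left, ← Summable.tsum_add]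
    · refine tsum_congr fun z => ?_
      simp only [EuclideanSpace.norm_sq_eq, dPlus_apply, Real.norm_eq_abs, sq_abs,
        Fin.sum_univ_three]
      ring
    · refine Summable.mul_left _ (summable_sum fun j _ => ?_)
      simp only [EuclideanSpace.norm_sq_eq, dPlus_apply, Real.norm_eq_abs, sq_abs]
      refine summable_sum fun i _ => ?_
      simpa only [sq] using hs i j j i
    · exact Summable.mul_left _ (summable_sum fun i _ => summable_sum fun j _ => hs i j i j)
  -- The cross terms add up to the square of the backward divergence. Solenoidality refers to the
  -- central divergence and would not make this vanish, but its sign suffices.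
  have e2 : ∑' z, ∑ i, ∑ j, dPlus h j (fun y => w y i) z * dPlus h i (fun y => w y j) z
      = ∑' z, (∑ i, dMinus h i (fun y => w y i) z) ^ 2 := by
    simp_rw [sq, Finset.sum_mul_sum]
    rw [Summable.tsum_finsetSum fun i _ => summable_sum fun j _ => hs i j i j,
      Summable.tsum_finsetSum fun i _ => summable_sum fun j _ => hm i j]
    refine Finset.sum_congr rfl fun i _ => ?_
    rw [Summable.tsum_finsetSum fun j _ => hs i j i j, Summable.tsum_finsetSum fun j _ => hm i j]
    exact Finset.sum_congr rfl fun j _ => tsum_dPlus_mul_dPlus h j i (finite_support_apply hw i)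
      (finite_support_apply hw j)
  rw [e1, e2]
  have : 0 ≤ ∑' z, (∑ i, dMinus h i (fun y => w y i) z) ^ 2 := tsum_nonneg fun z => sq_nonneg _
  linarith

/-! ### The momentum operator -/

/-- The linear part of the discrete momentum equation, applied to the unknown velocity `w`. -/
def momentumOp (h τ : ℝ) (η η' : Idx → ℝ) (ũ : Idx → E3) (m : Idx → ℝ) (w : Idx → E3) (z : Idx)
    (i : Fin 3) : ℝ :=
  η' z * w z i * (1 / τ) + dDiv h (fun y => η y • ũ y) z * w z i
    + ∑ j, 1 / 2 *
        (η (z - unitIdx j) * ũ (z - unitIdx j) j * dCentral h j (fun y => w y i) (z - unitIdx j)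
          + η (z + unitIdx j) * ũ (z + unitIdx j) j
            * dCentral h j (fun y => w y i) (z + unitIdx j))
    - ∑ j, dMinus h j (fun y => m y *
        (dPlus h j (fun y' => w y' i) y + dPlus h i (fun y' => w y' j) y)) z

/-- The discrete energy identity. -/
theorem tsum_momentumOp (h τ : ℝ) (η η' : Idx → ℝ) (ũ : Idx → E3) (m : Idx → ℝ) {w : Idx → E3}
    (hw : w.support.Finite) :
    ∑' z, ∑ i, momentumOp h τ η η' ũ m w z i * w z i
      = ∑' z, (η' z * (1 / τ) + 1 / 2 * dDiv h (fun y => η y • ũ y) z) * ‖w z‖ ^ 2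
        + ∑' z, 1 / 2 * m z * ∑ i, ∑ j,
          (dPlus h j (fun y => w y i) z + dPlus h i (fun y => w y j) z) ^ 2 := by
  have hs : ∀ F : Idx → Fin 3 → ℝ, ∀ i, Summable fun z => F z i * w z i := fun F i =>
    summable_of_imp_field hw fun z hz => by simp [hz]
  have hs2 : ∀ F : Idx → ℝ, ∀ i, Summable fun z => F z * w z i ^ 2 := fun F i =>
    summable_of_imp_field hw fun z hz => by simp [hz]
  have hp : ∀ i j, (dPlus h j (fun y => w y i)).support.Finite := fun i j =>
    finite_support_dPlus h j (finite_support_apply hw i)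
  have hX : ∀ i j k l, ∀ F : Idx → ℝ, Summable fun z => F z *
      (dPlus h j (fun y => w y i) z + dPlus h i (fun y => w y j) z)
        * dPlus h k (fun y => w y l) z := fun i j k l F =>
    summable_of_imp (hp l k) fun z hz => by simp [hz]
  set d := dDiv h (fun y => η y • ũ y) with hd
  -- The explicit divergence term contributes `d` and the skew convection term `-d / 2`, which
  -- leaves the coefficient `1 / 2` in the identity.
  have e1 : ∀ i, ∑' z, momentumOp h τ η η' ũ m w z i * w z i
      = ∑' z, (η' z * (1 / τ) + d z) * w z i ^ 2
        + ∑ j, ∑' z, -(1 / 2) * (dCentral h j (fun y => η y * ũ y j) z * w z i ^ 2)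
        + ∑ j, ∑' z, m z * (dPlus h j (fun y => w y i) z + dPlus h i (fun y => w y j) z)
            * dPlus h j (fun y => w y i) z := by
    intro i
    have c1 : ∀ j, ∑' z, -(1 / 2) * (dCentral h j (fun y => η y * ũ y j) z * w z i ^ 2)
        = ∑' z, 1 / 2 * (η (z - unitIdx j) * ũ (z - unitIdx j) j
              * dCentral h j (fun y => w y i) (z - unitIdx j)
            + η (z + unitIdx j) * ũ (z + unitIdx j) j
              * dCentral h j (fun y => w y i) (z + unitIdx j)) * w z i := fun j =>
      (tsum_convection_mul h j (finite_support_apply hw i) fun y => η y * ũ y j).symm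
    have c2 : ∀ j, ∑' z, m z * (dPlus h j (fun y => w y i) z + dPlus h i (fun y => w y j) z)
          * dPlus h j (fun y => w y i) z
        = ∑' z, -dMinus h j (fun y => m y *
          (dPlus h j (fun y' => w y' i) y + dPlus h i (fun y' => w y' j) y)) z * w z i := by
      intro j
      simp_rw [neg_mul]
      rw [tsum_neg, tsum_dMinus_mul h j (finite_support_apply hw i), neg_neg]
    simp_rw [c1, c2]
    rw [← Summable.tsum_finsetSum fun j _ => hs (fun z _ => _) i,
      ← Summable.tsum_finsetSum fun j _ => hs (fun z _ => _) i, ← Summable.tsum_add,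
      ← Summable.tsum_add]
    · refine tsum_congr fun z => ?_
      simp only [momentumOp, Fin.sum_univ_three, ← hd]
      ring
    · exact (hs2 _ i).add (summable_sum fun j _ => hs (fun z _ => _) i)
    · exact summable_sum fun j _ => hs (fun z _ => _) i
    · exact hs2 _ i
    · exact summable_sum fun j _ => hs (fun z _ => _) i
  rw [Summable.tsum_finsetSum fun i _ => hs _ i]
  simp_rw [e1]
  rw [Finset.sum_add_distrib, Finset.sum_add_distrib]
  congr 1
  · simp_rw [← Summable.tsum_finsetSum fun j (_ : j ∈ Finset.univ) =>
      ((hs2 (dCentral h j (fun y => η y * ũ y j)) _).mul_left (-(1 / 2)))]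
    rw [← Summable.tsum_finsetSum fun i _ => hs2 _ i, ← Summable.tsum_finsetSum,
      ← Summable.tsum_add]
    · refine tsum_congr fun z => ?_
      have : d z = ∑ j, dCentral h j (fun y => η y * ũ y j) z := by simp [hd, dDiv]
      simp only [this, EuclideanSpace.norm_sq_eq, Real.norm_eq_abs, sq_abs, Fin.sum_univ_three]
      ring
    · exact summable_sum fun i _ => hs2 _ i
    · exact summable_sum fun i _ => summable_sum fun j _ => (hs2 _ i).mul_left _
    · exact fun i _ => summable_sum fun j _ => (hs2 _ i).mul_left _
  -- The symmetric gradient paired with the full gradient is half its own square, by exchanging `i`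
  -- and `j`.
  · simp_rw [← Summable.tsum_finsetSum fun j (_ : j ∈ Finset.univ) => hX _ j j _ m]
    rw [← Summable.tsum_finsetSum fun i _ => summable_sum fun j _ => hX i j j i m]
    refine tsum_congr fun z => ?_
    simp only [Fin.sum_univ_three]
    ring

/-! ### Geometry of the grid -/

theorem finite_grid {Ω : Set E3} (hΩ : Bornology.IsBounded Ω) {h : ℝ} (hh : 0 < h) :
    (grid Ω h).Finite := by
  obtain ⟨R, hR⟩ := hΩ.exists_norm_le
  refine (Set.finite_Icc (fun _ : Fin 3 => -⌈R / h⌉) (fun _ : Fin 3 => ⌈R / h⌉)).subset ?_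
  intro z hz
  have key : ∀ i, |(z i : ℝ)| ≤ ⌈R / h⌉ := fun i => by
    have h1 : |h * (z i : ℝ)| ≤ R := (PiLp.norm_apply_le (gridPt h z) i).trans (hR _ hz.1)
    rw [abs_mul, abs_of_pos hh] at h1
    refine le_trans ?_ (Int.le_ceil _)
    rw [le_div_iff₀ hh]
    linarith
  rw [mem_Icc, Pi.le_def, Pi.le_def]
  refine ⟨fun i => ?_, fun i => ?_⟩
  · have := (abs_le.1 (key i)).1
    exact_mod_cast this
  · have := (abs_le.1 (key i)).2
    exact_mod_cast this

theorem add_mem_of_interior {G : Set Idx} {z : Idx} (hz : z ∈ G \ gridBoundary G) (i : Fin 3) :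
    z + unitIdx i ∈ G ∧ z - unitIdx i ∈ G := by
  by_contra hc
  exact hz.2 ⟨hz.1, i, not_and_or.1 hc⟩

/-- Half the side is `2 * h` and the shift adds at most `h`, so each coordinate moves by at most `3
* h`; the Euclidean distance is at most `√27 * h < 6 * h`. -/
theorem cube_gridPt_subset {h : ℝ} (hh : 0 < h) (z e : Idx) (he : ∀ i, |e i| ≤ 1) :
    cube (4 * h) (gridPt h (z + e)) ⊆ Metric.closedBall (gridPt h z) (6 * h) := by
  intro y hy
  rw [Metric.mem_closedBall, dist_eq_norm, EuclideanSpace.norm_eq]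
  have key : ∀ i, ‖(y - gridPt h z) i‖ ^ 2 ≤ (3 * h) ^ 2 := fun i => by
    have h1 := hy i
    have h2 : |(e i : ℝ)| ≤ 1 := by exact_mod_cast he i
    rw [abs_le] at h2
    simp only [gridPt, Pi.add_apply, Int.cast_add] at h1
    rw [Real.norm_eq_abs]
    refine pow_le_pow_left₀ (abs_nonneg _) ?_ 2
    simp only [PiLp.sub_apply, gridPt]
    rw [abs_le]
    constructor <;> nlinarith
  refine Real.sqrt_le_iff.2 ⟨by positivity, ?_⟩
  rw [Fin.sum_univ_three]
  nlinarith [key 0, key 1, key 2]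

theorem abs_unitIdx_le (i k : Fin 3) : |unitIdx i k| ≤ 1 := by
  rw [unitIdx, Pi.single_apply]
  split_ifs <;> simp

/-- For small mesh sizes the grid of `Ω` lies in the interior of the grid of the larger domain. -/
theorem grid_subset_interior {Ω Ω' : Set E3} {ε₀ h : ℝ}
    (hΩΩ' : ∀ x ∈ Ω, Metric.closedBall x ε₀ ⊆ Ω') (hh : 0 < h) (hε : 6 * h ≤ ε₀) :
    grid Ω h ⊆ grid Ω' h \ gridBoundary (grid Ω' h) := by
  intro z hz
  have key : ∀ e : Idx, (∀ i, |e i| ≤ 1) → z + e ∈ grid Ω' h := fun e he => by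
    have h1 : cube (4 * h) (gridPt h (z + e)) ⊆ Ω' :=
      ((cube_gridPt_subset hh z e he).trans (Metric.closedBall_subset_closedBall hε)).trans
        (hΩΩ' _ hz.1)
    exact ⟨h1 fun i => ⟨by linarith, by linarith⟩, h1⟩
  refine ⟨by simpa using key 0 (by simp), fun hb => ?_⟩
  obtain ⟨-, i, hi | hi⟩ := hb
  · exact hi (key _ (abs_unitIdx_le i))
  · exact hi (sub_eq_add_neg z _ ▸ key (-unitIdx i) fun k => by simpa using abs_unitIdx_le i k)

theorem cell_subset_of_mem_grid {Ω : Set E3} {h : ℝ} (hh : 0 < h) {z : Idx} (hz : z ∈ grid Ω h) :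
    cell h z ⊆ Ω := fun y hy => hz.2 fun i => ⟨by linarith [(hy i).1], by linarith [(hy i).2]⟩

/-- Interior points have all their neighbours in `G`, so a point outside `G` has no interior
neighbour and its central differences only see zeros. Having the constraint on the whole grid
matters for local averages, whose windows may leave `G`. -/
theorem dDiv_eq_zero {G : Set Idx} {h : ℝ} {w : Idx → E3}
    (hw : ∀ z, z ∉ G \ gridBoundary G → w z = 0) (hd : ∀ z ∈ G, dDiv h w z = 0) (z : Idx) :
    dDiv h w z = 0 := by
  by_cases hz : z ∈ G
  · exact hd z hz
  · have h1 : ∀ i, w (z + unitIdx i) = 0 := fun i => hw _ fun hi => hz (by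
      simpa using (add_mem_of_interior hi i).2)
    have h2 : ∀ i, w (z - unitIdx i) = 0 := fun i => hw _ fun hi => hz (by
      simpa using (add_mem_of_interior hi i).1)
    simp [dDiv, dCentral, h1, h2]

/-! ### Truncated fields -/

/-- Averaging over translates commutes with the translation-invariant difference operators. -/
theorem dDiv_localAverage (h : ℝ) (k : ℕ) {w : Idx → E3} (hw : ∀ z, dDiv h w z = 0) (z : Idx) :
    dDiv h (localAverage k w) z = 0 := by
  have key : dDiv h (localAverage k w) z = ((2 * (k : ℝ) + 1) ^ 3)⁻¹ *
      ∑ y ∈ Finset.Icc (fun _ : Fin 3 => -(k : ℤ)) (fun _ : Fin 3 => (k : ℤ)),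
        dDiv h w (z + y) := by
    have hs : ∀ i : Fin 3, ∀ y : Idx, z + y + unitIdx i = z + unitIdx i + y := fun i y => by abel
    have hs' : ∀ i : Fin 3, ∀ y : Idx, z + y - unitIdx i = z - unitIdx i + y := fun i y => by abel
    simp only [dDiv, dCentral, localAverage, PiLp.smul_apply, WithLp.ofLp_sum, Finset.sum_apply,
      smul_eq_mul, Fin.sum_univ_three, hs, hs', Finset.sum_add_distrib, ← Finset.mul_sum,
      Finset.sum_sub_distrib]
    ring
  rw [key]
  simp [hw]

theorem norm_localAverage_le (k : ℕ) {w : Idx → E3} (hw : w.support.Finite) (z : Idx) :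
    ‖localAverage k w z‖ ≤ ((2 * (k : ℝ) + 1) ^ 3)⁻¹ * ∑' y, ‖w y‖ := by
  rw [localAverage, norm_smul, Real.norm_eq_abs, abs_of_nonneg (by positivity)]
  refine mul_le_mul_of_nonneg_left ((norm_sum_le _ _).trans ?_) (by positivity)
  have hs : Summable fun y => ‖w (y + z)‖ :=
    summable_of_eq_zero_off (finite_support_shift hw z) fun y hy => by simpa using hy
  rw [← tsum_shift z fun y => ‖w y‖]
  simp_rw [add_comm z]
  exact hs.sum_le_tsum _ fun y _ => norm_nonneg _

/-- Averages of a finitely supported field decay like `(2 * k + 1) ^ (-3)`, so some `k` is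
admissible. Hence the infimum in `truncIndex` is attained and is not the default value for the empty
set. -/
theorem norm_truncField_le (α : ℝ) {h : ℝ} (hh : 0 < h) {w : Idx → E3} (hw : w.support.Finite)
    (z : Idx) : ‖truncField α h w z‖ ≤ 2 / 7 * h ^ (-1 + α) := by
  have hne : {k : ℕ | ∀ z, ‖localAverage k w z‖ ≤ 2 / 7 * h ^ (-1 + α)}.Nonempty := by
    have hpos : 0 < 2 / 7 * h ^ (-1 + α) := mul_pos (by norm_num) (Real.rpow_pos_of_pos hh _)
    have h1 : Tendsto (fun k : ℕ => (2 * (k : ℝ) + 1) ^ 3) atTop atTop :=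
      (tendsto_pow_atTop (by norm_num)).comp (tendsto_atTop_add_const_right _ _
        (tendsto_natCast_atTop_atTop.const_mul_atTop (by norm_num)))
    have h2 := (h1.inv_tendsto_atTop).mul_const (∑' y, ‖w y‖)
    rw [zero_mul] at h2
    obtain ⟨k, hk⟩ := (h2.eventually (gt_mem_nhds hpos)).exists
    exact ⟨k, fun z => (norm_localAverage_le k hw z).trans hk.le⟩
  exact Nat.sInf_mem hne z

theorem dDiv_truncField (α h : ℝ) {w : Idx → E3} (hw : ∀ z, dDiv h w z = 0) (z : Idx) :
    dDiv h (truncField α h w) z = 0 := dDiv_localAverage h _ hw z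

/-! ### The discrete maximum principle -/

/-- One explicit step of the discrete continuity equation preserves positivity. -/
theorem transport_nonneg {h τ : ℝ} {g : Idx → ℝ} {ũ : Idx → E3} {z : Idx}
    (hũ : ∀ z j, |τ * (2 * h)⁻¹ * ũ z j| ≤ 1 / 7) (h0 : 0 ≤ g z)
    (h1 : ∀ j, 0 ≤ g (z + unitIdx j)) (h2 : ∀ j, 0 ≤ g (z - unitIdx j)) :
    0 ≤ stencilMean g z - τ * dDiv h (fun y => g y • ũ y) z := by
  -- In this form the update is a sum of stencil values with the weights `1 / 7` and `1 / 7 ∓ τ * (2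
  -- * h)⁻¹ * ũ`, which are nonnegative under the Courant condition.
  have e : stencilMean g z - τ * dDiv h (fun y => g y • ũ y) z = 1 / 7 * g z
      + ∑ j, ((1 / 7 - τ * (2 * h)⁻¹ * ũ (z + unitIdx j) j) * g (z + unitIdx j)
        + (1 / 7 + τ * (2 * h)⁻¹ * ũ (z - unitIdx j) j) * g (z - unitIdx j)) := by
    simp only [stencilMean, dDiv, dCentral, smul_eq_mul, PiLp.smul_apply, Fin.sum_univ_three]
    ring
  rw [e]
  refine add_nonneg (by positivity) (Finset.sum_nonneg fun j _ => add_nonneg ?_ ?_)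
  · exact mul_nonneg (by linarith [(abs_le.1 (hũ (z + unitIdx j) j)).2]) (h1 j)
  · exact mul_nonneg (by linarith [(abs_le.1 (hũ (z - unitIdx j) j)).1]) (h2 j)

/-- The discrete maximum principle for solenoidal transport fields. -/
theorem transport_mem_Icc {G : Set Idx} {h τ lo hi : ℝ} {g : Idx → ℝ} {ũ : Idx → E3}
    (hũ : ∀ z j, |τ * (2 * h)⁻¹ * ũ z j| ≤ 1 / 7) (hd : ∀ z, dDiv h ũ z = 0)
    (hg : ∀ z ∈ G, g z ∈ Icc lo hi) {z : Idx} (hz : z ∈ G \ gridBoundary G) :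
    stencilMean g z - τ * dDiv h (fun y => g y • ũ y) z ∈ Icc lo hi := by
  have hp := fun j => (add_mem_of_interior hz j).1
  have hm := fun j => (add_mem_of_interior hz j).2
  have hdz : ∑ j, (2 * h)⁻¹ * (ũ (z + unitIdx j) j - ũ (z - unitIdx j) j) = 0 := by
    simpa [dDiv, dCentral] using hd z
  have e1 : ∀ c s : ℝ, stencilMean (fun y => s * (g y - c)) z
        - τ * dDiv h (fun y => (s * (g y - c)) • ũ y) z
      = s * (stencilMean g z - τ * dDiv h (fun y => g y • ũ y) z - c) := fun c s => by
    simp only [stencilMean, dDiv, dCentral, smul_eq_mul, PiLp.smul_apply, Fin.sum_univ_three]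
      at hdz ⊢
    linear_combination s * τ * c * hdz
  constructor
  · have := transport_nonneg (g := fun y => 1 * (g y - lo)) hũ
      (by linarith [(hg z hz.1).1]) (fun j => by linarith [(hg _ (hp j)).1])
      (fun j => by linarith [(hg _ (hm j)).1])
    rw [e1] at this
    linarith
  · have := transport_nonneg (g := fun y => -1 * (g y - hi)) hũ
      (by linarith [(hg z hz.1).2]) (fun j => by linarith [(hg _ (hp j)).2])
      (fun j => by linarith [(hg _ (hm j)).2])
    rw [e1] at this
    linarith

theorem timeStep_pos (α : ℝ) {h : ℝ} (hh : 0 < h) : 0 < timeStep α h := Real.rpow_pos_of_pos hh _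

/-- The truncation threshold is made for this: `τ * h ^ (-1 + α) = h`, so the ratio is `(2 * h)⁻¹ *
(2 / 7) * h = 1 / 7`. -/
theorem courant_bound {α h : ℝ} (hh : 0 < h) {ũ : Idx → E3}
    (hũ : ∀ z, ‖ũ z‖ ≤ 2 / 7 * h ^ (-1 + α)) (z : Idx) (j : Fin 3) :
    |timeStep α h * (2 * h)⁻¹ * ũ z j| ≤ 1 / 7 := by
  have hτ := timeStep_pos α hh
  rw [abs_mul, abs_of_nonneg (by positivity)]
  have h1 : |ũ z j| ≤ 2 / 7 * h ^ (-1 + α) := (PiLp.norm_apply_le (ũ z) j).trans (hũ z)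
  have h2 : timeStep α h * h ^ (-1 + α) = h := by
    rw [timeStep, ← Real.rpow_add hh]
    norm_num
  calc timeStep α h * (2 * h)⁻¹ * |ũ z j|
      ≤ timeStep α h * (2 * h)⁻¹ * (2 / 7 * h ^ (-1 + α)) := by gcongr
    _ = (2 * h)⁻¹ * (2 / 7) * (timeStep α h * h ^ (-1 + α)) := by ring
    _ = 1 / 7 := by rw [h2]; field_simp

/-! ### Cells and cell averages -/

theorem cell_eq_preimage (h : ℝ) (z : Idx) :
    cell h z = (MeasurableEquiv.toLp 2 (Fin 3 → ℝ)).symm ⁻¹'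
      Set.pi univ fun i => Ico (h * (z i : ℝ)) (h * z i + h) := by
  ext y
  simp [cell, gridPt]

theorem measurableSet_cell (h : ℝ) (z : Idx) : MeasurableSet (cell h z) := by
  rw [cell_eq_preimage]
  exact (MeasurableEquiv.measurable _) (MeasurableSet.univ_pi fun i => measurableSet_Ico)

theorem volume_cell {h : ℝ} (hh : 0 < h) (z : Idx) :
    volume (cell h z) = ENNReal.ofReal (h ^ 3) := by
  rw [cell_eq_preimage,
    (EuclideanSpace.volume_preserving_symm_measurableEquiv_toLp (Fin 3)).measure_preimage
      (MeasurableSet.univ_pi fun i => measurableSet_Ico).nullMeasurableSet, volume_pi_pi]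
  simp [Real.volume_Ico, ENNReal.ofReal_pow hh.le]

theorem volume_real_cell {h : ℝ} (hh : 0 < h) (z : Idx) :
    (volume : Measure E3).real (cell h z) = h ^ 3 := by
  rw [Measure.real, volume_cell hh, ENNReal.toReal_ofReal (by positivity)]

theorem measurable_cellIdx (h : ℝ) : Measurable (cellIdx h) :=
  measurable_pi_lambda _ fun i => Int.measurable_floor.comp
    (Measurable.div_const (by fun_prop) h)

/-- A cell average inherits almost everywhere bounds. The upper end is a maximum because cells may
meet the complement of `Ω`, where the density is `ρlo`, and `ρlo ≤ ρhi` is not among the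
assumptions. -/
theorem densityInit_mem_Icc {Ω : Set E3} (hΩ : IsOpen Ω) {ρ0 : Lp ℝ ⊤ (volume.restrict Ω)}
    {ρlo ρhi : ℝ} (hρ0 : ∀ᵐ x ∂(volume.restrict Ω), ρlo ≤ ρ0 x ∧ ρ0 x ≤ ρhi)
    {h : ℝ} (hh : 0 < h) (z : Idx) :
    densityInit ρ0 ρlo h z ∈ Icc ρlo (max ρlo ρhi) := by
  classical
  have hae : ∀ᵐ x, extendDensity ρ0 ρlo x ∈ Icc ρlo (max ρlo ρhi) := by
    rw [ae_restrict_iff' hΩ.measurableSet] at hρ0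
    filter_upwards [hρ0] with x hx
    rw [extendDensity]
    split_ifs with hxΩ
    · exact ⟨(hx hxΩ).1, (hx hxΩ).2.trans (le_max_right _ _)⟩
    · exact ⟨le_rfl, le_max_left _ _⟩
  have hmeas : StronglyMeasurable (extendDensity ρ0 ρlo) := by
    have : StronglyMeasurable fun x => if x ∈ Ω then ρ0 x else ρlo :=
      StronglyMeasurable.ite hΩ.measurableSet (Lp.stronglyMeasurable ρ0) stronglyMeasurable_const
    convert this using 1
    ext x
    rw [extendDensity]
  have hfin : volume (cell h z) ≠ ⊤ := by rw [volume_cell hh]; exact ENNReal.ofReal_ne_top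
  have hint : IntegrableOn (extendDensity ρ0 ρlo) (cell h z) := by
    refine Measure.integrableOn_of_bounded (M := |ρlo| + |max ρlo ρhi|) hfin
      hmeas.aestronglyMeasurable (ae_restrict_of_ae (hae.mono fun x hx => ?_))
    rw [Real.norm_eq_abs, abs_le]
    constructor <;> cases abs_cases ρlo <;> cases abs_cases (max ρlo ρhi) <;>
      linarith [hx.1, hx.2]
  have hc : ∀ c : ℝ, ∫ _ in cell h z, c = h ^ 3 * c := fun c => by
    rw [setIntegral_const, volume_real_cell hh, smul_eq_mul]
  have hcint : ∀ c : ℝ, IntegrableOn (fun _ : E3 => c) (cell h z) := fun c =>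
    integrableOn_const hfin
  have h3 : 0 < h ^ 3 := by positivity
  rw [densityInit, mem_Icc, ← div_eq_inv_mul, le_div_iff₀ h3, div_le_iff₀ h3, mul_comm ρlo,
    mul_comm (max ρlo ρhi), ← hc, ← hc]
  exact ⟨setIntegral_mono_ae (hcint _) hint (hae.mono fun x hx => hx.1),
    setIntegral_mono_ae hint (hcint _) (hae.mono fun x hx => hx.2)⟩

/-! ### Solvability of the discrete problem -/

/-- Solvability of a finite-dimensional saddle point problem. -/
theorem exists_saddle_point {E F : Type} [NormedAddCommGroup E] [InnerProductSpace ℝ E]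
    [FiniteDimensional ℝ E] [NormedAddCommGroup F] [InnerProductSpace ℝ F] [FiniteDimensional ℝ F]
    (A : E →ₗ[ℝ] E) (B : E →ₗ[ℝ] F) (hA : ∀ w, B w = 0 → w ≠ 0 → 0 < inner ℝ (A w) w) (f : E) :
    ∃ u p, B u = 0 ∧ A u + B.adjoint p = f := by
  let K := LinearMap.ker B
  let π : E →ₗ[ℝ] K := (K.orthogonalProjectionOnto : E →L[ℝ] K)
  let L : K →ₗ[ℝ] K := π ∘ₗ A ∘ₗ K.subtype
  -- The compression of `A` to `ker B` is injective by positivity, hence bijective in finite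
  -- dimension.
  have hL : Function.Injective L := by
    rw [← LinearMap.ker_eq_bot, LinearMap.ker_eq_bot']
    intro w hw
    by_contra hne
    have h1 := hA w w.2 (by simpa using hne)
    have h2 : inner ℝ (A w) (w : E) = inner ℝ ((L w : K) : E) (w : E) := by
      exact (Submodule.inner_orthogonalProjectionOnto_eq_of_mem_right w (A w)).symm
    rw [h2, hw] at h1
    simp at h1
  obtain ⟨u, hu⟩ := LinearMap.injective_iff_surjective.1 hL (π f)
  -- The residual is orthogonal to `ker B` and thus in the range of the adjoint, which yields the
  -- multiplier `p`. Surjectivity of `B` is not needed, so redundant constraints do no harm.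
  have h1 : f - A u ∈ Kᗮ := by
    rw [← Submodule.orthogonalProjectionOnto_eq_zero_iff, map_sub, sub_eq_zero]
    exact hu.symm
  rw [LinearMap.orthogonal_ker] at h1
  obtain ⟨p, hp⟩ := h1
  exact ⟨u, p, u.2, by rw [hp]; abel⟩

/-! ### Coordinate vectors on a finite set of grid points as fields on the whole grid -/

section Extension

variable (J : Finset Idx)

open Classical in
/-- Extension by zero of a vector field on a finite part of the grid. -/
def extendField : EuclideanSpace ℝ (J × Fin 3) →ₗ[ℝ] Idx → E3 where
  toFun w z := if hz : z ∈ J then WithLp.toLp 2 fun i => w (⟨z, hz⟩, i) else 0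
  map_add' v w := by
    ext z i
    by_cases hz : z ∈ J <;> simp [hz]
  map_smul' c w := by
    ext z i
    by_cases hz : z ∈ J <;> simp [hz]

variable {J}

theorem extendField_of_mem (w : EuclideanSpace ℝ (J × Fin 3)) {z : Idx} (hz : z ∈ J) (i : Fin 3) :
    extendField J w z i = w (⟨z, hz⟩, i) := by
  simp [extendField, hz]

theorem extendField_of_notMem (w : EuclideanSpace ℝ (J × Fin 3)) {z : Idx} (hz : z ∉ J) :
    extendField J w z = 0 := by
  simp [extendField, hz]

theorem finite_support_extendField (w : EuclideanSpace ℝ (J × Fin 3)) :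
    (extendField J w).support.Finite :=
  J.finite_toSet.subset fun z hz => by
    by_contra h
    exact hz (extendField_of_notMem w h)

theorem inner_toLp_extendField (F : Idx → Fin 3 → ℝ) (w : EuclideanSpace ℝ (J × Fin 3)) :
    inner ℝ (WithLp.toLp 2 fun k : J × Fin 3 => F k.1 k.2) w
      = ∑' z, ∑ i, F z i * extendField J w z i := by
  rw [tsum_eq_sum (s := J) fun z hz => by simp [extendField_of_notMem w hz], PiLp.inner_apply,
    Fintype.sum_prod_type, ← Finset.sum_coe_sort J]
  refine Finset.sum_congr rfl fun z _ => Finset.sum_congr rfl fun i _ => ?_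
  rw [extendField_of_mem w z.2]
  simp [mul_comm]

end Extension

/-- Solvability of linear problems with a discrete incompressibility constraint. -/
theorem exists_grid_saddle_point {G : Set Idx} (hG : G.Finite) (h : ℝ)
    (A : (Idx → E3) →ₗ[ℝ] Idx → Fin 3 → ℝ)
    (hA : ∀ w : Idx → E3, (∀ z, z ∉ G \ gridBoundary G → w z = 0) → w ≠ 0 →
      0 < ∑' z, ∑ i, A w z i * w z i) (F : Idx → Fin 3 → ℝ) :
    ∃ (u : Idx → E3) (q : Idx → ℝ), (∀ z, z ∉ G \ gridBoundary G → u z = 0) ∧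
      (∀ z ∈ G, dDiv h u z = 0) ∧
      ∀ z ∈ G \ gridBoundary G, ∀ i, A u z i + dCentral h i q z = F z i := by
  classical
  obtain ⟨J, hJ⟩ := (hG.subset (sdiff_subset : G \ gridBoundary G ⊆ G)).exists_finset
  obtain ⟨G₁, hG₁⟩ := hG.exists_finset
  let ext := extendField J
  have hext : ∀ w z, z ∉ G \ gridBoundary G → ext w z = 0 := fun w z hz =>
    extendField_of_notMem w fun h => hz ((hJ z).1 h)
  -- The unknowns sit at the interior points `J`, while the constraint is imposed at all points `G₁`
  -- of the grid; the multiplier therefore lives on `G₁`.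
  let A' : EuclideanSpace ℝ (J × Fin 3) →ₗ[ℝ] EuclideanSpace ℝ (J × Fin 3) :=
    { toFun := fun w => WithLp.toLp 2 fun k => A (ext w) k.1 k.2
      map_add' := fun v w => by ext k; simp
      map_smul' := fun c w => by ext k; simp }
  let B : EuclideanSpace ℝ (J × Fin 3) →ₗ[ℝ] EuclideanSpace ℝ G₁ :=
    { toFun := fun w => WithLp.toLp 2 fun k => dDiv h (ext w) k
      map_add' := fun v w => by
        ext k
        simp only [map_add, dDiv, dCentral, PiLp.add_apply, Pi.add_apply, smul_eq_mul,
          Fin.sum_univ_three]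
        ring
      map_smul' := fun c w => by
        ext k
        simp only [map_smul, dDiv, dCentral, PiLp.smul_apply, Pi.smul_apply, smul_eq_mul,
          Fin.sum_univ_three, RingHom.id_apply]
        ring }
  have hinj : ∀ w, ext w = 0 → w = 0 := fun w hw => by
    ext k
    rw [← extendField_of_mem w k.1.2]
    exact congrFun (congrArg WithLp.ofLp (congrFun hw k.1)) k.2
  obtain ⟨u, p, hu, hup⟩ := exists_saddle_point A' B (fun w _ hw => by
    have h1 := hA (ext w) (hext w) fun h0 => hw (hinj w h0)
    rwa [← inner_toLp_extendField (A (ext w)) w] at h1)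
    (WithLp.toLp 2 fun k => F k.1 k.2)
  -- The sign is changed because the adjoint of the discrete divergence is minus the discrete
  -- gradient.
  let q : Idx → ℝ := fun z => if hz : z ∈ G₁ then -p ⟨z, hz⟩ else 0
  refine ⟨ext u, q, hext u, fun z hz => ?_, fun z hz i => ?_⟩
  · exact congrFun (congrArg WithLp.ofLp hu) ⟨z, (hG₁ z).2 hz⟩
  · have hzJ := (hJ z).2 hz
    have h1 := congrFun (congrArg WithLp.ofLp hup) (⟨z, hzJ⟩, i)
    simp only [PiLp.add_apply] at h1
    change A (ext u) z i + _ = F z i at h1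
    rw [← h1]
    congr 1
    -- Pairing with this unit vector isolates one component of `B.adjoint p`, which summation by
    -- parts identifies as a component of the gradient of `q`.
    let s : EuclideanSpace ℝ (J × Fin 3) := EuclideanSpace.single (⟨z, hzJ⟩, i) 1
    have h2 : (B.adjoint p) (⟨z, hzJ⟩, i) = inner ℝ (B.adjoint p) s := by
      simp [s, EuclideanSpace.inner_single_right]
    have h3 : inner ℝ p (B s) = -∑' z, q z * dDiv h (ext s) z := by
      rw [tsum_eq_sum (s := G₁) fun z hz => by simp [q, hz], PiLp.inner_apply,
        ← Finset.sum_coe_sort G₁, ← Finset.sum_neg_distrib]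
      refine Finset.sum_congr rfl fun k _ => ?_
      simp [q, B, mul_comm]
    rw [h2, LinearMap.adjoint_inner_left, h3,
      ← tsum_dCentral_inner h (finite_support_extendField s),
      ← inner_toLp_extendField fun z i => dCentral h i q z]
    simp [s, EuclideanSpace.inner_single_right]

theorem momentumOp_add (h τ : ℝ) (η η' : Idx → ℝ) (ũ : Idx → E3) (m : Idx → ℝ) (v w : Idx → E3) :
    momentumOp h τ η η' ũ m (v + w)
      = momentumOp h τ η η' ũ m v + momentumOp h τ η η' ũ m w := by
  ext z i
  simp only [momentumOp, dCentral, dMinus, dPlus, Pi.add_apply, PiLp.add_apply, smul_eq_mul,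
    Fin.sum_univ_three]
  ring

theorem momentumOp_smul (h τ : ℝ) (η η' : Idx → ℝ) (ũ : Idx → E3) (m : Idx → ℝ) (c : ℝ)
    (w : Idx → E3) : momentumOp h τ η η' ũ m (c • w) = c • momentumOp h τ η η' ũ m w := by
  ext z i
  simp only [momentumOp, dCentral, dMinus, dPlus, Pi.smul_apply, PiLp.smul_apply, smul_eq_mul,
    Fin.sum_univ_three]
  ring

theorem stencilMean_nonneg {g : Idx → ℝ} {z : Idx} (h0 : 0 ≤ g z)
    (h1 : ∀ j, 0 ≤ g (z + unitIdx j)) (h2 : ∀ j, 0 ≤ g (z - unitIdx j)) : 0 ≤ stencilMean g z :=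
  mul_nonneg (by norm_num) (add_nonneg h0
    (Finset.sum_nonneg fun j _ => add_nonneg (h1 j) (h2 j)))

/-- The viscous dissipation density. -/
theorem dissipation_nonneg {G : Set Idx} (h : ℝ) {m : Idx → ℝ} (hm : ∀ z ∈ G, 0 ≤ m z)
    {w : Idx → E3} (hw : ∀ z, z ∉ G \ gridBoundary G → w z = 0) (z : Idx) :
    0 ≤ 1 / 2 * m z * ∑ i, ∑ j,
          (dPlus h j (fun y => w y i) z + dPlus h i (fun y => w y j) z) ^ 2 := by
  by_cases hz : z ∈ G
  · have := hm z hz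
    positivity
  · have h0 : w z = 0 := hw z fun h => hz h.1
    have h1 : ∀ i, w (z + unitIdx i) = 0 := fun i => hw _ fun hi => hz (by
      simpa using (add_mem_of_interior hi i).2)
    simp [dPlus, h0, h1]

/-- In the energy identity the continuity equation gives `η' / τ + dDiv / 2 = (η' + stencilMean η) /
(2τ)`, which is positive on `G`; the dissipation has a good sign. -/
theorem momentumOp_pos {G : Set Idx} (hG : G.Finite) {h τ : ℝ} (hτ : 0 < τ) {η η' : Idx → ℝ}
    {ũ : Idx → E3} {m : Idx → ℝ} (hη' : ∀ z ∈ G, 0 < η' z)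
    (hmean : ∀ z ∈ G, 0 ≤ stencilMean η z)
    (hcont : ∀ z ∈ G, (η' z - stencilMean η z) * (1 / τ) + dDiv h (fun y => η y • ũ y) z = 0)
    (hm : ∀ z ∈ G, 0 ≤ m z) {w : Idx → E3} (hw : ∀ z, z ∉ G \ gridBoundary G → w z = 0)
    (hw0 : w ≠ 0) : 0 < ∑' z, ∑ i, momentumOp h τ η η' ũ m w z i * w z i := by
  have hfin : w.support.Finite := hG.subset fun z hz => by
    by_contra hzG
    exact hz (hw z fun h => hzG h.1)
  rw [tsum_momentumOp h τ η η' ũ m hfin]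
  refine add_pos_of_pos_of_nonneg ?_ (tsum_nonneg fun z => dissipation_nonneg h hm hw z)
  obtain ⟨z₀, hz₀⟩ := Function.ne_iff.1 hw0
  have hpos : ∀ z ∈ G, 0 < η' z * (1 / τ) + 1 / 2 * dDiv h (fun y => η y • ũ y) z := by
    intro z hz
    have h1 := hcont z hz
    have h2 : 0 < η' z * (1 / τ) := mul_pos (hη' z hz) (by positivity)
    have h3 : 0 ≤ stencilMean η z * (1 / τ) := mul_nonneg (hmean z hz) (by positivity)
    linarith
  have hs : Summable fun z => (η' z * (1 / τ) + 1 / 2 * dDiv h (fun y => η y • ũ y) z)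
      * ‖w z‖ ^ 2 := summable_of_imp_field hfin fun z hz => by simp [hz]
  have hmem : ∀ z, w z ≠ 0 → z ∈ G := fun z hz => by
    by_contra hzG
    exact hz (hw z fun h => hzG h.1)
  refine hs.tsum_pos (fun z => ?_) z₀ ?_
  · by_cases hz : w z = 0
    · simp [hz]
    · exact mul_nonneg (hpos z (hmem z hz)).le (sq_nonneg _)
  · exact mul_pos (hpos z₀ (hmem z₀ hz₀)) (pow_pos (norm_pos_iff.2 hz₀) 2)

/-- Existence of the discrete Helmholtz-Hodge decomposition. -/
theorem exists_helmholtzProjection {G : Set Idx} (hG : G.Finite) (h : ℝ) (u : Idx → E3) :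
    ∃ w, IsHelmholtzProjection G h u w := by
  let A : (Idx → E3) →ₗ[ℝ] Idx → Fin 3 → ℝ :=
    { toFun := fun w z i => w z i
      map_add' := fun v w => by ext; simp
      map_smul' := fun c w => by ext; simp }
  obtain ⟨w, q, h1, h2, h3⟩ := exists_grid_saddle_point hG h A (fun w hw hw0 => by
    have hfin : w.support.Finite := hG.subset fun z hz => by
      by_contra hzG
      exact hz (hw z fun h => hzG h.1)
    obtain ⟨z₀, hz₀⟩ := Function.ne_iff.1 hw0
    have e : ∀ z, ∑ i, A w z i * w z i = ‖w z‖ ^ 2 := fun z => by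
      rw [EuclideanSpace.norm_sq_eq]
      exact Finset.sum_congr rfl fun i _ => by simp [A, sq]
    simp_rw [e]
    refine Summable.tsum_pos (summable_of_imp_field hfin fun z hz => by simp [hz])
      (fun z => sq_nonneg _) z₀ (pow_pos (norm_pos_iff.2 hz₀) 2)) fun z i => u z i
  exact ⟨w, fun z hz => h1 z fun h => hz h.1, fun z hz => h1 z fun h => h.2 hz, h2, q, h3⟩

/-- Solvability of one time step of the discrete momentum equation. -/
theorem exists_velocity_step {G : Set Idx} (hG : G.Finite) {h τ : ℝ} (hτ : 0 < τ)
    {η η' : Idx → ℝ} {ũ : Idx → E3} {m : Idx → ℝ} (hη' : ∀ z ∈ G, 0 < η' z)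
    (hmean : ∀ z ∈ G, 0 ≤ stencilMean η z)
    (hcont : ∀ z ∈ G, (η' z - stencilMean η z) * (1 / τ) + dDiv h (fun y => η y • ũ y) z = 0)
    (hm : ∀ z ∈ G, 0 ≤ m z) (F : Idx → Fin 3 → ℝ) :
    ∃ (u : Idx → E3) (q : Idx → ℝ), (∀ z, z ∉ G \ gridBoundary G → u z = 0) ∧
      (∀ z ∈ G, dDiv h u z = 0) ∧ ∀ z ∈ G \ gridBoundary G, ∀ i,
        momentumOp h τ η η' ũ m u z i + dCentral h i q z = F z i :=
  exists_grid_saddle_point hG h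
    { toFun := momentumOp h τ η η' ũ m
      map_add' := momentumOp_add h τ η η' ũ m
      map_smul' := momentumOp_smul h τ η η' ũ m }
    (fun _ hw hw0 => momentumOp_pos hG hτ hη' hmean hcont hm hw hw0) F

theorem exists_seq_of_step {S : Type} (P : S → Prop) (R : ℕ → S → S → Prop) (s₀ : S) (h₀ : P s₀)
    (hstep : ∀ n s, P s → ∃ s', P s' ∧ R n s s') :
    ∃ a : ℕ → S, a 0 = s₀ ∧ ∀ n, R n (a n) (a (n + 1)) := by
  choose! g hg using hstep
  let a : ℕ → S := fun n => Nat.rec s₀ (fun n s => g n s) n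
  have hP : ∀ n, P (a n) := fun n => by
    induction n with
    | zero => exact h₀
    | succ n ih => exact (hg n _ ih).1
  exact ⟨a, rfl, fun n => (hg n _ (hP n)).2⟩

open Classical in
-- Induction in time with the invariant `P`: the density obeys the initial bounds and the transport
-- field `ũ` is truncated and solenoidal. The density update is explicit and keeps its bounds by the
-- maximum principle. The velocity update is linear because its coefficients involve only the old
-- data and the new density, with the old momentum moved to the right-hand side.
theorem exists_discreteSolution {Ω Ω' : Set E3} (hΩ_open : IsOpen Ω)
    (hΩ : Bornology.IsBounded Ω)
    {ε₀ : ℝ} (hΩΩ' : ∀ x ∈ Ω, Metric.closedBall x ε₀ ⊆ Ω') {μ : ℝ → ℝ}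
    (hμ : ∀ r, 0 ≤ r → 0 < μ r) (f : ℝ → L2On E3 Ω) (v0 : L2On E3 Ω)
    {ρ0 : Lp ℝ ⊤ (volume.restrict Ω)} {ρlo ρhi : ℝ} (hρlo : 0 < ρlo)
    (hρ0 : ∀ᵐ x ∂(volume.restrict Ω), ρlo ≤ ρ0 x ∧ ρ0 x ≤ ρhi) (α T : ℝ) {h : ℝ} (hh : 0 < h)
    (hε : 6 * h ≤ ε₀) :
    ∃ η u ũ q, IsDiscreteSolution Ω Ω' μ f v0 ρ0 ρlo α T h η u ũ q := by
  set G := grid Ω h with hGdef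
  set G' := grid Ω' h with hG'def
  set τ := timeStep α h with hτdef
  have hτ : 0 < τ := timeStep_pos α hh
  have hG : G.Finite := finite_grid hΩ hh
  have hGG' : G ⊆ G' \ gridBoundary G' := grid_subset_interior hΩΩ' hh hε
  let I := Icc ρlo (max ρlo ρhi)
  have hinit : ∀ z, densityInit ρ0 ρlo h z ∈ I := densityInit_mem_Icc hΩ_open hρ0 hh
  -- Cell averages need not vanish off the grid, so the extension by zero has to be imposed.
  let u0 : Idx → E3 := fun z => if z ∈ G then velocityInit v0 h z else 0
  obtain ⟨w, hw⟩ := exists_helmholtzProjection hG h u0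
  have hwint : ∀ z, z ∉ G \ gridBoundary G → w z = 0 := fun z hz => by
    by_cases hzG : z ∈ G
    · exact hw.zero_boundary z (by_contra fun hb => hz ⟨hzG, hb⟩)
    · exact hw.zero_outside z hzG
  have htrunc : ∀ v : Idx → E3, (∀ z, z ∉ G \ gridBoundary G → v z = 0) →
      (∀ z ∈ G, dDiv h v z = 0) → (∀ z, ‖truncField α h v z‖ ≤ 2 / 7 * h ^ (-1 + α)) ∧
        ∀ z, dDiv h (truncField α h v) z = 0 := fun v hv hd => by
    have hfin : v.support.Finite := hG.subset fun z hz => by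
      by_contra hzG
      exact hz (hv z fun h => hzG h.1)
    exact ⟨norm_truncField_le α hh hfin, dDiv_truncField α h (dDiv_eq_zero hv hd)⟩
  let P : (Idx → ℝ) × (Idx → E3) × (Idx → E3) × (Idx → ℝ) → Prop := fun s =>
    (∀ z ∈ G', s.1 z ∈ I) ∧ (∀ z, ‖s.2.2.1 z‖ ≤ 2 / 7 * h ^ (-1 + α)) ∧
      ∀ z, dDiv h s.2.2.1 z = 0
  let R : ℕ → (Idx → ℝ) × (Idx → E3) × (Idx → E3) × (Idx → ℝ) →
      (Idx → ℝ) × (Idx → E3) × (Idx → E3) × (Idx → ℝ) → Prop := fun n s s' =>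
    (∀ z, z ∉ G \ gridBoundary G → s'.2.1 z = 0) ∧ (∀ z ∈ G, dDiv h s'.2.1 z = 0) ∧
    s'.2.2.1 = truncField α h s'.2.1 ∧
    (∀ z ∈ G' \ gridBoundary G', (s'.1 z - stencilMean s.1 z) * (1 / τ)
      + dDiv h (fun y => s.1 y • s.2.2.1 y) z = 0) ∧
    (∀ z ∈ gridBoundary G', s'.1 z = densityInit ρ0 ρlo h z) ∧
    ∀ z ∈ G \ gridBoundary G, ∀ i,
      momentumOp h τ s.1 s'.1 s.2.2.1 (fun y => μ (s'.1 y)) s'.2.1 z i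
        + dCentral h i s'.2.2.2 z
      = stencilMean (fun y => s.1 y * s.2.1 y i) z * (1 / τ) + s'.1 z * forceStep f τ h n z i
  obtain ⟨a, ha0, ha⟩ := exists_seq_of_step P R
    (densityInit ρ0 ρlo h, u0, truncField α h w, 0)
    ⟨fun z _ => hinit z, (htrunc w hwint hw.div_free).1, (htrunc w hwint hw.div_free).2⟩ (by
    rintro n ⟨η, u, ũ, q⟩ ⟨hη, hũ, hd⟩
    dsimp only at hη hũ hd
    let η' : Idx → ℝ := fun z => if z ∈ gridBoundary G' then densityInit ρ0 ρlo h z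
      else stencilMean η z - τ * dDiv h (fun y => η y • ũ y) z
    have hη' : ∀ z ∈ G', η' z ∈ I := fun z hz => by
      by_cases hb : z ∈ gridBoundary G'
      · simp only [η', hb, if_true]
        exact hinit z
      · simp only [η', hb, if_false]
        exact transport_mem_Icc (courant_bound hh hũ) hd hη ⟨hz, hb⟩
    have hcont : ∀ z ∈ G' \ gridBoundary G', (η' z - stencilMean η z) * (1 / τ)
        + dDiv h (fun y => η y • ũ y) z = 0 := fun z hz => by
      simp only [η', hz.2, if_false]
      field_simp
      ring
    have hpos : ∀ z ∈ G', 0 ≤ η z := fun z hz => hρlo.le.trans (hη z hz).1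
    obtain ⟨u', q', h1, h2, h3⟩ := exists_velocity_step hG hτ (η := η) (η' := η') (ũ := ũ)
      (m := fun y => μ (η' y)) (fun z hz => hρlo.trans_le (hη' z (hGG' hz).1).1)
      (fun z hz => stencilMean_nonneg (hpos z (hGG' hz).1)
        (fun j => hpos _ (add_mem_of_interior (hGG' hz) j).1)
        (fun j => hpos _ (add_mem_of_interior (hGG' hz) j).2))
      (fun z hz => hcont z (hGG' hz))
      (fun z hz => (hμ _ (hρlo.le.trans (hη' z (hGG' hz).1).1)).le)
      (fun z i => stencilMean (fun y => η y * u y i) z * (1 / τ) + η' z * forceStep f τ h n z i)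
    refine ⟨(η', u', truncField α h u', q'), ⟨hη', htrunc u' h1 h2⟩, h1, h2, rfl, hcont,
      fun z hz => ?_, h3⟩
    simp [η', hz])
  refine ⟨fun n => (a n).1, fun n => (a n).2.1, fun n => (a n).2.2.1, fun n => (a n).2.2.2, ?_⟩
  refine ⟨fun z _ => by rw [ha0], fun z hz => by rw [ha0]; exact if_pos hz, fun n z hz => ?_,
    ⟨w, by simpa only [ha0] using hw, by rw [ha0]⟩, fun n => (ha n).2.2.1,
    fun n _ => (ha n).2.2.2.1, fun n _ z hz => ?_, fun n _ z hz i => ?_,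
    fun n _ z hz => (ha n).1 z fun h => h.2 hz, fun n _ => (ha n).2.1⟩
  · rcases n with _ | n
    · rw [ha0]
      exact if_neg hz
    · exact (ha n).1 z fun h => hz h.1
  · rw [(ha n).2.2.2.2.1 z hz, ha0]
  · have := (ha n).2.2.2.2.2 z hz i
    simp only [momentumOp, ← hτdef] at this ⊢
    linear_combination this

/-! ### Grid functions as square integrable functions -/

theorem cell_ne_top {h : ℝ} (hh : 0 < h) (z : Idx) : volume (cell h z) ≠ ⊤ := by
  rw [volume_cell hh]
  exact ENNReal.ofReal_ne_top

theorem comp_cellIdx_eq_sum {E : Type} [AddCommMonoid E] {h : ℝ} (hh : 0 < h) (F : Idx → E3 → E)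
    {S : Finset Idx} (hF : ∀ z ∉ S, F z = 0) (x : E3) :
    F (cellIdx h x) x = ∑ z ∈ S, (cell h z).indicator (F z) x := by
  classical
  simp only [indicator, mem_cell_iff hh, Finset.sum_ite_eq]
  split_ifs with hx
  · rfl
  · simp [hF _ hx]

theorem integral_comp_cellIdx {h : ℝ} (hh : 0 < h) {F : Idx → ℝ} (hF : F.support.Finite) :
    ∫ x : E3, F (cellIdx h x) = h ^ 3 * ∑' z, F z := by
  have hS : ∀ z ∉ hF.toFinset, F z = 0 := fun z hz => by simpa using hz
  rw [integral_congr_ae (Eventually.of_forall fun x => comp_cellIdx_eq_sum hh (fun z _ => F z)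
    (S := hF.toFinset) (fun z hz => by ext; exact hS z hz) x), integral_finsetSum, tsum_eq_sum hS,
    Finset.mul_sum]
  · refine Finset.sum_congr rfl fun z _ => ?_
    rw [integral_indicator (measurableSet_cell h z), setIntegral_const, volume_real_cell hh,
      smul_eq_mul]
  · exact fun z _ => (integrable_indicator_iff (measurableSet_cell h z)).2
      (integrableOn_const (cell_ne_top hh z))

/-- The cells of grid points lie inside `Ω`, so restricting the integral to `Ω` loses nothing. -/
theorem setIntegral_comp_cellIdx {Ω : Set E3} {h : ℝ} (hh : 0 < h) {F : Idx → ℝ}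
    (hfin : (grid Ω h).Finite) (hF : ∀ z, z ∉ grid Ω h → F z = 0) :
    ∫ x in Ω, F (cellIdx h x) = h ^ 3 * ∑' z, F z := by
  rw [setIntegral_eq_integral_of_forall_compl_eq_zero, integral_comp_cellIdx hh]
  · exact hfin.subset fun z hz => by_contra fun hzG => hz (hF z hzG)
  · intro x hx
    refine hF _ fun hz => hx (cell_subset_of_mem_grid hh hz ?_)
    rw [mem_cell_iff hh]

theorem memLp_comp_cellIdx {E : Type} [NormedAddCommGroup E] {Ω : Set E3} (hΩ : volume Ω ≠ ⊤)
    (h : ℝ) {a : Idx → E} {C : ℝ} (ha : ∀ z, ‖a z‖ ≤ C) :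
    MemLp (fun x => a (cellIdx h x)) 2 (volume.restrict Ω) := by
  have : IsFiniteMeasure (volume.restrict Ω) := ⟨by simpa using hΩ.lt_top⟩
  refine MemLp.of_bound ?_ C (Eventually.of_forall fun x => ha _)
  exact (StronglyMeasurable.comp_measurable (StronglyMeasurable.of_discrete (f := a))
    (measurable_cellIdx h)).aestronglyMeasurable

open Classical in
/-- The element of `L²(Ω; E)` defined by a grid function. -/
def gridL2 {E : Type} [NormedAddCommGroup E] (Ω : Set E3) (h : ℝ) (a : Idx → E) : L2On E Ω :=
  if hm : MemLp (fun x => a (cellIdx h x)) 2 (volume.restrict Ω) then hm.toLp else 0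

theorem coeFn_gridL2 {E : Type} [NormedAddCommGroup E] {Ω : Set E3} (hΩ : volume Ω ≠ ⊤)
    (h : ℝ) {a : Idx → E} {C : ℝ} (ha : ∀ z, ‖a z‖ ≤ C) :
    gridL2 Ω h a =ᵐ[volume.restrict Ω] fun x => a (cellIdx h x) := by
  rw [gridL2, dif_pos (memLp_comp_cellIdx hΩ h ha)]
  exact MemLp.coeFn_toLp _

theorem exists_bound_of_finite_support {E : Type} [NormedAddCommGroup E] {a : Idx → E}
    (ha : a.support.Finite) : ∃ C, ∀ z, ‖a z‖ ≤ C := by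
  obtain ⟨C, hC⟩ := (ha.image fun z => ‖a z‖).bddAbove
  refine ⟨max C 0, fun z => ?_⟩
  by_cases hz : a z = 0
  · simp [hz]
  · exact (hC ⟨z, hz, rfl⟩).trans (le_max_left _ _)

section GridL2

variable {Ω : Set E3} {h : ℝ} {a : Idx → E3}

theorem finite_support_of_grid {E : Type} [Zero E] {a : Idx → E} (hG : (grid Ω h).Finite)
    (ha : ∀ z, z ∉ grid Ω h → a z = 0) : a.support.Finite :=
  hG.subset fun z hz => by_contra fun hzG => hz (ha z hzG)

theorem norm_gridL2_sq (hΩ : volume Ω ≠ ⊤) (hh : 0 < h) (hG : (grid Ω h).Finite)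
    (ha : ∀ z, z ∉ grid Ω h → a z = 0) : ‖gridL2 Ω h a‖ ^ 2 = h ^ 3 * ∑' z, ‖a z‖ ^ 2 := by
  obtain ⟨C, hC⟩ := exists_bound_of_finite_support (finite_support_of_grid hG ha)
  rw [← real_inner_self_eq_norm_sq, L2.inner_def,
    ← setIntegral_comp_cellIdx hh hG fun z hz => by simp [ha z hz]]
  refine integral_congr_ae ((coeFn_gridL2 hΩ h hC).mono fun x hx => ?_)
  simp only [hx, real_inner_self_eq_norm_sq]

theorem integrableOn_cell (hh : 0 < h) {z : Idx} (hz : z ∈ grid Ω h) (v : L2On E3 Ω) :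
    IntegrableOn v (cell h z) := by
  have : IsFiniteMeasure (volume.restrict (cell h z)) := ⟨by simpa using (cell_ne_top hh z).lt_top⟩
  have h1 : MemLp v 2 (volume.restrict (cell h z)) :=
    (Lp.memLp v).mono_measure (Measure.restrict_mono_set _ (cell_subset_of_mem_grid hh hz))
  exact h1.integrable (by norm_num)

theorem inner_gridL2 (hΩ : volume Ω ≠ ⊤) (hh : 0 < h) (hG : (grid Ω h).Finite)
    (ha : ∀ z, z ∉ grid Ω h → a z = 0) (v : L2On E3 Ω) :
    inner ℝ v (gridL2 Ω h a) = ∑' z, inner ℝ (∫ y in cell h z, v y) (a z) := by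
  obtain ⟨C, hC⟩ := exists_bound_of_finite_support (finite_support_of_grid hG ha)
  have hS : ∀ z ∉ hG.toFinset, a z = 0 := fun z hz => ha z (by simpa using hz)
  have e : (fun x => inner ℝ (v x) (gridL2 Ω h a x)) =ᵐ[volume.restrict Ω] fun x =>
      ∑ z ∈ hG.toFinset, (cell h z).indicator (fun x => inner ℝ (v x) (a z)) x := by
    filter_upwards [coeFn_gridL2 hΩ h hC] with x hx
    rw [hx, ← comp_cellIdx_eq_sum hh (fun z x => inner ℝ (v x) (a z))]
    exact fun z hz => by ext; simp [hS z hz]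
  have hi : ∀ z ∈ hG.toFinset, IntegrableOn (fun x => inner ℝ (v x) (a z)) (cell h z) :=
    fun z hz => (integrableOn_cell hh (by simpa using hz) v).inner_const (a z)
  rw [L2.inner_def, integral_congr_ae e, integral_finsetSum,
    tsum_eq_sum (s := hG.toFinset) fun z hz => by simp [hS z hz]]
  · refine Finset.sum_congr rfl fun z hz => ?_
    have hzG : z ∈ grid Ω h := by simpa using hz
    rw [integral_indicator (measurableSet_cell h z),
      Measure.restrict_restrict_of_subset (cell_subset_of_mem_grid hh hzG)]
    simp_rw [real_inner_comm (a z)]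
    rw [integral_inner (integrableOn_cell hh hzG v)]
  · exact fun z hz => ((integrable_indicator_iff (measurableSet_cell h z)).2 (hi z hz)).mono_measure
      Measure.restrict_le_self

/-- Cell averages do not increase the norm. -/
theorem norm_gridL2_velocityInit_le (hΩ : volume Ω ≠ ⊤) (hh : 0 < h) (hG : (grid Ω h).Finite)
    (v0 : L2On E3 Ω) (ha : ∀ z, z ∉ grid Ω h → a z = 0)
    (ha0 : ∀ z ∈ grid Ω h, a z = velocityInit v0 h z) : ‖gridL2 Ω h a‖ ≤ ‖v0‖ := by
  -- On the grid cells, averaging is an orthogonal projection; Cauchy–Schwarz then gives the bound.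
  have h1 : ‖gridL2 Ω h a‖ ^ 2 = inner ℝ v0 (gridL2 Ω h a) := by
    rw [norm_gridL2_sq hΩ hh hG ha, inner_gridL2 hΩ hh hG ha, ← tsum_mul_left]
    refine tsum_congr fun z => ?_
    by_cases hz : z ∈ grid Ω h
    · have h2 : ∫ y in cell h z, v0 y = h ^ 3 • a z := by
        rw [ha0 z hz, velocityInit, smul_smul, mul_inv_cancel₀ (by positivity), one_smul]
      rw [h2, real_inner_smul_left, real_inner_self_eq_norm_sq]
    · simp [ha z hz]
  have h2 := real_inner_le_norm v0 (gridL2 Ω h a)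
  by_contra hc
  push Not at hc
  nlinarith [norm_nonneg v0]

/-- Writing components of cell integrals as inner products in `L²(Ω)` makes them continuous
functionals. This is how integrability in time passes from `f` to its cell integrals. -/
theorem integral_cell_apply (hΩ : volume Ω ≠ ⊤) (hh : 0 < h) (hG : (grid Ω h).Finite) {z : Idx}
    (hz : z ∈ grid Ω h) (v : L2On E3 Ω) (c : E3) :
    inner ℝ (∫ y in cell h z, v y) c = inner ℝ v (gridL2 Ω h (Pi.single z c)) := by
  have h0 : ∀ y, y ≠ z → (Pi.single z c : Idx → E3) y = 0 := fun y hy =>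
    Pi.single_eq_of_ne (M := fun _ => E3) hy c
  rw [inner_gridL2 hΩ hh hG fun y hy => h0 y fun hyz => hy (hyz.symm ▸ hz),
    tsum_eq_single z fun y hy => by rw [h0 y hy, inner_zero_right], Pi.single_eq_same]

theorem inner_forceStep (hΩ : volume Ω ≠ ⊤) (hh : 0 < h) (hG : (grid Ω h).Finite)
    {f : ℝ → L2On E3 Ω} {τ : ℝ} {n : ℕ}
    (hf : IntervalIntegrable f volume (τ * n) (τ * (n + 1))) (hτ : 0 < τ)
    (ha : ∀ z, z ∉ grid Ω h → a z = 0) :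
    τ * (h ^ 3 * ∑' z, inner ℝ (forceStep f τ h n z) (a z))
      = ∫ s in (τ * n)..(τ * (n + 1)), inner ℝ (f s) (gridL2 Ω h a) := by
  have hS : ∀ z ∉ hG.toFinset, a z = 0 := fun z hz => ha z (by simpa using hz)
  have hii : ∀ g : L2On E3 Ω,
      IntervalIntegrable (fun s => inner ℝ (f s) g) volume (τ * n) (τ * (n + 1)) := fun g =>
    ⟨hf.1.inner_const g, hf.2.inner_const g⟩
  have hcell : ∀ z ∈ grid Ω h,
      IntervalIntegrable (fun s => ∫ y in cell h z, f s y) volume (τ * n) (τ * (n + 1)) := by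
    intro z hz
    have e : (fun s => ∫ y in cell h z, f s y) = ∑ i : Fin 3, fun s =>
        inner ℝ (f s) (gridL2 Ω h (Pi.single z (EuclideanSpace.single i (1 : ℝ))))
          • EuclideanSpace.single i (1 : ℝ) := by
      ext s k
      simp_rw [← integral_cell_apply hΩ hh hG hz]
      simp [EuclideanSpace.inner_single_right, Finset.sum_apply, Fin.sum_univ_three,
        PiLp.single_apply]
      fin_cases k <;> simp
    rw [e]
    refine IntervalIntegrable.sum _ fun i _ => ?_
    exact ⟨(hii _).1.smul_const _, (hii _).2.smul_const _⟩
  have e : ∀ z, τ * (h ^ 3 * inner ℝ (forceStep f τ h n z) (a z))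
      = ∫ s in (τ * n)..(τ * (n + 1)), inner ℝ (∫ y in cell h z, f s y) (a z) := by
    intro z
    by_cases hz : z ∈ grid Ω h
    · rw [forceStep, real_inner_smul_left]
      have h1 : inner ℝ (∫ s in (τ * n)..(τ * (n + 1)), ∫ y in cell h z, f s y) (a z)
          = ∫ s in (τ * n)..(τ * (n + 1)), inner ℝ (∫ y in cell h z, f s y) (a z) := by
        rw [intervalIntegral.integral_of_le (by nlinarith),
          intervalIntegral.integral_of_le (by nlinarith), real_inner_comm]
        simp_rw [real_inner_comm (a z)]
        exact (integral_inner (hcell z hz).1 (a z)).symm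
      rw [h1]
      field_simp
    · simp [ha z hz]
  rw [← tsum_mul_left, ← tsum_mul_left, tsum_congr e,
    tsum_eq_sum (s := hG.toFinset) fun z hz => by simp [hS z hz],
    ← intervalIntegral.integral_finsetSum]
  · refine intervalIntegral.integral_congr fun s _ => ?_
    rw [inner_gridL2 hΩ hh hG ha,
      tsum_eq_sum (s := hG.toFinset) fun z hz => by simp [hS z hz]]
  · intro z hz
    have := hcell z (by simpa using hz)
    exact ⟨this.1.inner_const _, this.2.inner_const _⟩

theorem inner_forceStep_le (hΩ : volume Ω ≠ ⊤) (hh : 0 < h) (hG : (grid Ω h).Finite)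
    {f : ℝ → L2On E3 Ω} {τ : ℝ} {n : ℕ}
    (hf : IntervalIntegrable f volume (τ * n) (τ * (n + 1))) (hτ : 0 < τ)
    (ha : ∀ z, z ∉ grid Ω h → a z = 0) :
    τ * (h ^ 3 * ∑' z, inner ℝ (forceStep f τ h n z) (a z))
      ≤ (∫ s in (τ * n)..(τ * (n + 1)), ‖f s‖) * ‖gridL2 Ω h a‖ := by
  rw [inner_forceStep hΩ hh hG hf hτ ha, ← intervalIntegral.integral_mul_const]
  refine intervalIntegral.integral_mono_on (by nlinarith) ?_ ?_ fun s _ => real_inner_le_norm _ _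
  · exact ⟨hf.1.inner_const _, hf.2.inner_const _⟩
  · exact hf.norm.mul_const _

end GridL2

/-! ### The discrete energy inequality -/

theorem tsum_stencilMean {g : Idx → ℝ} (hg : g.support.Finite) :
    (Summable fun z => stencilMean g z) ∧ ∑' z, stencilMean g z = ∑' z, g z := by
  have h0 : Summable g := summable_of_imp hg fun z hz => hz
  have h1 : ∀ e : Idx, Summable fun z => g (z + e) := fun e =>
    summable_of_imp (finite_support_shift hg e) fun z hz => hz
  have h2 : ∀ e : Idx, Summable fun z => g (z - e) := fun e => by
    simpa only [sub_eq_add_neg] using h1 (-e)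
  have h3 : ∀ e : Idx, ∑' z, g (z - e) = ∑' z, g z := fun e => by
    simpa only [sub_eq_add_neg] using tsum_shift (-e) g
  have hs : Summable fun z => g z + ∑ j, (g (z + unitIdx j) + g (z - unitIdx j)) :=
    h0.add (summable_sum fun j _ => (h1 _).add (h2 _))
  refine ⟨hs.mul_left _, ?_⟩
  simp only [stencilMean, smul_eq_mul]
  rw [tsum_mul_left, h0.tsum_add (summable_sum fun j _ => (h1 _).add (h2 _)),
    Summable.tsum_finsetSum fun j _ => (h1 _).add (h2 _)]
  simp_rw [(h1 _).tsum_add (h2 _), tsum_shift, h3, Fin.sum_univ_three]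
  ring

/-- The momentum equation is tested with `u'`. The pressure drops out, and the continuity equation
makes the quadratic coefficient `(η' + stencilMean η) / (2τ)`. Young's inequality inside the stencil
mean bounds the old momentum, and its share `stencilMean η * ‖u'‖ ^ 2` cancels exactly. The old
velocity only has to vanish off `G`, so the unprojected initial velocity is admissible. -/
theorem energy_inequality {G G' : Set Idx} (hG : G.Finite) (hGG' : G ⊆ G' \ gridBoundary G')
    {h τ : ℝ} (hτ : 0 < τ) {η η' q : Idx → ℝ} {ũ u u' : Idx → E3} {m : Idx → ℝ}
    {F : Idx → E3} (hη : ∀ z ∈ G', 0 ≤ η z)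
    (hcont : ∀ z ∈ G, (η' z - stencilMean η z) * (1 / τ) + dDiv h (fun y => η y • ũ y) z = 0)
    (hu : ∀ z, z ∉ G → u z = 0)
    (hu' : ∀ z, z ∉ G \ gridBoundary G → u' z = 0) (hd : ∀ z ∈ G, dDiv h u' z = 0)
    (hmom : ∀ z ∈ G \ gridBoundary G, ∀ i, momentumOp h τ η η' ũ m u' z i + dCentral h i q z
      = stencilMean (fun y => η y * u y i) z * (1 / τ) + F z i) :
    1 / 2 * ∑' z, η' z * ‖u' z‖ ^ 2 + τ * ∑' z, 1 / 2 * m z * ∑ i, ∑ j,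
          (dPlus h j (fun y => u' y i) z + dPlus h i (fun y => u' y j) z) ^ 2
      ≤ 1 / 2 * ∑' z, η z * ‖u z‖ ^ 2 + τ * ∑' z, inner ℝ (F z) (u' z) := by
  have hfin' : u'.support.Finite := hG.subset fun z hz => by
    by_contra hzG
    exact hz (hu' z fun h => hzG h.1)
  have hfin : u.support.Finite := hG.subset fun z hz => by
    by_contra hzG
    exact hz (hu z hzG)
  have hs : ∀ A : Idx → Fin 3 → ℝ, Summable fun z => ∑ i, A z i * u' z i := fun A =>
    summable_of_imp_field hfin' fun z hz => by simp [hz]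
  have hs2 : ∀ A : Idx → ℝ, Summable fun z => A z * ‖u' z‖ ^ 2 := fun A =>
    summable_of_imp_field hfin' fun z hz => by simp [hz]
  have hsF : Summable fun z => inner ℝ (F z) (u' z) :=
    summable_of_imp_field hfin' fun z hz => by simp [hz]
  have hq : ∑' z, ∑ i, dCentral h i q z * u' z i = 0 := by
    rw [tsum_dCentral_inner h hfin', neg_eq_zero]
    simp [dDiv_eq_zero hu' hd]
  have hpt : ∀ z, ∑ i, momentumOp h τ η η' ũ m u' z i * u' z i
      = ∑ i, (stencilMean (fun y => η y * u y i) z * (1 / τ)) * u' z i + inner ℝ (F z) (u' z)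
        - ∑ i, dCentral h i q z * u' z i := by
    intro z
    by_cases hz : z ∈ G \ gridBoundary G
    · have h1 := hmom z hz
      simp only [PiLp.inner_apply, RCLike.inner_apply, conj_trivial, Fin.sum_univ_three]
      linear_combination h1 0 * u' z 0 + h1 1 * u' z 1 + h1 2 * u' z 2
    · simp [hu' z hz]
  have hen := tsum_momentumOp h τ η η' ũ m hfin'
  rw [tsum_congr hpt, ((hs _).add hsF).tsum_sub (hs _), (hs _).tsum_add hsF, hq] at hen
  have hc : ∀ z, (η' z * (1 / τ) + 1 / 2 * dDiv h (fun y => η y • ũ y) z) * ‖u' z‖ ^ 2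
      = 1 / (2 * τ) * (η' z * ‖u' z‖ ^ 2) + 1 / (2 * τ) * (stencilMean η z * ‖u' z‖ ^ 2) := by
    intro z
    by_cases hz : z ∈ G
    · have h1 := hcont z hz
      have e : 1 / (2 * τ) = 1 / 2 * (1 / τ) := by field_simp
      rw [e]
      linear_combination 1 / 2 * ‖u' z‖ ^ 2 * h1
    · simp [hu' z fun h => hz h.1]
  rw [tsum_congr hc, ((hs2 _).mul_left _).tsum_add ((hs2 _).mul_left _), tsum_mul_left,
    tsum_mul_left] at hen
  have hgs : (fun z => η z * ‖u z‖ ^ 2).support.Finite := hfin.subset fun z hz hz0 => hz (by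
    simp [hz0])
  have hgnn : ∀ z, 0 ≤ η z * ‖u z‖ ^ 2 := fun z => by
    by_cases hz : z ∈ G
    · exact mul_nonneg (hη z (hGG' hz).1) (sq_nonneg _)
    · simp [hu z hz]
  obtain ⟨hms, hmt⟩ := tsum_stencilMean hgs
  have hyoung : ∀ z, ∑ i, (stencilMean (fun y => η y * u y i) z * (1 / τ)) * u' z i
      ≤ 1 / (2 * τ) * stencilMean (fun y => η y * ‖u y‖ ^ 2) z
        + 1 / (2 * τ) * (stencilMean η z * ‖u' z‖ ^ 2) := by
    intro z
    by_cases hz : z ∈ G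
    · have hp := fun j => hη _ (add_mem_of_interior (hGG' hz) j).1
      have hm := fun j => hη _ (add_mem_of_interior (hGG' hz) j).2
      have h0 := hη _ (hGG' hz).1
      -- The gap in Young's inequality is precisely this mean, with `u'` frozen at the centre of the
      -- stencil.
      have key : 0 ≤ 1 / (2 * τ) * stencilMean (fun y => η y * ‖u y - u' z‖ ^ 2) z :=
        mul_nonneg (by positivity) (stencilMean_nonneg (mul_nonneg h0 (sq_nonneg _))
          (fun j => mul_nonneg (hp j) (sq_nonneg _)) fun j => mul_nonneg (hm j) (sq_nonneg _))
      have e : 1 / τ = 2 * (1 / (2 * τ)) := by field_simp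
      rw [e, ← sub_nonneg]
      convert key using 1
      simp only [stencilMean, EuclideanSpace.norm_sq_eq, Real.norm_eq_abs, sq_abs,
        Fin.sum_univ_three, smul_eq_mul, PiLp.sub_apply]
      ring
    · have h1 : u' z = 0 := hu' z fun h => hz h.1
      simp only [h1, PiLp.zero_apply, mul_zero, Finset.sum_const_zero, norm_zero, ne_eq,
        OfNat.ofNat_ne_zero, not_false_eq_true, zero_pow, add_zero]
      exact mul_nonneg (by positivity) (stencilMean_nonneg (hgnn _) (fun _ => hgnn _)
        fun _ => hgnn _)
  have hle := (hs _).tsum_le_tsum hyoung ((hms.mul_left _).add ((hs2 _).mul_left _))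
  rw [(hms.mul_left _).tsum_add ((hs2 _).mul_left _), tsum_mul_left, tsum_mul_left, hmt] at hle
  set D := ∑' z, 1 / 2 * m z * ∑ i, ∑ j,
          (dPlus h j (fun y => u' y i) z + dPlus h i (fun y => u' y j) z) ^ 2
  have h1 : 1 / (2 * τ) * ∑' z, η' z * ‖u' z‖ ^ 2 + D
      ≤ 1 / (2 * τ) * ∑' z, η z * ‖u z‖ ^ 2 + ∑' z, inner ℝ (F z) (u' z) := by linarith
  have h2 := mul_le_mul_of_nonneg_left h1 hτ.le
  have h3 : τ * (1 / (2 * τ)) = 1 / 2 := by field_simp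
  rw [mul_add, mul_add, ← mul_assoc, ← mul_assoc, h3] at h2
  exact h2

/-! ### Uniform bounds for the solutions of the discrete problem -/

theorem dPlus_eq_zero {G : Set Idx} (h : ℝ) {w : Idx → E3}
    (hw : ∀ z, z ∉ G \ gridBoundary G → w z = 0) (j : Fin 3) {z : Idx} (hz : z ∉ G) :
    dPlus h j w z = 0 := by
  have h0 : w z = 0 := hw z fun h => hz h.1
  have h1 : w (z + unitIdx j) = 0 := hw _ fun hi => hz (by
    simpa using (add_mem_of_interior hi j).2)
  simp [dPlus, h0, h1]

/-- The factor `1 / 2` of the dissipation and the factor `2` of the discrete Korn inequality cancel.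
Only the values of `m` on `G` matter, since the differences vanish elsewhere. -/
theorem dissipation_lower_bound {G : Set Idx} (hG : G.Finite) (h : ℝ) {m : Idx → ℝ} {c : ℝ}
    (hc : 0 ≤ c) (hm : ∀ z ∈ G, c ≤ m z) {w : Idx → E3}
    (hw : ∀ z, z ∉ G \ gridBoundary G → w z = 0) :
    c * ∑' z, ∑ j, ‖dPlus h j w z‖ ^ 2 ≤ ∑' z, 1 / 2 * m z * ∑ i, ∑ j,
          (dPlus h j (fun y => w y i) z + dPlus h i (fun y => w y j) z) ^ 2 := by
  have hfin : w.support.Finite := hG.subset fun z hz => by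
    by_contra hzG
    exact hz (hw z fun h => hzG h.1)
  have h0 : ∀ z, z ∉ G → ∑ i, ∑ j,
      (dPlus h j (fun y => w y i) z + dPlus h i (fun y => w y j) z) ^ 2 = 0 := fun z hz => by
    simp [← dPlus_apply, dPlus_eq_zero h hw _ hz]
  have h1 := mul_le_mul_of_nonneg_left (tsum_dPlus_sq_le h hfin) (by positivity : 0 ≤ 1 / 2 * c)
  rw [← tsum_mul_left (a := 1 / 2 * c)] at h1
  have h2 : ∑' z, 1 / 2 * c * ∑ i, ∑ j,
        (dPlus h j (fun y => w y i) z + dPlus h i (fun y => w y j) z) ^ 2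
      ≤ ∑' z, 1 / 2 * m z * ∑ i, ∑ j,
          (dPlus h j (fun y => w y i) z + dPlus h i (fun y => w y j) z) ^ 2 := by
    refine Summable.tsum_le_tsum (fun z => ?_)
      (summable_of_eq_zero_off hG fun z hz => by rw [h0 z hz, mul_zero])
      (summable_of_eq_zero_off hG fun z hz => by rw [h0 z hz, mul_zero])
    by_cases hz : z ∈ G
    · have := hm z hz
      gcongr
    · simp [h0 z hz]
  linarith

/-- A discrete Gronwall argument. -/
theorem energy_recursion {N : ℕ} {E d b : ℕ → ℝ} (hE : ∀ n ≤ N, 0 ≤ E n) (hd : ∀ n < N, 0 ≤ d n)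
    (hb : ∀ n < N, 0 ≤ b n)
    (hstep : ∀ n < N, 1 / 2 * E (n + 1) + d n ≤ 1 / 2 * E n + b n * √(E (n + 1))) :
    (∀ n ≤ N, √(E n) ≤ √(E 0) + 2 * ∑ k ∈ Finset.range N, b k) ∧
      ∑ n ∈ Finset.range N, d n ≤ 1 / 2 * E 0
        + (∑ k ∈ Finset.range N, b k) * (√(E 0) + 2 * ∑ k ∈ Finset.range N, b k) := by
  have h1 : ∀ n ≤ N, √(E n) ≤ √(E 0) + 2 * ∑ k ∈ Finset.range n, b k := by
    intro n hn
    induction n with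
    | zero => simp
    | succ n ih =>
      have ih := ih (by omega)
      rw [Finset.sum_range_succ]
      -- With `x = √(E (n + 1))` and `y = √(E n)` the step gives `(x - y) * (x + y) ≤ 2 * b n * x ≤
      -- 2 * b n * (x + y)`. The root grows additively, so no exponential factor appears.
      have hs : √(E (n + 1)) ≤ √(E n) + 2 * b n := by
        by_contra hc
        push Not at hc
        have e1 := Real.sq_sqrt (hE (n + 1) hn)
        have e2 := Real.sq_sqrt (hE n (by omega))
        have := hstep n (by omega)
        have := hd n (by omega)
        have hbn := hb n (by omega)
        nlinarith [Real.sqrt_nonneg (E n), Real.sqrt_nonneg (E (n + 1)),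
          mul_nonneg hbn (Real.sqrt_nonneg (E n))]
      linarith
  have h2 : ∀ n ≤ N, √(E n) ≤ √(E 0) + 2 * ∑ k ∈ Finset.range N, b k := fun n hn => by
    refine (h1 n hn).trans ?_
    gcongr
    exact fun k hk _ => hb k (Finset.mem_range.1 hk)
  refine ⟨h2, ?_⟩
  set K := √(E 0) + 2 * ∑ k ∈ Finset.range N, b k
  have h3 : ∀ n ≤ N, 1 / 2 * E n + ∑ k ∈ Finset.range n, d k
      ≤ 1 / 2 * E 0 + (∑ k ∈ Finset.range n, b k) * K := by
    intro n hn
    induction n with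
    | zero => simp
    | succ n ih =>
      have ih := ih (by omega)
      rw [Finset.sum_range_succ, Finset.sum_range_succ, add_mul]
      have := hstep n (by omega)
      have := mul_le_mul_of_nonneg_left (h2 (n + 1) hn) (hb n (by omega))
      linarith
  have := h3 N le_rfl
  have := hE N le_rfl
  linarith

/-! ### Maximum principle and energy step for an arbitrary discrete solution -/

namespace IsDiscreteSolution

variable {Ω Ω' : Set E3} {μ : ℝ → ℝ} {f : ℝ → L2On E3 Ω} {v0 : L2On E3 Ω}
  {ρ0 : Lp ℝ ⊤ (volume.restrict Ω)} {ρlo ρhi α T h ε₀ : ℝ} {η : ℕ → Idx → ℝ} {u ũ : ℕ → Idx → E3}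
  {q : ℕ → Idx → ℝ}

theorem velocity_support (S : IsDiscreteSolution Ω Ω' μ f v0 ρ0 ρlo α T h η u ũ q) {n : ℕ}
    (hn : n < numSteps α h T) (z : Idx) (hz : z ∉ grid Ω h \ gridBoundary (grid Ω h)) :
    u (n + 1) z = 0 := by
  by_cases hzG : z ∈ grid Ω h
  · exact S.velocity_boundary n hn z (by_contra fun hb => hz ⟨hzG, hb⟩)
  · exact S.zero_outside _ z hzG

theorem velocity_solenoidal (S : IsDiscreteSolution Ω Ω' μ f v0 ρ0 ρlo α T h η u ũ q) {n : ℕ}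
    (hn : n < numSteps α h T) (z : Idx) : dDiv h (u (n + 1)) z = 0 :=
  dDiv_eq_zero (S.velocity_support hn) (S.incompressible n hn) z

/-- At later times the truncated field comes from the incompressible velocity. The averaged initial
velocity need not be discretely solenoidal, and at time zero the Helmholtz projection takes its
place. -/
theorem trunc_bounds (S : IsDiscreteSolution Ω Ω' μ f v0 ρ0 ρlo α T h η u ũ q)
    (hΩ : Bornology.IsBounded Ω) (hh : 0 < h) {n : ℕ} (hn : n ≤ numSteps α h T) :
    (∀ z, ‖ũ n z‖ ≤ 2 / 7 * h ^ (-1 + α)) ∧ ∀ z, dDiv h (ũ n) z = 0 := by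
  have hG := finite_grid hΩ hh
  rcases n with _ | n
  · obtain ⟨w, hw, hũ⟩ := S.trunc_init
    rw [hũ]
    have hwint : ∀ z, z ∉ grid Ω h \ gridBoundary (grid Ω h) → w z = 0 := fun z hz => by
      by_cases hzG : z ∈ grid Ω h
      · exact hw.zero_boundary z (by_contra fun hb => hz ⟨hzG, hb⟩)
      · exact hw.zero_outside z hzG
    exact ⟨norm_truncField_le α hh (finite_support_of_grid hG hw.zero_outside),
      dDiv_truncField α h (dDiv_eq_zero hwint hw.div_free)⟩
  · rw [S.trunc_succ]
    exact ⟨norm_truncField_le α hh (finite_support_of_grid hG (S.zero_outside _)),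
      dDiv_truncField α h (S.velocity_solenoidal (by omega))⟩

theorem density_mem_Icc (S : IsDiscreteSolution Ω Ω' μ f v0 ρ0 ρlo α T h η u ũ q)
    (hΩ_open : IsOpen Ω) (hΩ : Bornology.IsBounded Ω) (hh : 0 < h)
    (hρ0 : ∀ᵐ x ∂(volume.restrict Ω), ρlo ≤ ρ0 x ∧ ρ0 x ≤ ρhi) {n : ℕ}
    (hn : n ≤ numSteps α h T) : ∀ z ∈ grid Ω' h, η n z ∈ Icc ρlo (max ρlo ρhi) := by
  have hinit := densityInit_mem_Icc hΩ_open hρ0 hh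
  induction n with
  | zero =>
    intro z hz
    rw [S.density_init z hz]
    exact hinit z
  | succ n ih =>
    intro z hz
    have ih := ih (by omega)
    by_cases hb : z ∈ gridBoundary (grid Ω' h)
    · rw [S.density_boundary n (by omega) z hb, S.density_init z hz]
      exact hinit z
    · obtain ⟨hũ, hd⟩ := S.trunc_bounds hΩ hh (n := n) (by omega)
      have h1 := transport_mem_Icc (courant_bound hh hũ) hd ih ⟨hz, hb⟩
      have h2 := S.continuity n (by omega) z ⟨hz, hb⟩
      have hτ := timeStep_pos α hh
      convert h1 using 1
      field_simp at h2
      linarith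

theorem energy_step (S : IsDiscreteSolution Ω Ω' μ f v0 ρ0 ρlo α T h η u ũ q)
    (hΩ_open : IsOpen Ω) (hΩ : Bornology.IsBounded Ω) (hh : 0 < h)
    (hΩΩ' : ∀ x ∈ Ω, Metric.closedBall x ε₀ ⊆ Ω') (hε : 6 * h ≤ ε₀)
    (hf : ∀ S : ℝ, MemLp f 2 (volume.restrict (Icc 0 S))) (hρlo : 0 < ρlo)
    (hρ0 : ∀ᵐ x ∂(volume.restrict Ω), ρlo ≤ ρ0 x ∧ ρ0 x ≤ ρhi) {c : ℝ} (hc : 0 ≤ c)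
    (hμ : ∀ r ∈ Icc ρlo (max ρlo ρhi), c ≤ μ r) {n : ℕ} (hn : n < numSteps α h T) :
    1 / 2 * (h ^ 3 * ∑' z, η (n + 1) z * ‖u (n + 1) z‖ ^ 2)
        + c * (timeStep α h * (h ^ 3 * ∑' z, ∑ j, ‖dPlus h j (u (n + 1)) z‖ ^ 2))
      ≤ 1 / 2 * (h ^ 3 * ∑' z, η n z * ‖u n z‖ ^ 2)
        + (√(max ρlo ρhi) * ∫ s in (timeStep α h * n)..(timeStep α h * (n + 1)), ‖f s‖)
          * √(h ^ 3 * ∑' z, η (n + 1) z * ‖u (n + 1) z‖ ^ 2) := by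
  have hG := finite_grid hΩ hh
  have hΩv : volume Ω ≠ ⊤ := hΩ.measure_lt_top.ne
  have hτ := timeStep_pos α hh
  set τ := timeStep α h
  have hGG' := grid_subset_interior hΩΩ' hh hε
  have hη := S.density_mem_Icc hΩ_open hΩ hh hρ0 (n := n) (by omega)
  have hη' := S.density_mem_Icc hΩ_open hΩ hh hρ0 (n := n + 1) (by omega)
  have hsupp := S.velocity_support hn
  have hmax : 0 ≤ max ρlo ρhi := hρlo.le.trans (le_max_left _ _)
  have h1 := energy_inequality hG hGG' hτ (η := η n) (η' := η (n + 1)) (q := q (n + 1))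
    (ũ := ũ n) (u := u n) (u' := u (n + 1)) (m := fun y => μ (η (n + 1) y))
    (F := fun z => η (n + 1) z • forceStep f τ h n z)
    (fun z hz => hρlo.le.trans (hη z hz).1) (fun z hz => S.continuity n hn z (hGG' hz))
    (S.zero_outside n) hsupp (S.incompressible n hn) (fun z hz i => by
      have := S.momentum n hn z hz i
      simp only [momentumOp, PiLp.smul_apply, smul_eq_mul]
      linear_combination this)
  have h2 := dissipation_lower_bound hG h hc (m := fun y => μ (η (n + 1) y))
    (fun z hz => hμ _ (hη' z (hGG' hz).1)) hsupp
  have h3 : ∀ z, z ∉ grid Ω h → η (n + 1) z • u (n + 1) z = 0 := fun z hz => by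
    rw [S.zero_outside _ z hz, smul_zero]
  have hint : IntervalIntegrable f volume (τ * n) (τ * (n + 1)) := by
    rw [intervalIntegrable_iff_integrableOn_Icc_of_le (by nlinarith)]
    have : IntegrableOn f (Icc 0 (τ * (n + 1))) := (hf _).integrable (by norm_num)
    exact this.mono_set (Icc_subset_Icc_left (by positivity))
  have h4 := inner_forceStep_le hΩv hh hG hint hτ h3
  -- The force is paired with the momentum `η u`, and `η ^ 2 ≤ max ρlo ρhi * η` bounds its norm by
  -- the root of the kinetic energy.
  have h5 : ‖gridL2 Ω h fun z => η (n + 1) z • u (n + 1) z‖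
      ≤ √(max ρlo ρhi) * √(h ^ 3 * ∑' z, η (n + 1) z * ‖u (n + 1) z‖ ^ 2) := by
    rw [← Real.sqrt_mul hmax]
    refine Real.le_sqrt_of_sq_le ?_
    rw [norm_gridL2_sq hΩv hh hG h3, mul_left_comm (max ρlo ρhi),
      ← tsum_mul_left (a := max ρlo ρhi)]
    have hfin := finite_support_of_grid hG (S.zero_outside (n + 1))
    refine mul_le_mul_of_nonneg_left (Summable.tsum_le_tsum (fun z => ?_)
      (summable_of_imp_field hfin fun z hz => by simp [hz])
      (summable_of_imp_field hfin fun z hz => by simp [hz])) (by positivity)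
    by_cases hz : z ∈ grid Ω h
    · have hz' := hη' z (hGG' hz).1
      have hpos : 0 ≤ η (n + 1) z := hρlo.le.trans hz'.1
      rw [norm_smul, Real.norm_eq_abs, abs_of_nonneg hpos, mul_pow, sq (η (n + 1) z), mul_assoc]
      exact mul_le_mul_of_nonneg_right hz'.2 (by positivity)
    · simp [S.zero_outside (n + 1) z hz]
  have h6 : 0 ≤ ∫ s in (τ * n)..(τ * (n + 1)), ‖f s‖ :=
    intervalIntegral.integral_nonneg (by nlinarith) fun _ _ => norm_nonneg _
  have h7 := mul_le_mul_of_nonneg_left h5 h6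
  have h8 : ∑' z, inner ℝ (η (n + 1) z • forceStep f τ h n z) (u (n + 1) z)
      = ∑' z, inner ℝ (forceStep f τ h n z) (η (n + 1) z • u (n + 1) z) :=
    tsum_congr fun z => by rw [real_inner_smul_left, real_inner_smul_right]
  rw [h8] at h1
  have h9 := mul_le_mul_of_nonneg_left h1 (by positivity : 0 ≤ h ^ 3)
  have h10 := mul_le_mul_of_nonneg_left h2 (by positivity : 0 ≤ h ^ 3 * τ)
  linarith

end IsDiscreteSolution

theorem timeStep_mul_numSteps {α h T : ℝ} (hh : 0 < h) (hT : 0 ≤ T) :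
    T < timeStep α h * numSteps α h T ∧ timeStep α h * numSteps α h T ≤ T + timeStep α h := by
  have hτ := timeStep_pos α hh
  have h1 := Nat.lt_floor_add_one (T / timeStep α h)
  have h2 := Nat.floor_le (div_nonneg hT hτ.le)
  rw [div_lt_iff₀ hτ] at h1
  rw [le_div_iff₀ hτ] at h2
  rw [numSteps]
  push_cast
  constructor <;> linarith

theorem timeStep_le_one {α h : ℝ} (hα : α < 1) (hh : 0 < h) (h1 : h ≤ 1) : timeStep α h ≤ 1 :=
  Real.rpow_le_one hh.le h1 (by linarith)

/-- The energy estimate, uniformly in the mesh size. -/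
theorem exists_uniform_bound {Ω Ω' : Set E3} (hΩ_open : IsOpen Ω) (hΩ : Bornology.IsBounded Ω)
    {ε₀ : ℝ} (hΩΩ' : ∀ x ∈ Ω, Metric.closedBall x ε₀ ⊆ Ω') {μ : ℝ → ℝ}
    (hμ_cont : ContinuousOn μ (Ici 0)) (hμ : ∀ r, 0 ≤ r → 0 < μ r) {f : ℝ → L2On E3 Ω}
    (hf : ∀ S : ℝ, MemLp f 2 (volume.restrict (Icc 0 S))) (v0 : L2On E3 Ω)
    {ρ0 : Lp ℝ ⊤ (volume.restrict Ω)} {ρlo ρhi : ℝ} (hρlo : 0 < ρlo)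
    (hρ0 : ∀ᵐ x ∂(volume.restrict Ω), ρlo ≤ ρ0 x ∧ ρ0 x ≤ ρhi) {α T : ℝ} (hα : α < 1)
    (hT : 0 ≤ T) :
    ∃ C, 0 ≤ C ∧ ∀ h, 0 < h → 6 * h ≤ ε₀ → h ≤ 1 → ∀ η u ũ q,
      IsDiscreteSolution Ω Ω' μ f v0 ρ0 ρlo α T h η u ũ q →
      (∀ n < numSteps α h T, h ^ 3 * ∑' z, ‖u (n + 1) z‖ ^ 2 ≤ C) ∧
      ∑ n ∈ Finset.range (numSteps α h T), timeStep α h *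
        (h ^ 3 * ∑' z, ∑ j, ‖dPlus h j (u (n + 1)) z‖ ^ 2) ≤ C := by
  have hmax : 0 ≤ max ρlo ρhi := hρlo.le.trans (le_max_left _ _)
  -- All densities stay in a fixed compact interval, so `μ r₀` is a positive lower bound for the
  -- viscosity, independent of the mesh.
  obtain ⟨r₀, hr₀, hmin⟩ := isCompact_Icc.exists_isMinOn
    (nonempty_Icc.2 (le_max_left ρlo ρhi))
    (hμ_cont.mono fun r hr => hρlo.le.trans hr.1)
  have hc : 0 < μ r₀ := hμ r₀ (hρlo.le.trans hr₀.1)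
  have hΩv : volume Ω ≠ ⊤ := hΩ.measure_lt_top.ne
  set M := max ρlo ρhi
  -- The last time step may overshoot `T`, but `τ * N ≤ T + τ ≤ T + 1` when `h ≤ 1`.
  set Φ := ∫ s in (0 : ℝ)..(T + 1), ‖f s‖
  set K := √(M * ‖v0‖ ^ 2) + 2 * (√M * Φ)
  have hΦ : 0 ≤ Φ := intervalIntegral.integral_nonneg (by linarith) fun _ _ => norm_nonneg _
  have hK : 0 ≤ K := by positivity
  refine ⟨K ^ 2 / ρlo + (1 / 2 * (M * ‖v0‖ ^ 2) + √M * Φ * K) / μ r₀, by positivity, ?_⟩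
  intro h hh hε h1 η u ũ q S
  have hG := finite_grid hΩ hh
  have hτ := timeStep_pos α hh
  have hτ1 := timeStep_le_one hα hh h1
  have hN := timeStep_mul_numSteps (α := α) hh hT
  have hGG' := grid_subset_interior hΩΩ' hh hε
  set τ := timeStep α h
  set N := numSteps α h T
  let E : ℕ → ℝ := fun n => h ^ 3 * ∑' z, η n z * ‖u n z‖ ^ 2
  let d : ℕ → ℝ := fun n => μ r₀ * (τ * (h ^ 3 * ∑' z, ∑ j, ‖dPlus h j (u (n + 1)) z‖ ^ 2))
  let b : ℕ → ℝ := fun n => √M * ∫ s in (τ * n)..(τ * (n + 1)), ‖f s‖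
  have hdens : ∀ n ≤ N, ∀ z ∈ grid Ω h, η n z ∈ Icc ρlo M := fun n hn z hz =>
    S.density_mem_Icc hΩ_open hΩ hh hρ0 hn z (hGG' hz).1
  have hfin : ∀ n, (u n).support.Finite := fun n => finite_support_of_grid hG (S.zero_outside n)
  have hs : ∀ n, ∀ A : Idx → ℝ, Summable fun z => A z * ‖u n z‖ ^ 2 := fun n A =>
    summable_of_imp_field (hfin n) fun z hz => by simp [hz]
  have hlow : ∀ n ≤ N, ρlo * (h ^ 3 * ∑' z, ‖u n z‖ ^ 2) ≤ E n := fun n hn => by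
    rw [mul_left_comm, ← tsum_mul_left]
    refine mul_le_mul_of_nonneg_left (Summable.tsum_le_tsum (fun z => ?_) (hs n _) (hs n _))
      (by positivity)
    by_cases hz : z ∈ grid Ω h
    · exact mul_le_mul_of_nonneg_right (hdens n hn z hz).1 (sq_nonneg _)
    · simp [S.zero_outside n z hz]
  have hE : ∀ n ≤ N, 0 ≤ E n := fun n hn =>
    (mul_nonneg hρlo.le (mul_nonneg (by positivity)
      (tsum_nonneg fun z => sq_nonneg _))).trans (hlow n hn)
  have hint : ∀ n : ℕ, 0 ≤ ∫ s in (τ * n)..(τ * (n + 1)), ‖f s‖ := fun n =>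
    intervalIntegral.integral_nonneg (by nlinarith) fun _ _ => norm_nonneg _
  have hii : ∀ a b : ℝ, 0 ≤ a → a ≤ b → IntervalIntegrable f volume a b := fun a b ha hab => by
    rw [intervalIntegrable_iff_integrableOn_Icc_of_le hab]
    have : IntegrableOn f (Icc 0 b) := (hf _).integrable (by norm_num)
    exact this.mono_set (Icc_subset_Icc_left ha)
  have hsum : ∑ n ∈ Finset.range N, b n ≤ √M * Φ := by
    have e := intervalIntegral.sum_integral_adjacent_intervals (f := fun s => ‖f s‖)
      (μ := volume) (a := fun n : ℕ => τ * n) (n := N) fun k _ =>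
        (hii _ _ (by positivity) (by push_cast; nlinarith)).norm
    push_cast at e
    rw [← Finset.mul_sum, e, mul_zero]
    refine mul_le_mul_of_nonneg_left ?_ (Real.sqrt_nonneg _)
    refine intervalIntegral.integral_mono_interval le_rfl (by positivity) (by linarith)
      (Eventually.of_forall fun s => norm_nonneg _) (hii _ _ le_rfl (by linarith)).norm
  have hb0 : 0 ≤ ∑ n ∈ Finset.range N, b n :=
    Finset.sum_nonneg fun n _ => mul_nonneg (Real.sqrt_nonneg _) (hint n)
  obtain ⟨r1, r2⟩ := energy_recursion (N := N) (E := E) (d := d) (b := b) hE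
    (fun n _ => mul_nonneg hc.le (mul_nonneg hτ.le (mul_nonneg (by positivity)
      (tsum_nonneg fun z => Finset.sum_nonneg fun j _ => sq_nonneg _))))
    (fun n _ => mul_nonneg (Real.sqrt_nonneg _) (hint n))
    (fun n hn => S.energy_step hΩ_open hΩ hh hΩΩ' hε hf hρlo hρ0 hc.le (fun r hr => hmin hr) hn)
  have hE0 : E 0 ≤ M * ‖v0‖ ^ 2 := by
    have h2 := norm_gridL2_velocityInit_le hΩv hh hG v0 (S.zero_outside 0) S.velocity_init
    have h3 := pow_le_pow_left₀ (norm_nonneg _) h2 2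
    rw [norm_gridL2_sq hΩv hh hG (S.zero_outside 0)] at h3
    refine le_trans ?_ (mul_le_mul_of_nonneg_left h3 hmax)
    rw [mul_left_comm, ← tsum_mul_left]
    refine mul_le_mul_of_nonneg_left (Summable.tsum_le_tsum (fun z => ?_) (hs 0 _) (hs 0 _))
      (by positivity)
    by_cases hz : z ∈ grid Ω h
    · exact mul_le_mul_of_nonneg_right (hdens 0 (Nat.zero_le _) z hz).2 (sq_nonneg _)
    · simp [S.zero_outside 0 z hz]
  have hsqrt : √(E 0) ≤ √(M * ‖v0‖ ^ 2) := Real.sqrt_le_sqrt hE0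
  have hbK : √(E 0) + 2 * ∑ k ∈ Finset.range N, b k ≤ K := by linarith
  constructor
  · intro n hn
    have h2 := (r1 (n + 1) hn).trans hbK
    have h3 : E (n + 1) ≤ K ^ 2 := by
      rw [← Real.sq_sqrt (hE (n + 1) hn)]
      exact pow_le_pow_left₀ (Real.sqrt_nonneg _) h2 2
    have h4 := (hlow (n + 1) hn).trans h3
    have h5 : h ^ 3 * ∑' z, ‖u (n + 1) z‖ ^ 2 ≤ K ^ 2 / ρlo := by
      rw [le_div_iff₀ hρlo]
      linarith
    have : 0 ≤ (1 / 2 * (M * ‖v0‖ ^ 2) + √M * Φ * K) / μ r₀ := by positivity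
    linarith
  · have h2 : (∑ k ∈ Finset.range N, b k) * (√(E 0) + 2 * ∑ k ∈ Finset.range N, b k)
        ≤ √M * Φ * K := mul_le_mul hsum hbK (by positivity) (by positivity)
    simp only [d] at r2
    rw [← Finset.mul_sum] at r2
    have h3 : ∑ n ∈ Finset.range N, τ * (h ^ 3 * ∑' z, ∑ j, ‖dPlus h j (u (n + 1)) z‖ ^ 2)
        ≤ (1 / 2 * (M * ‖v0‖ ^ 2) + √M * Φ * K) / μ r₀ := by
      rw [le_div_iff₀ hc]
      linarith
    have : 0 ≤ K ^ 2 / ρlo := by positivity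
    linarith

/-! ### Smoothing kernels -/

theorem contDiff_smoothTransition : ContDiff ℝ ((⊤ : ℕ∞) : WithTop ℕ∞) Real.smoothTransition :=
  Real.smoothTransition.contDiff

/-- The integral of a difference of translates of a transition function from `0` to `1`. -/
theorem integral_transition_sub {P : ℝ → ℝ} (hP : Continuous P) {L : ℝ}
    (h0 : ∀ s ≤ -L, P s = 0) (h1 : ∀ s, L ≤ s → P s = 1) {c : ℝ} (hc : 0 ≤ c) :
    ∫ s, (P (s + c) - P s) = c := by
  set R := |L| + c + 1
  have hL := le_abs_self L
  have hL' := neg_abs_le L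
  have hL0 := abs_nonneg L
  have hsupp : (Function.support fun s => P (s + c) - P s) ⊆ Ioc (-R) R := by
    intro s hs
    by_contra hn
    rw [mem_Ioc, not_and_or, not_lt, not_le] at hn
    apply hs
    dsimp only
    rcases hn with hn | hn
    · rw [h0 _ (by linarith), h0 _ (by linarith), sub_zero]
    · rw [h1 _ (by linarith), h1 _ (by linarith), sub_self]
  have hi : ∀ a b, IntervalIntegrable P volume a b := fun a b => hP.intervalIntegrable a b
  rw [← intervalIntegral.integral_eq_integral_of_support_subset hsupp,
    intervalIntegral.integral_sub (f := fun s => P (s + c))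
      ((hP.comp (continuous_add_const c)).intervalIntegrable _ _) (hi _ _), intervalIntegral.integral_comp_add_right,
    intervalIntegral.integral_interval_sub_interval_comm' (hi _ _) (hi _ _) (hi _ _)]
  have e1 : ∫ s in R..(R + c), P s = c := by
    rw [intervalIntegral.integral_congr (g := fun _ => (1 : ℝ)) fun s hs => h1 s ?_]
    · simp
    · rw [uIcc_of_le (by linarith)] at hs
      linarith [hs.1]
  have e2 : ∫ s in (-R)..(-R + c), P s = 0 := by
    rw [intervalIntegral.integral_congr (g := fun _ => (0 : ℝ)) fun s hs => h0 s ?_]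
    · simp
    · rw [uIcc_of_le (by linarith)] at hs
      linarith [hs.2]
  rw [e1, e2, sub_zero]

/-- A one-dimensional smoothing profile. -/
structure IsProfile (β : ℝ → ℝ) : Prop where
  contDiff : ContDiff ℝ ((⊤ : ℕ∞) : WithTop ℕ∞) β
  support : ∀ s, β s ≠ 0 → |s| ≤ 2
  integral_eq : ∫ s, β s = 1

/-- A smooth bump function on `[0, 1]`. -/
def bumpProfile : ℝ → ℝ := deriv Real.smoothTransition

/-- The average of `bumpProfile` over intervals `[s, s + 1]`. -/
def hatProfile (s : ℝ) : ℝ := Real.smoothTransition (s + 1) - Real.smoothTransition s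

/-- The antiderivative of `hatProfile`. -/
def hatPrimitive (s : ℝ) : ℝ := ∫ x in (-1 : ℝ)..s, hatProfile x

/-- The average of `bumpProfile` over intervals `[s - 1, s + 1]`. -/
def wideProfile (s : ℝ) : ℝ :=
  1 / 2 * (Real.smoothTransition (s + 1) - Real.smoothTransition (s - 1))

/-- The average of `hatProfile` over intervals `[s - 1, s + 1]`. -/
def wideHatProfile (s : ℝ) : ℝ := 1 / 2 * (hatPrimitive (s + 1) - hatPrimitive (s - 1))

theorem contDiff_hatProfile : ContDiff ℝ ((⊤ : ℕ∞) : WithTop ℕ∞) hatProfile :=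
  (contDiff_smoothTransition.comp (contDiff_id.add contDiff_const)).sub contDiff_smoothTransition

theorem hasDerivAt_hatPrimitive (s : ℝ) : HasDerivAt hatPrimitive (hatProfile s) s :=
  intervalIntegral.integral_hasDerivAt_right
    (contDiff_hatProfile.continuous.intervalIntegrable _ _)
    (contDiff_hatProfile.continuous.stronglyMeasurableAtFilter _ _)
    contDiff_hatProfile.continuous.continuousAt

theorem contDiff_hatPrimitive : ContDiff ℝ ((⊤ : ℕ∞) : WithTop ℕ∞) hatPrimitive := by
  rw [contDiff_infty_iff_deriv]
  refine ⟨fun s => (hasDerivAt_hatPrimitive s).differentiableAt, ?_⟩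
  rw [show deriv hatPrimitive = hatProfile from funext fun s => (hasDerivAt_hatPrimitive s).deriv]
  exact contDiff_hatProfile

theorem hasDerivAt_smoothTransition (s : ℝ) :
    HasDerivAt Real.smoothTransition (bumpProfile s) s :=
  (contDiff_smoothTransition.differentiable (by simp) s).hasDerivAt

theorem hatProfile_support {s : ℝ} (hs : hatProfile s ≠ 0) : -1 < s ∧ s < 1 := by
  by_contra hc
  rw [not_and_or, not_lt, not_lt] at hc
  apply hs
  rw [hatProfile]
  rcases hc with hc | hc
  · rw [Real.smoothTransition.zero_of_nonpos (by linarith),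
      Real.smoothTransition.zero_of_nonpos (by linarith), sub_zero]
  · rw [Real.smoothTransition.one_of_one_le (by linarith),
      Real.smoothTransition.one_of_one_le hc, sub_self]

theorem integral_hatProfile : ∫ s, hatProfile s = 1 :=
  integral_transition_sub (L := 1) contDiff_smoothTransition.continuous
    (fun s hs => Real.smoothTransition.zero_of_nonpos (by linarith))
    (fun s hs => Real.smoothTransition.one_of_one_le hs) zero_le_one

theorem isProfile_hat : IsProfile hatProfile :=
  ⟨contDiff_hatProfile, fun s hs => abs_le.2
    ⟨by linarith [(hatProfile_support hs).1], by linarith [(hatProfile_support hs).2]⟩,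
    integral_hatProfile⟩

theorem isProfile_bump : IsProfile bumpProfile := by
  have hc : ContDiff ℝ ((⊤ : ℕ∞) : WithTop ℕ∞) bumpProfile :=
    (contDiff_infty_iff_deriv.1 contDiff_smoothTransition).2
  have hneg : ∀ s < 0, bumpProfile s = 0 := fun s hs => by
    have : Real.smoothTransition =ᶠ[𝓝 s] fun _ => 0 := by
      filter_upwards [gt_mem_nhds hs] with x hx
      exact Real.smoothTransition.zero_of_nonpos hx.le
    rw [bumpProfile, this.deriv_eq, deriv_const]
  have hpos : ∀ s, 1 < s → bumpProfile s = 0 := fun s hs => by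
    have : Real.smoothTransition =ᶠ[𝓝 s] fun _ => 1 := by
      filter_upwards [lt_mem_nhds hs] with x hx
      exact Real.smoothTransition.one_of_one_le hx.le
    rw [bumpProfile, this.deriv_eq, deriv_const]
  refine ⟨hc, fun s hs => abs_le.2 ⟨?_, ?_⟩, ?_⟩
  · by_contra h
    exact hs (hneg s (by linarith))
  · by_contra h
    exact hs (hpos s (by linarith))
  · rw [← intervalIntegral.integral_eq_integral_of_support_subset (a := -1) (b := 2),
      intervalIntegral.integral_eq_sub_of_hasDerivAt (fun s _ => hasDerivAt_smoothTransition s)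
        (hc.continuous.intervalIntegrable _ _),
      Real.smoothTransition.one_of_one_le (by norm_num),
      Real.smoothTransition.zero_of_nonpos (by norm_num), sub_zero]
    intro s hs
    constructor
    · by_contra h
      exact hs (hneg s (by linarith))
    · by_contra h
      exact hs (hpos s (by linarith))

/-- Symmetric averages of transition functions are profiles. -/
theorem isProfile_of_transition {P : ℝ → ℝ} (hP : ContDiff ℝ ((⊤ : ℕ∞) : WithTop ℕ∞) P)
    (h0 : ∀ s ≤ -1, P s = 0) (h1 : ∀ s, 1 ≤ s → P s = 1) :
    IsProfile fun s => 1 / 2 * (P (s + 1) - P (s - 1)) := by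
  refine ⟨contDiff_const.mul ((hP.comp (contDiff_id.add contDiff_const)).sub
    (hP.comp (contDiff_id.sub contDiff_const))), fun s hs => ?_, ?_⟩
  · by_contra hc
    apply hs
    rw [abs_le, not_and_or, not_le, not_le] at hc
    rcases hc with hc | hc
    · rw [h0 _ (by linarith), h0 _ (by linarith)]; ring
    · rw [h1 _ (by linarith), h1 _ (by linarith)]; ring
  · have h2 := integral_transition_sub hP.continuous h0 h1 (c := 2) (by norm_num)
    rw [← integral_sub_right_eq_self _ (1 : ℝ)] at h2
    rw [integral_const_mul]
    simp_rw [show ∀ s : ℝ, s - 1 + 2 = s + 1 from fun s => by ring] at h2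
    rw [h2]
    norm_num

theorem isProfile_wide : IsProfile wideProfile :=
  isProfile_of_transition contDiff_smoothTransition
    (fun s hs => Real.smoothTransition.zero_of_nonpos (by linarith))
    (fun s hs => Real.smoothTransition.one_of_one_le hs)

theorem isProfile_wideHat : IsProfile wideHatProfile := by
  refine isProfile_of_transition contDiff_hatPrimitive (fun s hs => ?_) fun s hs => ?_
  · rw [hatPrimitive, intervalIntegral.integral_congr (g := fun _ => (0 : ℝ))]
    · simp
    · intro x hx
      rw [uIcc_of_ge hs] at hx
      by_contra h
      linarith [(hatProfile_support h).1, hx.2]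
  · rw [hatPrimitive, intervalIntegral.integral_eq_integral_of_support_subset,
      integral_hatProfile]
    intro x hx
    exact ⟨(hatProfile_support hx).1, (hatProfile_support hx).2.le.trans hs⟩

theorem hasDerivAt_hatProfile (s : ℝ) :
    HasDerivAt hatProfile (bumpProfile (s + 1) - bumpProfile s) s :=
  ((hasDerivAt_smoothTransition (s + 1)).comp_add_const s 1).sub (hasDerivAt_smoothTransition s)

theorem hasDerivAt_wideHatProfile (s : ℝ) :
    HasDerivAt wideHatProfile (1 / 2 * (hatProfile (s + 1) - hatProfile (s - 1))) s :=
  (((hasDerivAt_hatPrimitive (s + 1)).comp_add_const s 1).sub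
    ((hasDerivAt_hatPrimitive (s - 1)).comp_sub_const s 1)).const_mul _

/-- This quantity is also the derivative of `wideHatProfile`. It can thus be read either as a
forward difference of one profile or as a central difference of another; the first reading serves
the gradient, the second the divergence. -/
theorem wideProfile_add_one_sub (s : ℝ) :
    wideProfile (s + 1) - wideProfile s = 1 / 2 * (hatProfile (s + 1) - hatProfile (s - 1)) := by
  simp only [wideProfile, hatProfile, add_sub_cancel_right, sub_add_cancel]
  ring

/-- A smoothing kernel on three-space. -/
structure IsKernel (Θ : E3 → ℝ) : Prop where
  contDiff : ContDiff ℝ ((⊤ : ℕ∞) : WithTop ℕ∞) Θ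
  support : ∀ y, Θ y ≠ 0 → ∀ k, |y k| ≤ 2
  integral_eq : ∫ y, Θ y = 1

/-- The product kernel `∏ k, β k (y k)`. -/
def prodKernel (β : Fin 3 → ℝ → ℝ) (y : E3) : ℝ := ∏ k, β k (y k)

theorem isKernel_prodKernel {β : Fin 3 → ℝ → ℝ} (hβ : ∀ k, IsProfile (β k)) :
    IsKernel (prodKernel β) := by
  refine ⟨contDiff_prod fun k _ => (hβ k).contDiff.comp (by fun_prop), fun y hy k => ?_, ?_⟩
  · exact (hβ k).support _ fun h => hy (Finset.prod_eq_zero (Finset.mem_univ k) h)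
  · have h1 := (EuclideanSpace.volume_preserving_symm_measurableEquiv_toLp (Fin 3)).integral_comp'
      fun y : Fin 3 → ℝ => ∏ k, β k (y k)
    have h2 : ∫ y, prodKernel β y = ∫ y : Fin 3 → ℝ, ∏ k, β k (y k) := h1
    rw [h2, integral_fintype_prod_volume_eq_prod]
    exact Finset.prod_eq_one fun k _ => (hβ k).integral_eq

theorem prodKernel_update (β : Fin 3 → ℝ → ℝ) (j : Fin 3) (g : ℝ → ℝ) (y : E3) :
    prodKernel (Function.update β j g) y = g (y j) * ∏ k ∈ Finset.univ.erase j, β k (y k) := by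
  rw [prodKernel, ← Finset.mul_prod_erase _ _ (Finset.mem_univ j), Function.update_self]
  congr 1
  exact Finset.prod_congr rfl fun k hk => by
    rw [Function.update_of_ne (Finset.ne_of_mem_erase hk)]

theorem prodKernel_update_add (β : Fin 3 → ℝ → ℝ) (j : Fin 3) (g : ℝ → ℝ) (y : E3) (s : ℝ) :
    prodKernel (Function.update β j g) (y + s • basisVec j)
      = g (y j + s) * ∏ k ∈ Finset.univ.erase j, β k (y k) := by
  rw [prodKernel_update]
  congr 1
  · simp [basisVec]
  · exact Finset.prod_congr rfl fun k hk => by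
      simp [basisVec, Finset.ne_of_mem_erase hk]

/-- The derivative of a product kernel in a coordinate direction. -/
theorem hasLineDerivAt_prodKernel {β : Fin 3 → ℝ → ℝ} {j : Fin 3} {g : ℝ → ℝ} {y : E3} {d : ℝ}
    (hg : HasDerivAt g d (y j)) (c : ℝ) :
    HasDerivAt (fun t : ℝ => prodKernel (Function.update β j g) (y + (c * t) • basisVec j))
      (c * (d * ∏ k ∈ Finset.univ.erase j, β k (y k))) 0 := by
  simp_rw [prodKernel_update_add]
  have h1 : HasDerivAt (fun t : ℝ => y j + c * t) c 0 := by
    simpa using ((hasDerivAt_id (0 : ℝ)).const_mul c).const_add (y j)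
  have h2 : HasDerivAt g d (y j + c * 0) := by simpa using hg
  have h3 := (h2.comp (0 : ℝ) h1).mul_const (∏ k ∈ Finset.univ.erase j, β k (y k))
  rw [← mul_assoc, mul_comm c]
  exact h3

/-- The kernel used for the `i`-th component of the velocity. -/
def velKernel (i : Fin 3) : E3 → ℝ :=
  prodKernel (Function.update (fun _ => hatProfile) i wideHatProfile)

open Classical in
/-- The kernel used for the `j`-th derivative of the `i`-th component of the velocity. -/
def gradKernel (j i : Fin 3) : E3 → ℝ :=
  prodKernel (Function.update (Function.update (fun _ => hatProfile) i wideHatProfile) j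
    (if j = i then wideProfile else bumpProfile))

theorem isProfile_update {β : Fin 3 → ℝ → ℝ} (hβ : ∀ k, IsProfile (β k)) {j : Fin 3} {g : ℝ → ℝ}
    (hg : IsProfile g) (k : Fin 3) : IsProfile (Function.update β j g k) := by
  by_cases hk : k = j
  · subst hk
    simpa using hg
  · simpa [hk] using hβ k

theorem isKernel_velKernel (i : Fin 3) : IsKernel (velKernel i) :=
  isKernel_prodKernel (isProfile_update (fun _ => isProfile_hat) isProfile_wideHat)

theorem isKernel_gradKernel (j i : Fin 3) : IsKernel (gradKernel j i) := by
  refine isKernel_prodKernel (isProfile_update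
    (isProfile_update (fun _ => isProfile_hat) isProfile_wideHat) ?_)
  split_ifs
  · exact isProfile_wide
  · exact isProfile_bump

/-- Only the factor in direction `j` is differentiated. It is a box average over a unit interval, of
`bumpProfile` if `j ≠ i` and of `wideProfile` if `j = i`, so its derivative is a unit forward
difference. The speed `c` will be `h⁻¹`. -/
theorem hasLineDerivAt_velKernel (i j : Fin 3) (y : E3) (c : ℝ) :
    HasDerivAt (fun t : ℝ => velKernel i (y + (c * t) • basisVec j))
      (c * (gradKernel j i (y + basisVec j) - gradKernel j i y)) 0 := by
  classical
  have e : velKernel i = prodKernel (Function.update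
      (Function.update (fun _ => hatProfile) i wideHatProfile) j
      (if j = i then wideHatProfile else hatProfile)) := by
    rw [velKernel]
    congr 1
    split_ifs with h
    · rw [h, Function.update_idem]
    · rw [eq_comm, Function.update_eq_self_iff, Function.update_of_ne h]
  have hd : HasDerivAt (if j = i then wideHatProfile else hatProfile)
      ((if j = i then wideProfile else bumpProfile) (y j + 1)
        - (if j = i then wideProfile else bumpProfile) (y j)) (y j) := by
    split_ifs with h
    · rw [wideProfile_add_one_sub]
      exact hasDerivAt_wideHatProfile _
    · exact hasDerivAt_hatProfile _
  rw [e]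
  convert hasLineDerivAt_prodKernel
    (β := Function.update (fun _ => hatProfile) i wideHatProfile) hd c using 2
  rw [gradKernel, ← one_smul ℝ (basisVec j), prodKernel_update_add, prodKernel_update, sub_mul]

/-- The central difference on the right acts on a kernel that no longer depends on `i`. This is what
lets the three diagonal derivatives combine into the discrete divergence. -/
theorem gradKernel_diag (i : Fin 3) (y : E3) :
    gradKernel i i (y + basisVec i) - gradKernel i i y
      = 1 / 2 * (prodKernel (fun _ => hatProfile) (y + basisVec i)
        - prodKernel (fun _ => hatProfile) (y - basisVec i)) := by
  have e : prodKernel (fun _ => hatProfile)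
      = prodKernel (Function.update (fun _ => hatProfile) i hatProfile) := by
    rw [Function.update_eq_self_iff.2 rfl]
  have e1 : y + basisVec i = y + (1 : ℝ) • basisVec i := by rw [one_smul]
  have e2 : y - basisVec i = y + (-1 : ℝ) • basisVec i := by rw [neg_one_smul, sub_eq_add_neg]
  rw [e, gradKernel, if_pos rfl, Function.update_idem, e1, e2, prodKernel_update_add,
    prodKernel_update_add, prodKernel_update_add, prodKernel_update, ← sub_eq_add_neg]
  have h := wideProfile_add_one_sub (y i)
  linear_combination (∏ k ∈ Finset.univ.erase i, hatProfile (y k)) * h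

/-! ### Smoothed grid functions -/

/-- The smoothed version `∑ z, Θ ((x - h z) / h) a z` of a grid function, with a kernel `Θ i` for
each component. -/
def smear (h : ℝ) (Θ : Fin 3 → E3 → ℝ) (a : Idx → E3) (x : E3) : E3 :=
  WithLp.toLp 2 fun i => ∑' z, Θ i (h⁻¹ • (x - gridPt h z)) * a z i

section Smear

variable {h : ℝ} {Θ : Fin 3 → E3 → ℝ} {a : Idx → E3}

theorem smear_apply (h : ℝ) (Θ : Fin 3 → E3 → ℝ) (a : Idx → E3) (x : E3) (i : Fin 3) :
    smear h Θ a x i = ∑' z, Θ i (h⁻¹ • (x - gridPt h z)) * a z i := rfl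

theorem smear_apply_eq_sum {S : Finset Idx} (hS : ∀ z ∉ S, a z = 0) (x : E3) (i : Fin 3) :
    smear h Θ a x i = ∑ z ∈ S, Θ i (h⁻¹ • (x - gridPt h z)) * a z i :=
  tsum_eq_sum fun z hz => by simp [hS z hz]

theorem contDiff_smear (hΘ : ∀ i, ContDiff ℝ ((⊤ : ℕ∞) : WithTop ℕ∞) (Θ i))
    (ha : a.support.Finite) : ContDiff ℝ ((⊤ : ℕ∞) : WithTop ℕ∞) (smear h Θ a) := by
  rw [contDiff_euclidean]
  intro i
  have hS : ∀ z ∉ ha.toFinset, a z = 0 := fun z hz => by simpa using hz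
  rw [show (fun x => smear h Θ a x i) = fun x => _ from funext fun x => smear_apply_eq_sum hS x i]
  refine ContDiff.sum fun z _ => ((hΘ i).comp ?_).mul contDiff_const
  exact (contDiff_id.sub contDiff_const).const_smul h⁻¹

theorem gridPt_add (h : ℝ) (z : Idx) (j : Fin 3) :
    gridPt h (z + unitIdx j) = gridPt h z + h • basisVec j := by
  ext k
  by_cases hk : k = j
  · subst hk
    simp [gridPt, unitIdx, basisVec, mul_add]
  · simp [gridPt, unitIdx, basisVec, hk]

theorem gridPt_sub (h : ℝ) (z : Idx) (j : Fin 3) :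
    gridPt h (z - unitIdx j) = gridPt h z - h • basisVec j := by
  have := gridPt_add h (z - unitIdx j) j
  rw [sub_add_cancel] at this
  rw [this, add_sub_cancel_right]

/-- A unit translation of the rescaled kernel is a shift of the index, which moves onto the grid
function: summation by parts in kernel form. -/
theorem tsum_kernel_add (hh : h ≠ 0) (K : E3 → ℝ) (b : Idx → ℝ) (x : E3) (j : Fin 3) :
    ∑' z, K (h⁻¹ • (x - gridPt h z) + basisVec j) * b z
      = ∑' z, K (h⁻¹ • (x - gridPt h z)) * b (z + unitIdx j) := by
  rw [← tsum_shift (unitIdx j)]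
  refine tsum_congr fun z => ?_
  congr 2
  rw [gridPt_add, ← sub_sub, smul_sub _ _ (h • basisVec j), smul_smul, inv_mul_cancel₀ hh, one_smul,
    sub_add_cancel]

theorem tsum_kernel_sub (hh : h ≠ 0) (K : E3 → ℝ) (b : Idx → ℝ) (x : E3) (j : Fin 3) :
    ∑' z, K (h⁻¹ • (x - gridPt h z) - basisVec j) * b z
      = ∑' z, K (h⁻¹ • (x - gridPt h z)) * b (z - unitIdx j) := by
  rw [← tsum_shift (-unitIdx j)]
  refine tsum_congr fun z => ?_
  rw [← sub_eq_add_neg]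
  congr 2
  rw [gridPt_sub, ← sub_add, smul_add, smul_smul, inv_mul_cancel₀ hh, one_smul,
    add_sub_cancel_right]

/-- Pointwise, a smoothed grid function is controlled by the values at nearby grid points. -/
theorem norm_smear_sq_le {M : ℝ} (hM : ∀ i y, |Θ i y| ≤ M)
    (hsupp : ∀ i y, Θ i y ≠ 0 → ∀ k, |y k| ≤ 2) (hh : 0 < h) (x : E3) :
    ‖smear h Θ a x‖ ^ 2 ≤ 3 * M ^ 2 * 343 *
      ∑ m ∈ Finset.Icc (fun _ : Fin 3 => (-3 : ℤ)) (fun _ : Fin 3 => (3 : ℤ)),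
        ‖a (cellIdx h x + m)‖ ^ 2 := by
  set B := Finset.Icc (fun _ : Fin 3 => (-3 : ℤ)) (fun _ : Fin 3 => (3 : ℤ)) with hB
  have hM0 : 0 ≤ M := (abs_nonneg _).trans (hM 0 0)
  -- Here `343 = 7 ^ 3`: kernel arguments have coordinates of size at most 2 and `x` lies within one
  -- cell of its base point, so only index offsets between -3 and 3 contribute.
  have hcard : (B.card : ℝ) = 343 := by
    rw [hB, Pi.card_Icc]
    simp
  have key : ∀ i, |smear h Θ a x i| ≤ M * ∑ m ∈ B, ‖a (cellIdx h x + m)‖ := by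
    intro i
    rw [smear_apply, ← tsum_shift (cellIdx h x), tsum_eq_sum (s := B), Finset.mul_sum]
    · refine (Finset.abs_sum_le_sum_abs _ _).trans (Finset.sum_le_sum fun m _ => ?_)
      rw [abs_mul, add_comm m]
      exact mul_le_mul (hM _ _) (PiLp.norm_apply_le (a (cellIdx h x + m)) i) (abs_nonneg _) hM0
    · intro m hm
      by_contra hne
      apply hm
      have h1 := hsupp i _ (left_ne_zero_of_mul hne)
      have h2 : ∀ k, -3 ≤ m k ∧ m k ≤ 3 := fun k => by
        have h3 := abs_le.1 (h1 k)
        simp only [gridPt, PiLp.smul_apply, PiLp.sub_apply, smul_eq_mul, Pi.add_apply,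
          Int.cast_add, cellIdx] at h3
        have e : h⁻¹ * (x k - h * ((m k : ℝ) + (⌊x k / h⌋ : ℤ)))
            = x k / h - m k - (⌊x k / h⌋ : ℤ) := by
          field_simp
          ring
        rw [e] at h3
        have h4 := Int.floor_le (x k / h)
        have h5 := Int.lt_floor_add_one (x k / h)
        have h6 : (-3 : ℝ) < m k := by linarith
        have h7 : (m k : ℝ) < 4 := by linarith
        have h8 : (-3 : ℤ) < m k := by exact_mod_cast h6
        have h9 : m k < 4 := by exact_mod_cast h7
        omega
      rw [hB, Finset.mem_Icc, Pi.le_def, Pi.le_def]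
      exact ⟨fun k => (h2 k).1, fun k => (h2 k).2⟩
  have hcs : (∑ m ∈ B, ‖a (cellIdx h x + m)‖) ^ 2
      ≤ 343 * ∑ m ∈ B, ‖a (cellIdx h x + m)‖ ^ 2 := by
    rw [← hcard]
    exact sq_sum_le_card_mul_sum_sq
  rw [EuclideanSpace.norm_sq_eq]
  calc ∑ i, ‖smear h Θ a x i‖ ^ 2
      ≤ ∑ _i : Fin 3, (M * ∑ m ∈ B, ‖a (cellIdx h x + m)‖) ^ 2 :=
        Finset.sum_le_sum fun i _ => pow_le_pow_left₀ (norm_nonneg _) (key i) 2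
    _ = 3 * M ^ 2 * (∑ m ∈ B, ‖a (cellIdx h x + m)‖) ^ 2 := by
        simp
        ring
    _ ≤ 3 * M ^ 2 * (343 * ∑ m ∈ B, ‖a (cellIdx h x + m)‖ ^ 2) := by gcongr
    _ = _ := by ring

theorem integrable_comp_cellIdx (hh : 0 < h) {F : Idx → ℝ} (hF : F.support.Finite) :
    Integrable fun x : E3 => F (cellIdx h x) := by
  have hS : ∀ z ∉ hF.toFinset, F z = 0 := fun z hz => by simpa using hz
  rw [show (fun x : E3 => F (cellIdx h x)) = fun x => ∑ z ∈ hF.toFinset,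
    (cell h z).indicator (fun _ => F z) x from funext fun x =>
      comp_cellIdx_eq_sum hh (fun z _ => F z) (fun z hz => by ext; exact hS z hz) x]
  exact integrable_finsetSum _ fun z _ => (integrable_indicator_iff (measurableSet_cell h z)).2
    (integrableOn_const (cell_ne_top hh z))

theorem integral_norm_smear_sq_le {M : ℝ} (hM : ∀ i y, |Θ i y| ≤ M)
    (hsupp : ∀ i y, Θ i y ≠ 0 → ∀ k, |y k| ≤ 2) (hh : 0 < h) (ha : a.support.Finite)
    (Ω : Set E3) :
    ∫ x in Ω, ‖smear h Θ a x‖ ^ 2 ≤ 3 * M ^ 2 * 343 * 343 * (h ^ 3 * ∑' z, ‖a z‖ ^ 2) := by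
  set B := Finset.Icc (fun _ : Fin 3 => (-3 : ℤ)) (fun _ : Fin 3 => (3 : ℤ)) with hB
  have hcard : (B.card : ℝ) = 343 := by
    rw [hB, Pi.card_Icc]
    simp
  have hfs : ∀ m : Idx, (fun z => ‖a (z + m)‖ ^ 2).support.Finite := fun m =>
    (finite_support_shift ha m).subset fun z hz hz0 => hz (by simp [hz0])
  have hi : ∀ m ∈ B, Integrable fun x : E3 => ‖a (cellIdx h x + m)‖ ^ 2 := fun m _ =>
    integrable_comp_cellIdx hh (hfs m)
  have hint : Integrable fun x : E3 => 3 * M ^ 2 * 343 * ∑ m ∈ B, ‖a (cellIdx h x + m)‖ ^ 2 :=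
    (integrable_finsetSum _ hi).const_mul _
  calc ∫ x in Ω, ‖smear h Θ a x‖ ^ 2
      ≤ ∫ x in Ω, 3 * M ^ 2 * 343 * ∑ m ∈ B, ‖a (cellIdx h x + m)‖ ^ 2 :=
        integral_mono_of_nonneg (Eventually.of_forall fun x => sq_nonneg _) hint.integrableOn
          (Eventually.of_forall fun x => norm_smear_sq_le hM hsupp hh x)
    _ ≤ ∫ x, 3 * M ^ 2 * 343 * ∑ m ∈ B, ‖a (cellIdx h x + m)‖ ^ 2 :=
        setIntegral_le_integral hint (Eventually.of_forall fun x => by positivity)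
    _ = 3 * M ^ 2 * 343 * ∑ m ∈ B, (h ^ 3 * ∑' z, ‖a z‖ ^ 2) := by
        rw [integral_const_mul, integral_finsetSum _ hi]
        congr 1
        refine Finset.sum_congr rfl fun m _ => ?_
        rw [integral_comp_cellIdx hh (hfs m), tsum_shift m fun z => ‖a z‖ ^ 2]
    _ = _ := by
        rw [Finset.sum_const, nsmul_eq_mul, hcard]
        ring

/-! ### Smooth solenoidal fields from discretely solenoidal ones -/

theorem hasDerivAt_smear_velKernel (ha : a.support.Finite) (x : E3) (i j : Fin 3) :
    HasDerivAt (fun t : ℝ => smear h velKernel a (x + t • basisVec j) i)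
      (∑' z, (h⁻¹ * (gradKernel j i (h⁻¹ • (x - gridPt h z) + basisVec j)
        - gradKernel j i (h⁻¹ • (x - gridPt h z)))) * a z i) 0 := by
  have hS : ∀ z ∉ ha.toFinset, a z = 0 := fun z hz => by simpa using hz
  rw [show (fun t : ℝ => smear h velKernel a (x + t • basisVec j) i) = fun t => _ from
    funext fun t => smear_apply_eq_sum hS _ i, tsum_eq_sum (s := ha.toFinset) fun z hz => by
      simp [hS z hz]]
  refine HasDerivAt.fun_sum fun z _ => HasDerivAt.mul_const ?_ _
  refine (hasLineDerivAt_velKernel i j (h⁻¹ • (x - gridPt h z)) h⁻¹).congr_of_eventuallyEq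
    (Eventually.of_forall fun t => ?_)
  dsimp only
  rw [mul_smul, ← smul_add, add_sub_right_comm]

theorem pderiv_smear_velKernel_apply (ha : a.support.Finite) (x : E3) (i j : Fin 3) :
    pderiv j (smear h velKernel a) x i
      = ∑' z, (h⁻¹ * (gradKernel j i (h⁻¹ • (x - gridPt h z) + basisVec j)
        - gradKernel j i (h⁻¹ • (x - gridPt h z)))) * a z i := by
  have hd : DifferentiableAt ℝ (smear h velKernel a) x :=
    (contDiff_smear (fun i => (isKernel_velKernel i).contDiff) ha).differentiable (by simp) x
  have h1 : HasDerivAt (fun t : ℝ => smear h velKernel a (x + t • basisVec j))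
      (pderiv j (smear h velKernel a) x) 0 := hd.hasFDerivAt.hasLineDerivAt (basisVec j)
  have h2 := (EuclideanSpace.proj i : E3 →L[ℝ] ℝ).hasFDerivAt.comp_hasDerivAt
    (0 : ℝ) h1
  exact h2.unique (hasDerivAt_smear_velKernel ha x i j)

/-- Differentiation of a smoothed velocity amounts to smoothing of the forward differences. -/
theorem pderiv_smear_velKernel (hh : 0 < h) (ha : a.support.Finite) (j : Fin 3) :
    pderiv j (smear h velKernel a) = smear h (gradKernel j) (dPlus h j a) := by
  ext x i
  have hs : ∀ K : Idx → ℝ, Summable fun z => K z * a z i := fun K =>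
    summable_of_imp_field ha fun z hz => by simp [hz]
  have hs' : Summable fun z => gradKernel j i (h⁻¹ • (x - gridPt h z)) * a (z + unitIdx j) i :=
    summable_of_eq_zero_off (finite_support_shift ha (unitIdx j)) fun z hz => by
      simp only [Function.mem_support, not_not] at hz
      simp [hz]
  rw [pderiv_smear_velKernel_apply ha, smear_apply]
  simp_rw [mul_assoc, sub_mul]
  rw [tsum_mul_left, (hs _).tsum_sub (hs _),
    tsum_kernel_add hh.ne' (gradKernel j i) (fun z => a z i), ← hs'.tsum_sub (hs _),
    ← tsum_mul_left]
  refine tsum_congr fun z => ?_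
  simp only [dPlus, PiLp.smul_apply, PiLp.sub_apply, smul_eq_mul]
  ring

/-- By `gradKernel_diag` every diagonal derivative smooths a central difference with the same
product of hats `Ψ`, so the divergence is the smoothed discrete divergence, which is zero. -/
theorem divergence_smear_velKernel (hh : 0 < h) (ha : a.support.Finite)
    (hd : ∀ z, dDiv h a z = 0) (x : E3) : ∑ i, pderiv i (smear h velKernel a) x i = 0 := by
  set Ψ := prodKernel fun _ => hatProfile
  have hs : ∀ K : Idx → ℝ, ∀ i, Summable fun z => K z * a z i := fun K i =>
    summable_of_imp_field ha fun z hz => by simp [hz]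
  have hs1 : ∀ (K : Idx → ℝ) (i : Fin 3), Summable fun z => K z * a (z + unitIdx i) i :=
    fun K i => summable_of_eq_zero_off (finite_support_shift ha (unitIdx i)) fun z hz => by
      simp only [Function.mem_support, not_not] at hz
      simp [hz]
  have hs2 : ∀ (K : Idx → ℝ) (i : Fin 3), Summable fun z => K z * a (z - unitIdx i) i :=
    fun K i => summable_of_eq_zero_off (finite_support_shift ha (-unitIdx i)) fun z hz => by
      simp only [Function.mem_support, not_not, ← sub_eq_add_neg] at hz
      simp [hz]
  have e : ∀ i, pderiv i (smear h velKernel a) x i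
      = ∑' z, Ψ (h⁻¹ • (x - gridPt h z)) * dCentral h i (fun y => a y i) z := by
    intro i
    rw [pderiv_smear_velKernel_apply ha]
    simp_rw [gradKernel_diag, mul_assoc, sub_mul]
    rw [tsum_mul_left, tsum_mul_left, (hs _ i).tsum_sub (hs _ i),
      tsum_kernel_add hh.ne' Ψ (fun z => a z i), tsum_kernel_sub hh.ne' Ψ (fun z => a z i),
      ← (hs1 _ i).tsum_sub (hs2 _ i), ← tsum_mul_left, ← tsum_mul_left]
    refine tsum_congr fun z => ?_
    simp only [dCentral, smul_eq_mul, mul_inv]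
    ring
  have hsum : ∀ i ∈ Finset.univ, Summable fun z =>
      Ψ (h⁻¹ • (x - gridPt h z)) * dCentral h i (fun y => a y i) z := fun i _ => by
    refine (((hs1 (fun z => Ψ (h⁻¹ • (x - gridPt h z))) i).sub
      (hs2 (fun z => Ψ (h⁻¹ • (x - gridPt h z))) i)).mul_left (2 * h)⁻¹).congr fun z => ?_
    simp only [dCentral, smul_eq_mul]
    ring
  simp_rw [e]
  rw [← Summable.tsum_finsetSum hsum]
  simp_rw [← Finset.mul_sum]
  change ∑' z, Ψ (h⁻¹ • (x - gridPt h z)) * dDiv h a z = 0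
  simp [hd]

theorem velKernel_support {i : Fin 3} {y : E3} (hy : velKernel i y ≠ 0) (k : Fin 3) :
    |y k| ≤ if k = i then 2 else 1 := by
  have h1 : Function.update (fun _ => hatProfile) i wideHatProfile k (y k) ≠ 0 := fun h =>
    hy (by rw [velKernel, prodKernel]; exact Finset.prod_eq_zero (Finset.mem_univ k) h)
  split_ifs with hk
  · subst hk
    rw [Function.update_self] at h1
    exact isProfile_wideHat.support _ h1
  · rw [Function.update_of_ne hk] at h1
    exact abs_le.2 ⟨(hatProfile_support h1).1.le, (hatProfile_support h1).2.le⟩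

/-- The closed box around `h z` that carries the smoothed velocity. -/
def kernelBox (h : ℝ) (z : Idx) (i : Fin 3) : Set E3 :=
  {x | ∀ k, |x k - gridPt h z k| ≤ if k = i then 2 * h else h}

theorem isClosed_kernelBox (h : ℝ) (z : Idx) (i : Fin 3) : IsClosed (kernelBox h z i) := by
  simp only [kernelBox, ofPred_forall]
  exact isClosed_iInter fun k => isClosed_le (by fun_prop) continuous_const

/-- The box touches the faces of the cube of side `4 * h` only in direction `i`. The cube is
half-open, so its upper face needs the cube of the neighbour in that direction, which is in the grid
because `z` is interior. -/
theorem kernelBox_subset {Ω : Set E3} (hh : 0 < h) {z : Idx}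
    (hz : z ∈ grid Ω h \ gridBoundary (grid Ω h)) (i : Fin 3) : kernelBox h z i ⊆ Ω := by
  intro x hx
  have hb : ∀ k, |x k - gridPt h z k| ≤ 2 * h := fun k => (hx k).trans (by split_ifs <;> linarith)
  by_cases hi : x i - gridPt h z i < 2 * h
  · refine hz.1.2 fun k => ⟨by linarith [(abs_le.1 (hb k)).1], ?_⟩
    by_cases hk : k = i
    · subst hk
      linarith
    · have := hx k
      rw [if_neg hk] at this
      linarith [(abs_le.1 this).2]
  · refine (add_mem_of_interior hz i).1.2 fun k => ?_
    rw [gridPt_add]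
    by_cases hk : k = i
    · subst hk
      have := (abs_le.1 (hb k)).2
      simp [basisVec]
      constructor <;> linarith
    · have := hx k
      rw [if_neg hk] at this
      simp [basisVec, hk]
      constructor <;> linarith [(abs_le.1 this).1, (abs_le.1 this).2]

/-- The support lies in a finite union of closed kernel boxes, each contained in `Ω`; boundedness of
`Ω` makes this union compact. -/
theorem isSolenoidalTest_smear {Ω : Set E3} (hΩ : Bornology.IsBounded Ω) (hh : 0 < h)
    (ha : ∀ z, z ∉ grid Ω h \ gridBoundary (grid Ω h) → a z = 0)
    (hd : ∀ z, dDiv h a z = 0) : IsSolenoidalTest Ω (smear h velKernel a) := by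
  have hG := finite_grid hΩ hh
  have hfin : a.support.Finite := finite_support_of_grid hG fun z hz => ha z fun h => hz h.1
  set K : Set E3 := ⋃ z ∈ hfin.toFinset, ⋃ i, kernelBox h z i with hKdef
  have hKc : IsClosed K := Set.Finite.isClosed_biUnion (Finset.finite_toSet _) fun z _ =>
    isClosed_iUnion_of_finite fun i => isClosed_kernelBox h z i
  have hKΩ : K ⊆ Ω := by
    refine iUnion₂_subset fun z hz => iUnion_subset fun i => kernelBox_subset hh ?_ i
    by_contra hc
    simp [ha z hc] at hz
  have hsupp : tsupport (smear h velKernel a) ⊆ K := by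
    refine closure_minimal (fun x hx => ?_) hKc
    by_contra hxK
    apply hx
    ext i
    rw [smear_apply_eq_sum (S := hfin.toFinset) fun z hz => by simpa using hz]
    refine Finset.sum_eq_zero fun z hz => ?_
    by_contra hne
    refine hxK (mem_iUnion₂.2 ⟨z, hz, mem_iUnion.2 ⟨i, fun k => ?_⟩⟩)
    have h1 := velKernel_support (left_ne_zero_of_mul hne) k
    rw [PiLp.smul_apply, PiLp.sub_apply, smul_eq_mul, abs_mul, abs_of_pos (inv_pos.2 hh),
      inv_mul_le_iff₀ hh] at h1
    refine h1.trans (le_of_eq ?_)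
    split_ifs <;> ring
  refine ⟨⟨contDiff_smear (fun i => (isKernel_velKernel i).contDiff) hfin, ?_, hsupp.trans hKΩ⟩,
    divergence_smear_velKernel hh hfin hd⟩
  exact (Metric.isCompact_of_isClosed_isBounded hKc (hΩ.subset hKΩ)).of_isClosed_subset
    (isClosed_tsupport _) hsupp

end Smear

/-! ### Solenoidal test fields in `H¹` -/

theorem IsTest.pderiv {E : Type} [NormedAddCommGroup E] [NormedSpace ℝ E] {Ω : Set E3} {φ : E3 → E}
    (hφ : IsTest Ω φ) (i : Fin 3) : IsTest Ω (FDNavierStokes.pderiv i φ) := by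
  refine ⟨?_, hφ.2.1.fderiv_apply ℝ (basisVec i), ?_⟩
  · exact ((contDiff_infty_iff_fderiv.1 hφ.1).2).clm_apply contDiff_const
  · refine Subset.trans (closure_mono fun x hx => ?_)
      ((tsupport_fderiv_subset ℝ (f := φ)).trans hφ.2.2)
    rw [Function.mem_support] at hx ⊢
    intro h
    exact hx (by simp [FDNavierStokes.pderiv, h])

theorem IsTest.memLp {E : Type} [NormedAddCommGroup E] [NormedSpace ℝ E] {Ω : Set E3} {φ : E3 → E}
    (hφ : IsTest Ω φ) : MemLp φ 2 (volume.restrict Ω) :=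
  hφ.1.continuous.memLp_of_hasCompactSupport hφ.2.1

theorem IsTest.hasWeakPartial {Ω : Set E3} {V : E3 → E3} (hV : IsTest Ω V) (i : Fin 3) :
    HasWeakPartial Ω i V (FDNavierStokes.pderiv i V) := by
  intro φ hφ
  have hφ' := hφ.pderiv i
  have hV' := hV.pderiv i
  have hz : ∀ {ψ : E3 → ℝ}, IsTest Ω ψ → ∀ x, x ∉ Ω → ψ x = 0 := fun hψ x hx =>
    image_eq_zero_of_notMem_tsupport fun h => hx (hψ.2.2 h)
  have hI : ∀ {ψ : E3 → ℝ} {W : E3 → E3}, IsTest Ω ψ → IsTest Ω W →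
      Integrable fun x => ψ x • W x := fun hψ hW =>
    (hψ.1.continuous.smul hW.1.continuous).integrable_of_hasCompactSupport hψ.2.1.smul_right
  rw [setIntegral_eq_integral_of_forall_compl_eq_zero fun x hx => by rw [hz hφ' x hx, zero_smul],
    setIntegral_eq_integral_of_forall_compl_eq_zero fun x hx => by rw [hz hφ x hx, zero_smul]]
  refine (neg_eq_iff_eq_neg.2 ?_).symm
  exact integral_bilinear_hasLineDerivAt_right_eq_neg_left_of_integrable
    (B := ContinuousLinearMap.lsmul ℝ ℝ) (v := basisVec i) (hI hφ' hV) (hI hφ hV') (hI hφ hV)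
    (fun x _ => ((hφ.1.differentiable (by simp)) x).hasFDerivAt.hasLineDerivAt _)
    (fun x _ => ((hV.1.differentiable (by simp)) x).hasFDerivAt.hasLineDerivAt _)

theorem HasWeakPartial.congr_ae {Ω : Set E3} {i : Fin 3} {u v g k : E3 → E3}
    (huv : u =ᵐ[volume.restrict Ω] v) (hgk : g =ᵐ[volume.restrict Ω] k)
    (h : HasWeakPartial Ω i v k) : HasWeakPartial Ω i u g := by
  intro φ hφ
  have e1 : ∫ x in Ω, pderiv i φ x • u x = ∫ x in Ω, pderiv i φ x • v x :=
    integral_congr_ae (huv.mono fun x hx => by simp only [hx])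
  have e2 : ∫ x in Ω, φ x • g x = ∫ x in Ω, φ x • k x :=
    integral_congr_ae (hgk.mono fun x hx => by simp only [hx])
  rw [e1, e2]
  exact h φ hφ

/-- A solenoidal test field, together with its derivatives, as an element of `H¹_{0,σ}(Ω)`. -/
theorem IsSolenoidalTest.exists_jet {Ω : Set E3} {V : E3 → E3} (hV : IsSolenoidalTest Ω V) :
    ∃ U : H10sigma Ω, jetComponent Ω none U =ᵐ[volume.restrict Ω] V ∧
      ∀ j, jetComponent Ω (some j) U =ᵐ[volume.restrict Ω] pderiv j V := by
  let U : Jet Ω := WithLp.toLp 2 fun o => o.elim hV.1.memLp.toLp fun j => (hV.1.pderiv j).memLp.toLp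
  have h0 : (U none : E3 → E3) =ᵐ[volume.restrict Ω] V := hV.1.memLp.coeFn_toLp
  have h1 : ∀ j, (U (some j) : E3 → E3) =ᵐ[volume.restrict Ω] pderiv j V := fun j =>
    (hV.1.pderiv j).memLp.coeFn_toLp
  have hU : U ∈ H1 Ω := fun i => (hV.1.hasWeakPartial i).congr_ae h0 (h1 i)
  refine ⟨⟨U, hU, Submodule.le_topologicalClosure _ (Submodule.subset_span ⟨hU, V, hV, h0⟩)⟩,
    h0, h1⟩

theorem continuous_integral_smul {Ω : Set E3} {ψ : E3 → ℝ} (hψ : MemLp ψ 2 (volume.restrict Ω)) :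
    Continuous fun U : L2On E3 Ω => ∫ x in Ω, ψ x • U x := by
  have hk : ∀ k, MemLp (fun x => ψ x • basisVec k) 2 (volume.restrict Ω) := fun k =>
    ((ContinuousLinearMap.id ℝ ℝ).smulRight (basisVec k)).comp_memLp' hψ
  have e : (fun U : L2On E3 Ω => ∫ x in Ω, ψ x • U x)
      = fun U : L2On E3 Ω => ∑ k, inner ℝ (hk k).toLp U • basisVec k := by
    ext U k
    have hint : Integrable (fun x => ψ x • U x) (volume.restrict Ω) :=
      memLp_one_iff_integrable.1 ((Lp.memLp U).smul hψ)
    have h1 := (EuclideanSpace.proj k : E3 →L[ℝ] ℝ).integral_comp_comm hint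
    have h2 : inner ℝ (hk k).toLp U = ∫ x in Ω, ψ x * U x k := by
      rw [L2.inner_def]
      refine integral_congr_ae ((hk k).coeFn_toLp.mono fun x hx => ?_)
      dsimp only
      rw [hx]
      simp [basisVec, real_inner_smul_left, EuclideanSpace.inner_single_left]
    have h3 : (∑ k, inner ℝ (hk k).toLp U • basisVec k : E3) k = inner ℝ (hk k).toLp U := by
      rw [WithLp.ofLp_sum, Finset.sum_apply, Finset.sum_eq_single k]
      · simp [basisVec]
      · intro j _ hj
        simp [basisVec, hj.symm]
      · simp
    rw [h3, h2]
    exact h1.symm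
  rw [e]
  fun_prop

/-- Each weak-derivative identity is a closed condition in the jet norm. The result makes `H10sigma
Ω` complete, as weak compactness over it requires. -/
theorem isClosed_H1 (Ω : Set E3) : IsClosed (H1 Ω : Set (Jet Ω)) := by
  have e : (H1 Ω : Set (Jet Ω)) = ⋂ (i : Fin 3) (φ : E3 → ℝ) (_ : IsTest Ω φ),
      {U : Jet Ω | ∫ x in Ω, pderiv i φ x • U none x = -∫ x in Ω, φ x • U (some i) x} := by
    ext U
    simp only [mem_iInter]
    rfl
  rw [e]
  refine isClosed_iInter fun i => isClosed_iInter fun φ => isClosed_iInter fun hφ =>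
    isClosed_eq ?_ ?_
  · exact (continuous_integral_smul (hφ.pderiv i).memLp).comp (PiLp.continuous_apply 2 _ none)
  · exact ((continuous_integral_smul hφ.memLp).comp (PiLp.continuous_apply 2 _ (some i))).neg

instance completeSpace_H10sigma (Ω : Set E3) : CompleteSpace (H10sigma Ω) :=
  ((isClosed_H1 Ω).inter (Submodule.isClosed_topologicalClosure _)).completeSpace_coe

theorem norm_jet_sq {Ω : Set E3} (U : H10sigma Ω) :
    ‖U‖ ^ 2 = ‖jetComponent Ω none U‖ ^ 2 + ∑ j, ‖jetComponent Ω (some j) U‖ ^ 2 := by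
  rw [← Submodule.norm_coe, PiLp.norm_sq_eq_of_L2, Fintype.sum_option]
  rfl

theorem IsKernel.exists_bound {Θ : E3 → ℝ} (hΘ : IsKernel Θ) : ∃ M, ∀ y, |Θ y| ≤ M := by
  have hK : HasCompactSupport Θ := by
    refine HasCompactSupport.of_support_subset_isCompact (isCompact_closedBall (0 : E3) 4)
      fun y hy => ?_
    rw [mem_closedBall_zero_iff, EuclideanSpace.norm_eq]
    refine Real.sqrt_le_iff.2 ⟨by norm_num, ?_⟩
    have h1 : ∀ k, ‖y k‖ ^ 2 ≤ 2 ^ 2 := fun k =>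
      pow_le_pow_left₀ (norm_nonneg _) (hΘ.support y hy k) 2
    rw [Fin.sum_univ_three]
    linarith [h1 0, h1 1, h1 2]
  obtain ⟨M, hM⟩ := hΘ.contDiff.continuous.bounded_above_of_compact_support hK
  exact ⟨M, hM⟩

theorem norm_L2On_sq {E : Type} [NormedAddCommGroup E] [InnerProductSpace ℝ E] {Ω : Set E3}
    {F : L2On E Ω} {g : E3 → E} (h : F =ᵐ[volume.restrict Ω] g) : ‖F‖ ^ 2 = ∫ x in Ω, ‖g x‖ ^ 2 := by
  rw [← real_inner_self_eq_norm_sq, L2.inner_def]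
  exact integral_congr_ae (h.mono fun x hx => by simp only [hx, real_inner_self_eq_norm_sq])

/-- The smoothed velocities are bounded in `H¹_{0,σ}(Ω)` by the discrete `H¹` norm. -/
theorem exists_smoothed_velocity {Ω : Set E3} (hΩ : Bornology.IsBounded Ω) :
    ∃ C, 0 ≤ C ∧ ∀ h, 0 < h → ∀ a : Idx → E3,
      (∀ z, z ∉ grid Ω h \ gridBoundary (grid Ω h) → a z = 0) → (∀ z, dDiv h a z = 0) →
      ∃ U : H10sigma Ω,
        jetComponent Ω none U =ᵐ[volume.restrict Ω] smear h velKernel a ∧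
        (∀ j, jetComponent Ω (some j) U =ᵐ[volume.restrict Ω]
          smear h (gradKernel j) (dPlus h j a)) ∧
        (∀ x, x ∉ Ω → smear h velKernel a x = 0) ∧
        (∀ j x, x ∉ Ω → smear h (gradKernel j) (dPlus h j a) x = 0) ∧
        ‖U‖ ^ 2 ≤ C * (h ^ 3 * ∑' z, ‖a z‖ ^ 2 + h ^ 3 * ∑' z, ∑ j, ‖dPlus h j a z‖ ^ 2) := by
  choose Mv hMv using fun i => (isKernel_velKernel i).exists_bound
  choose Mg hMg using fun j i => (isKernel_gradKernel j i).exists_bound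
  set M := ∑ i, |Mv i| + ∑ j, ∑ i, |Mg j i|
  have hv : ∀ i y, |velKernel i y| ≤ M := fun i y => by
    have h1 := Finset.single_le_sum (f := fun i => |Mv i|) (fun i _ => abs_nonneg _)
      (Finset.mem_univ i)
    have h2 : 0 ≤ ∑ j, ∑ i, |Mg j i| :=
      Finset.sum_nonneg fun j _ => Finset.sum_nonneg fun i _ => abs_nonneg _
    have := (hMv i y).trans (le_abs_self _)
    linarith
  have hg : ∀ j i y, |gradKernel j i y| ≤ M := fun j i y => by
    have h1 := Finset.single_le_sum (f := fun i => |Mg j i|) (fun i _ => abs_nonneg _)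
      (Finset.mem_univ i)
    have h2 := Finset.single_le_sum (f := fun j => ∑ i, |Mg j i|)
      (fun j _ => Finset.sum_nonneg fun i _ => abs_nonneg _) (Finset.mem_univ j)
    have h3 : 0 ≤ ∑ i, |Mv i| := Finset.sum_nonneg fun i _ => abs_nonneg _
    have := (hMg j i y).trans (le_abs_self _)
    linarith
  refine ⟨3 * M ^ 2 * 343 * 343, by positivity, fun h hh a ha hd => ?_⟩
  have hG := finite_grid hΩ hh
  have hfin : a.support.Finite := finite_support_of_grid hG fun z hz => ha z fun h => hz h.1
  have hV := isSolenoidalTest_smear hΩ hh ha hd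
  obtain ⟨U, hU0, hU1⟩ := hV.exists_jet
  have hU2 : ∀ j, jetComponent Ω (some j) U =ᵐ[volume.restrict Ω]
      smear h (gradKernel j) (dPlus h j a) := fun j => by
    rw [← pderiv_smear_velKernel hh hfin]
    exact hU1 j
  refine ⟨U, hU0, hU2, fun x hx => image_eq_zero_of_notMem_tsupport fun h => hx (hV.1.2.2 h),
    fun j x hx => ?_, ?_⟩
  · rw [← pderiv_smear_velKernel hh hfin]
    exact image_eq_zero_of_notMem_tsupport fun h => hx ((hV.1.pderiv j).2.2 h)
  · rw [norm_jet_sq, norm_L2On_sq hU0, mul_add]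
    have hs : ∀ j ∈ Finset.univ, Summable fun z => ‖dPlus h j a z‖ ^ 2 := fun j _ =>
      summable_of_imp_field (finite_support_dPlus h j hfin) fun z hz => by simp [hz]
    rw [Summable.tsum_finsetSum hs, Finset.mul_sum, Finset.mul_sum]
    refine add_le_add (integral_norm_smear_sq_le hv (fun i => (isKernel_velKernel i).support) hh
      hfin Ω) (Finset.sum_le_sum fun j _ => ?_)
    rw [norm_L2On_sq (hU2 j)]
    exact integral_norm_smear_sq_le (hg j) (fun i => (isKernel_gradKernel j i).support) hh
      (finite_support_dPlus h j hfin) Ω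

/-! ### Smoothing is asymptotically invisible in the weak topology -/

/-- A non-integrable function has integral zero by convention, which contradicts mass one. -/
theorem IsKernel.integrable {Θ : E3 → ℝ} (hΘ : IsKernel Θ) : Integrable Θ := by
  by_contra h
  have := hΘ.integral_eq
  rw [integral_undef h] at this
  exact zero_ne_one this

theorem norm_le_of_coord_le {y : E3} {r : ℝ} (hr : 0 ≤ r) (hy : ∀ k, |y k| ≤ 2 * r) :
    ‖y‖ ≤ 4 * r := by
  rw [EuclideanSpace.norm_eq]
  refine Real.sqrt_le_iff.2 ⟨by positivity, ?_⟩
  have h1 : ∀ k, ‖y k‖ ^ 2 ≤ (2 * r) ^ 2 := fun k => pow_le_pow_left₀ (norm_nonneg _) (hy k) 2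
  rw [Fin.sum_univ_three]
  nlinarith [h1 0, h1 1, h1 2, sq_nonneg r]

/-- Rescaling produces `h ^ 3`, mass one produces `φ g`, and the rest is the oscillation of `φ` over
the support. `integral_cell_sub` compares a cell integral with the same quantity `h ^ 3 * φ g`. -/
theorem integral_kernel_mul {Θ : E3 → ℝ} (hΘ : IsKernel Θ) {φ : E3 → ℝ} (hφ : Continuous φ)
    {h ε : ℝ} (hh : 0 < h) (g : E3) (hosc : ∀ x, ‖x - g‖ ≤ 4 * h → |φ x - φ g| ≤ ε) :
    |(∫ x, Θ (h⁻¹ • (x - g)) * φ x) - h ^ 3 * φ g| ≤ h ^ 3 * (ε * ∫ y, |Θ y|) := by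
  have e1 : ∫ x, Θ (h⁻¹ • (x - g)) * φ x = h ^ 3 * ∫ y, Θ y * φ (h • y + g) := by
    rw [← integral_add_right_eq_self _ g]
    have h1 := Measure.integral_comp_inv_smul_of_nonneg (volume : Measure E3)
      (fun y => Θ y * φ (h • y + g)) hh.le
    rw [finrank_euclideanSpace_fin] at h1
    rw [← smul_eq_mul, ← h1]
    refine integral_congr_ae (Eventually.of_forall fun x => ?_)
    simp [smul_smul, hh.ne']
  have hpt : ∀ y, |Θ y * (φ (h • y + g) - φ g)| ≤ ε * |Θ y| := fun y => by
    by_cases hy : Θ y = 0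
    · simp [hy]
    · rw [abs_mul, mul_comm]
      refine mul_le_mul_of_nonneg_right (hosc _ ?_) (abs_nonneg _)
      rw [add_sub_cancel_right, norm_smul, Real.norm_eq_abs, abs_of_pos hh, mul_comm]
      refine mul_le_mul_of_nonneg_right ?_ hh.le
      simpa using norm_le_of_coord_le (r := 1) zero_le_one fun k => by
        simpa using hΘ.support y hy k
  have hbound : Integrable fun y => ε * |Θ y| := hΘ.integrable.abs.const_mul ε
  have hint : Integrable fun y => Θ y * (φ (h • y + g) - φ g) :=
    hbound.mono' (hΘ.contDiff.continuous.mul (by fun_prop)).aestronglyMeasurable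
      (Eventually.of_forall hpt)
  have e2 : ∫ y, Θ y * φ (h • y + g) = (∫ y, Θ y * (φ (h • y + g) - φ g)) + φ g := by
    have h1 : (fun y => Θ y * φ (h • y + g))
        = fun y => Θ y * (φ (h • y + g) - φ g) + Θ y * φ g := by
      ext y
      ring
    rw [h1, integral_add hint (hΘ.integrable.mul_const _), integral_mul_const, hΘ.integral_eq,
      one_mul]
  rw [e1, e2, mul_add, add_sub_cancel_right, abs_mul, abs_of_pos (by positivity)]
  refine mul_le_mul_of_nonneg_left ?_ (by positivity)
  rw [← integral_const_mul, ← Real.norm_eq_abs]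
  exact norm_integral_le_of_norm_le hbound (Eventually.of_forall fun y => by
    rw [Real.norm_eq_abs]
    exact hpt y)

theorem integral_cell_sub {φ : E3 → ℝ} (hφ : Continuous φ) {h ε : ℝ} (hh : 0 < h) (z : Idx)
    (hosc : ∀ x, ‖x - gridPt h z‖ ≤ 4 * h → |φ x - φ (gridPt h z)| ≤ ε) :
    |(∫ x in cell h z, φ x) - h ^ 3 * φ (gridPt h z)| ≤ h ^ 3 * ε := by
  have hcell : ∀ x ∈ cell h z, ‖x - gridPt h z‖ ≤ 4 * h := fun x hx =>
    norm_le_of_coord_le hh.le fun k => abs_le.2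
      ⟨by simp only [PiLp.sub_apply]; linarith [(hx k).1],
        by simp only [PiLp.sub_apply]; linarith [(hx k).2]⟩
  have hint : IntegrableOn φ (cell h z) :=
    (hφ.continuousOn.integrableOn_compact (isCompact_closedBall (gridPt h z) (4 * h))).mono_set
      fun x hx => by simpa [dist_eq_norm] using hcell x hx
  have e : (∫ x in cell h z, φ x) - h ^ 3 * φ (gridPt h z)
      = ∫ x in cell h z, (φ x - φ (gridPt h z)) := by
    rw [integral_sub hint (integrableOn_const (cell_ne_top hh z)), setIntegral_const,
      volume_real_cell hh, smul_eq_mul]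
  rw [e, ← Real.norm_eq_abs]
  refine (norm_setIntegral_le_of_norm_le_const (cell_ne_top hh z).lt_top fun x hx => by
    rw [Real.norm_eq_abs]
    exact hosc x (hcell x hx)).trans (le_of_eq ?_)
  rw [volume_real_cell hh, mul_comm]

theorem card_grid_le {Ω : Set E3} (hΩ : volume Ω ≠ ⊤) {h : ℝ} (hh : 0 < h)
    (hG : (grid Ω h).Finite) : h ^ 3 * (hG.toFinset.card : ℝ) ≤ (volume : Measure E3).real Ω := by
  classical
  have h1 := setIntegral_comp_cellIdx hh hG
    (F := fun z => if z ∈ grid Ω h then (1 : ℝ) else 0) fun z hz => if_neg hz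
  rw [tsum_eq_sum (s := hG.toFinset) fun z hz => if_neg (by simpa using hz)] at h1
  have h2 : ∑ z ∈ hG.toFinset, (if z ∈ grid Ω h then (1 : ℝ) else 0) = hG.toFinset.card := by
    rw [Finset.sum_congr rfl fun z hz => if_pos (by simpa using hz)]
    simp
  rw [h2] at h1
  rw [← h1]
  have : IsFiniteMeasure (volume.restrict Ω) := ⟨by simpa using hΩ.lt_top⟩
  calc ∫ x in Ω, (if cellIdx h x ∈ grid Ω h then (1 : ℝ) else 0)
      ≤ ∫ x in Ω, (1 : ℝ) :=
        integral_mono_of_nonneg (Eventually.of_forall fun x => by dsimp only; split_ifs <;> simp)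
          (integrable_const _) (Eventually.of_forall fun x => by dsimp only; split_ifs <;> simp)
    _ = _ := by simp

/-- Both pairings are sums of grid values times local integrals of `φ`, by a kernel or over a cell,
and these integrals differ by little. Vanishing of the smoothed field outside `Ω` allows whole-space
integrals, so that no kernel is cut off at the boundary. -/
theorem smear_sub_gridL2_le {Ω : Set E3} (hΩ : Bornology.IsBounded Ω) {Θ : Fin 3 → E3 → ℝ}
    (hΘ : ∀ i, IsKernel (Θ i)) {φ : E3 → E3} (hφ : Continuous φ) (hφc : HasCompactSupport φ)
    {ε : ℝ} (hε : 0 < ε) :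
    ∃ δ > 0, ∀ h, 0 < h → h < δ → ∀ a : Idx → E3, (∀ z, z ∉ grid Ω h → a z = 0) →
      (∀ x, x ∉ Ω → smear h Θ a x = 0) → ∀ F ψ : L2On E3 Ω,
      F =ᵐ[volume.restrict Ω] smear h Θ a → ψ =ᵐ[volume.restrict Ω] φ →
      |inner ℝ ψ (F - gridL2 Ω h a)| ≤ ε * (1 + h ^ 3 * ∑' z, ‖a z‖ ^ 2) := by
  have hΩv : volume Ω ≠ ⊤ := hΩ.measure_lt_top.ne
  set B := ∑ i, ∫ y, |Θ i y|
  have hB : ∀ i, ∫ y, |Θ i y| ≤ B := fun i =>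
    Finset.single_le_sum (f := fun i => ∫ y, |Θ i y|)
      (fun i _ => integral_nonneg fun y => abs_nonneg _) (Finset.mem_univ i)
  have hB0 : 0 ≤ B := Finset.sum_nonneg fun i _ => integral_nonneg fun y => abs_nonneg _
  set V := (volume : Measure E3).real Ω
  have hV : 0 ≤ V := measureReal_nonneg
  -- The factors account for three components, for the kernel mass `B` plus the cell mass one, and
  -- for the volume of `Ω`.
  set ε' := ε / (3 * (B + 1) * (V + 1)) with hε'def
  have hε' : 0 < ε' := by positivity
  obtain ⟨δ, hδ, hunif⟩ := Metric.uniformContinuous_iff.1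
    (hφc.uniformContinuous_of_continuous hφ) ε' hε'
  refine ⟨δ / 4, by positivity, fun h hh hhδ a ha hoff F ψ hF hψ => ?_⟩
  have hG := finite_grid hΩ hh
  have hS : ∀ z ∉ hG.toFinset, a z = 0 := fun z hz => ha z (by simpa using hz)
  have hosc : ∀ i (g x : E3), ‖x - g‖ ≤ 4 * h → |φ x i - φ g i| ≤ ε' := fun i g x hx => by
    have h1 := hunif (a := x) (b := g) (by rw [dist_eq_norm]; linarith)
    rw [dist_eq_norm] at h1
    exact (PiLp.norm_apply_le (φ x - φ g) i).trans h1.le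
  have hφi : ∀ i, Continuous fun x => φ x i := fun i => by fun_prop
  have hφci : ∀ i, HasCompactSupport fun x => φ x i := fun i =>
    hφc.comp_left (g := fun y : E3 => y i) rfl
  have eF : inner ℝ ψ F = ∑ z ∈ hG.toFinset, ∑ i,
      a z i * ∫ x, Θ i (h⁻¹ • (x - gridPt h z)) * φ x i := by
    have h1 : inner ℝ ψ F = ∫ x in Ω, ∑ z ∈ hG.toFinset, ∑ i,
        a z i * (Θ i (h⁻¹ • (x - gridPt h z)) * φ x i) := by
      rw [L2.inner_def]
      refine integral_congr_ae ?_
      filter_upwards [hF, hψ] with x hx hx'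
      rw [hx, hx', PiLp.inner_apply, Finset.sum_comm]
      refine Finset.sum_congr rfl fun i _ => ?_
      rw [smear_apply_eq_sum hS, real_inner_comm]
      simp only [RCLike.inner_apply, conj_trivial]
      rw [Finset.mul_sum]
      exact Finset.sum_congr rfl fun z _ => by ring
    have h2 : ∀ x, x ∉ Ω → ∑ z ∈ hG.toFinset, ∑ i,
        a z i * (Θ i (h⁻¹ • (x - gridPt h z)) * φ x i) = 0 := fun x hx => by
      rw [Finset.sum_comm]
      refine Finset.sum_eq_zero fun i _ => ?_
      have h3 : smear h Θ a x i * φ x i = 0 := by rw [hoff x hx]; simp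
      rw [smear_apply_eq_sum hS, Finset.sum_mul] at h3
      rw [← h3]
      exact Finset.sum_congr rfl fun z _ => by ring
    have h3 : ∀ z i, Integrable fun x => a z i * (Θ i (h⁻¹ • (x - gridPt h z)) * φ x i) :=
      fun z i => by
        have hc : Continuous fun x => Θ i (h⁻¹ • (x - gridPt h z)) :=
          (hΘ i).contDiff.continuous.comp (by fun_prop)
        exact ((hc.mul (hφi i)).integrable_of_hasCompactSupport (hφci i).mul_left).const_mul _
    rw [h1, setIntegral_eq_integral_of_forall_compl_eq_zero h2,
      integral_finsetSum _ fun z _ => integrable_finsetSum _ fun i _ => h3 z i]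
    refine Finset.sum_congr rfl fun z _ => ?_
    rw [integral_finsetSum _ fun i _ => h3 z i]
    exact Finset.sum_congr rfl fun i _ => integral_const_mul _ _
  have eG : inner ℝ ψ (gridL2 Ω h a) = ∑ z ∈ hG.toFinset, ∑ i,
      a z i * ∫ x in cell h z, φ x i := by
    rw [inner_gridL2 hΩv hh hG ha, tsum_eq_sum (s := hG.toFinset) fun z hz => by simp [hS z hz]]
    refine Finset.sum_congr rfl fun z hz => ?_
    have hzG : z ∈ grid Ω h := by simpa using hz
    have hcell := cell_subset_of_mem_grid hh hzG
    have h1 : ∫ y in cell h z, ψ y = ∫ y in cell h z, φ y :=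
      integral_congr_ae (ae_mono (Measure.restrict_mono_set _ hcell) hψ)
    have hint : IntegrableOn φ (cell h z) :=
      (hφ.integrable_of_hasCompactSupport hφc).integrableOn
    rw [h1, PiLp.inner_apply]
    refine Finset.sum_congr rfl fun i _ => ?_
    have h2 := (EuclideanSpace.proj i : E3 →L[ℝ] ℝ).integral_comp_comm hint
    have h3 : (∫ y in cell h z, φ y) i = ∫ y in cell h z, φ y i := h2.symm
    rw [h3]
    simp only [RCLike.inner_apply, conj_trivial]
  have hterm : ∀ z i, |a z i * (∫ x, Θ i (h⁻¹ • (x - gridPt h z)) * φ x i)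
      - a z i * ∫ x in cell h z, φ x i| ≤ ‖a z‖ * (h ^ 3 * (ε' * (B + 1))) := fun z i => by
    have h1 := integral_kernel_mul (hΘ i) (hφi i) hh (gridPt h z) (hosc i _)
    have h2 := integral_cell_sub (hφi i) hh z (hosc i _)
    have h3 : h ^ 3 * (ε' * ∫ y, |Θ i y|) ≤ h ^ 3 * (ε' * B) := by gcongr; exact hB i
    rw [← mul_sub, abs_mul]
    refine mul_le_mul (PiLp.norm_apply_le (a z) i) ?_ (abs_nonneg _) (norm_nonneg _)
    rw [abs_le] at h1 h2 ⊢
    constructor <;> linarith [h1.1, h1.2, h2.1, h2.2]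
  rw [inner_sub_right, eF, eG, ← Finset.sum_sub_distrib]
  simp_rw [← Finset.sum_sub_distrib]
  -- The discrete `L¹` norm is reduced to the `L²` norm by `t ≤ 1 + t ^ 2`, the ones adding up to at
  -- most the volume.
  have hsumA : h ^ 3 * ∑ z ∈ hG.toFinset, ‖a z‖ ≤ V + h ^ 3 * ∑' z, ‖a z‖ ^ 2 := by
    have h1 : ∑ z ∈ hG.toFinset, ‖a z‖ ≤ ∑ z ∈ hG.toFinset, (1 + ‖a z‖ ^ 2) :=
      Finset.sum_le_sum fun z _ => by nlinarith [sq_nonneg (‖a z‖ - 1), norm_nonneg (a z)]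
    rw [Finset.sum_add_distrib, Finset.sum_const, nsmul_eq_mul, mul_one] at h1
    rw [tsum_eq_sum (s := hG.toFinset) fun z hz => by simp [hS z hz]]
    have h2 := mul_le_mul_of_nonneg_left h1 (by positivity : 0 ≤ h ^ 3)
    have h3 := card_grid_le hΩv hh hG
    linarith
  have hA0 : 0 ≤ h ^ 3 * ∑' z, ‖a z‖ ^ 2 :=
    mul_nonneg (by positivity) (tsum_nonneg fun z => sq_nonneg _)
  calc |∑ z ∈ hG.toFinset, ∑ i, (a z i * (∫ x, Θ i (h⁻¹ • (x - gridPt h z)) * φ x i)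
      - a z i * ∫ x in cell h z, φ x i)|
      ≤ ∑ z ∈ hG.toFinset, ∑ _i : Fin 3, ‖a z‖ * (h ^ 3 * (ε' * (B + 1))) :=
        (Finset.abs_sum_le_sum_abs _ _).trans (Finset.sum_le_sum fun z _ =>
          (Finset.abs_sum_le_sum_abs _ _).trans (Finset.sum_le_sum fun i _ => hterm z i))
    _ = 3 * ε' * (B + 1) * (h ^ 3 * ∑ z ∈ hG.toFinset, ‖a z‖) := by
        simp only [Finset.sum_const, Finset.card_univ, Fintype.card_fin, nsmul_eq_mul]
        rw [← Finset.mul_sum, ← Finset.sum_mul]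
        push_cast
        ring
    _ ≤ 3 * ε' * (B + 1) * (V + h ^ 3 * ∑' z, ‖a z‖ ^ 2) := by gcongr
    _ ≤ 3 * ε' * (B + 1) * ((V + 1) * (1 + h ^ 3 * ∑' z, ‖a z‖ ^ 2)) := by
        gcongr
        nlinarith
    _ = ε * (1 + h ^ 3 * ∑' z, ‖a z‖ ^ 2) := by
        rw [hε'def]
        field_simp

/-! ### Weak convergence in Hilbert spaces -/

section Hilbert

variable {H : Type} [NormedAddCommGroup H] [InnerProductSpace ℝ H]

/-- Bounded sequences in a Hilbert space have weakly convergent subsequences. -/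
theorem exists_weakly_convergent_subseq [CompleteSpace H] {x : ℕ → H} {C : ℝ}
    (hx : ∀ n, ‖x n‖ ≤ C) :
    ∃ s : ℕ → ℕ, StrictMono s ∧ ∃ y, ∀ z,
      Tendsto (fun n => inner ℝ (x (s n)) z) atTop (𝓝 (inner ℝ y z)) := by
  -- On this separable subspace sequential Banach–Alaoglu applies; arbitrary test vectors are later
  -- projected onto it.
  let K := (Submodule.span ℝ (range x)).topologicalClosure
  have hK : TopologicalSpace.SeparableSpace K := by
    have : TopologicalSpace.IsSeparable (K : Set H) :=
      ((countable_range x).isSeparable.span (R := ℝ)).closure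
    exact this.separableSpace
  have : CompleteSpace K := (Submodule.isClosed_topologicalClosure _).completeSpace_coe
  let x' : ℕ → K := fun n =>
    ⟨x n, Submodule.le_topologicalClosure _ (Submodule.subset_span (mem_range_self n))⟩
  let L : ℕ → WeakDual ℝ K := fun n => StrongDual.toWeakDual (InnerProductSpace.toDual ℝ K (x' n))
  obtain ⟨ℓ, -, s, hs, hlim⟩ := WeakDual.isSeqCompact_closedBall ℝ K 0 C (x := L) fun n => by
    simp only [L, mem_preimage, mem_closedBall_zero_iff]
    exact ((InnerProductSpace.toDual ℝ K).norm_map (x' n)).trans_le (hx n)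
  refine ⟨s, hs, ((InnerProductSpace.toDual ℝ K).symm (WeakDual.toStrongDual ℓ) : K), fun z => ?_⟩
  let z' : K := K.orthogonalProjectionOnto z
  have h1 : ∀ k : K, inner ℝ (k : H) z = inner ℝ k z' := fun k =>
    (Submodule.inner_orthogonalProjectionOnto_eq_of_mem_left k z).symm
  have h2 := ((WeakDual.eval_continuous z').tendsto ℓ).comp hlim
  rw [h1, InnerProductSpace.toDual_symm_apply]
  refine h2.congr fun n => ?_
  exact (h1 (x' (s n))).symm

/-- For a bounded sequence, the vectors against which it is weakly null form a closed set. -/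
theorem isClosed_weakly_null {F : ℕ → H} {C : ℝ} (hF : ∀ n, ‖F n‖ ≤ C) :
    IsClosed {ψ : H | Tendsto (fun n => inner ℝ ψ (F n)) atTop (𝓝 0)} := by
  refine isClosed_of_closure_subset fun ψ hψ => ?_
  rw [mem_ofPred_eq, Metric.tendsto_atTop]
  intro ε hε
  have hC : 0 ≤ C := (norm_nonneg _).trans (hF 0)
  obtain ⟨χ, hχ, hd⟩ := Metric.mem_closure_iff.1 hψ (ε / (2 * (C + 1))) (by positivity)
  obtain ⟨N, hN⟩ := Metric.tendsto_atTop.1 hχ (ε / 2) (by positivity)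
  refine ⟨N, fun n hn => ?_⟩
  have h1 := hN n hn
  rw [Real.dist_eq, sub_zero] at h1 ⊢
  have h2 : |inner ℝ (ψ - χ) (F n)| ≤ ε / (2 * (C + 1)) * C :=
    (abs_real_inner_le_norm _ _).trans
      (mul_le_mul (by rw [← dist_eq_norm]; exact hd.le) (hF n) (norm_nonneg _) (by positivity))
  have h3 : ε / (2 * (C + 1)) * C ≤ ε / 2 := by
    rw [div_mul_eq_mul_div, div_le_iff₀ (by positivity)]
    nlinarith
  rw [inner_sub_left] at h2
  have h4 := abs_add_le (inner ℝ ψ (F n) - inner ℝ χ (F n)) (inner ℝ χ (F n))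
  rw [sub_add_cancel] at h4
  linarith

/-- A bounded sequence in `L²(0,T;X)` is weakly null if it is so against indicator functions with
values in a dense set. -/
theorem weakly_null_of_dense [CompleteSpace H] {T : ℝ} {F : ℕ → L2Time H T} {C : ℝ}
    (hF : ∀ n, ‖F n‖ ≤ C) {D : Set H} (hD : Dense D)
    (h : ∀ c ∈ D, ∀ (A : Set ℝ) (hA : MeasurableSet A)
      (hA' : (volume : Measure ℝ).restrict (Icc 0 T) A ≠ ⊤),
      Tendsto (fun n => inner ℝ (indicatorConstLp 2 hA hA' c : L2Time H T) (F n)) atTop (𝓝 0))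
    (ψ : L2Time H T) : Tendsto (fun n => inner ℝ ψ (F n)) atTop (𝓝 0) := by
  induction ψ using Lp.induction (by norm_num : (2 : ℝ≥0∞) ≠ ⊤) with
  | @indicatorConst c A hA hA' =>
    have e : ∀ c n, inner ℝ (indicatorConstLp 2 hA hA'.ne c : L2Time H T) (F n)
        = inner ℝ c (∫ t in A, F n t ∂((volume : Measure ℝ).restrict (Icc 0 T))) := fun c n =>
      L2.inner_indicatorConstLp_eq_inner_setIntegral ℝ hA hA'.ne c (F n)
    set m := ((volume : Measure ℝ).restrict (Icc 0 T)).real A ^ (1 / (2 : ℝ≥0∞).toReal)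
    have hm : 0 ≤ m := Real.rpow_nonneg measureReal_nonneg _
    -- Testing with the indicator times the integral itself gives the bound. For fixed `A` the claim
    -- is then about a bounded sequence in `H`, where density of `D` suffices.
    have hbound : ∀ n, ‖∫ t in A, F n t ∂((volume : Measure ℝ).restrict (Icc 0 T))‖ ≤ m * C := by
      intro n
      set y := ∫ t in A, F n t ∂((volume : Measure ℝ).restrict (Icc 0 T))
      have h1 := real_inner_le_norm (indicatorConstLp 2 hA hA'.ne y : L2Time H T) (F n)
      rw [e, real_inner_self_eq_norm_sq, norm_indicatorConstLp (by norm_num) (by norm_num)] at h1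
      have h2 : ‖y‖ * m * ‖F n‖ ≤ ‖y‖ * m * C :=
        mul_le_mul_of_nonneg_left (hF n) (mul_nonneg (norm_nonneg _) hm)
      have hC : 0 ≤ C := (norm_nonneg _).trans (hF n)
      by_contra hc
      push Not at hc
      nlinarith [mul_nonneg hm hC]
    have h1 : closure D ⊆ {c | Tendsto (fun n => inner ℝ c
        (∫ t in A, F n t ∂((volume : Measure ℝ).restrict (Icc 0 T)))) atTop (𝓝 0)} :=
      closure_minimal (fun c hc => (h c hc A hA hA'.ne).congr fun n => e c n)
        (isClosed_weakly_null hbound)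
    exact (h1 (hD c)).congr fun n => (e c n).symm
  | add hf hg _ h1 h2 =>
    have := h1.add h2
    rw [add_zero] at this
    exact this.congr fun n => (inner_add_left _ _ _).symm
  | isClosed => exact isClosed_weakly_null hF

end Hilbert

/-- Continuous functions with compact support are dense in `L²(Ω)³`. -/
theorem dense_continuous_compactSupport {Ω : Set E3} (hΩ : Bornology.IsBounded Ω) :
    Dense {c : L2On E3 Ω | ∃ φ : E3 → E3, Continuous φ ∧ HasCompactSupport φ ∧
      c =ᵐ[volume.restrict Ω] φ} := by
  have : (volume.restrict Ω).Regular :=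
    Measure.Regular.restrict_of_measure_ne_top hΩ.measure_lt_top.ne
  intro c
  rw [EMetric.mem_closure_iff]
  intro ε hε
  obtain ⟨ε', hε', hlt⟩ := exists_between hε
  obtain ⟨φ, h1, h2, h3, h4⟩ := (Lp.memLp c).exists_hasCompactSupport_eLpNorm_sub_le
    (by norm_num) hε'.ne'
  refine ⟨h4.toLp, ⟨φ, h3, h1, h4.coeFn_toLp⟩, ?_⟩
  rw [Lp.edist_def, eLpNorm_congr_ae ((EventuallyEq.refl _ _).sub h4.coeFn_toLp)]
  exact h2.trans_lt hlt

/-! ### Functions that are piecewise constant in time -/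

theorem timeIdx_eq {τ : ℝ} (hτ : 0 < τ) {n : ℕ} {t : ℝ} (ht : t ∈ Ioc (τ * n) (τ * (n + 1))) :
    timeIdx τ t = n + 1 := by
  have h1 : ⌈t / τ⌉₊ = n + 1 := by
    rw [Nat.ceil_eq_iff (by omega)]
    constructor
    · rw [lt_div_iff₀ hτ]
      push_cast
      simpa [mul_comm] using ht.1
    · rw [div_le_iff₀ hτ]
      push_cast
      linarith [ht.2]
  rw [timeIdx, h1]
  omega

theorem exists_timeIdx_eq {τ T : ℝ} (hτ : 0 < τ) {N : ℕ} (hN : T < τ * N) {t : ℝ}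
    (ht : t ∈ Icc 0 T) : ∃ n < N, timeIdx τ t = n + 1 := by
  have h1 : ⌈t / τ⌉₊ ≤ N := by
    rw [Nat.ceil_le, div_le_iff₀ hτ]
    linarith [ht.2]
  have h2 : 0 < N := by
    rcases Nat.eq_zero_or_pos N with h | h
    · subst h
      simp at hN
      linarith [ht.1, ht.2]
    · exact h
  refine ⟨timeIdx τ t - 1, ?_, ?_⟩ <;> rw [timeIdx] <;> omega

theorem measurable_timeIdx (τ : ℝ) : Measurable (timeIdx τ) :=
  measurable_const.max (Nat.measurable_ceil.comp (measurable_id.div_const τ))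

theorem memLp_comp_timeIdx {X : Type} [NormedAddCommGroup X] {τ T : ℝ} (hτ : 0 < τ) (a : ℕ → X) :
    MemLp (fun t => a (timeIdx τ t)) 2 ((volume : Measure ℝ).restrict (Icc 0 T)) := by
  obtain ⟨N, hN⟩ := exists_nat_gt (T / τ)
  rw [div_lt_iff₀ hτ, mul_comm] at hN
  refine MemLp.of_bound (C := ∑ n ∈ Finset.range N, ‖a (n + 1)‖) ?_ ?_
  · exact (StronglyMeasurable.comp_measurable (StronglyMeasurable.of_discrete (f := a))
      (measurable_timeIdx τ)).aestronglyMeasurable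
  · rw [ae_restrict_iff' measurableSet_Icc]
    refine Eventually.of_forall fun t ht => ?_
    obtain ⟨n, hn, e⟩ := exists_timeIdx_eq hτ hN ht
    rw [e]
    exact Finset.single_le_sum (f := fun n => ‖a (n + 1)‖) (fun n _ => norm_nonneg _)
      (Finset.mem_range.2 hn)

open Classical in
/-- The element of `L²(0,T;X)` with the value `a (n + 1)` on `(n τ, (n + 1) τ]`. -/
def stepTime {X : Type} [NormedAddCommGroup X] (τ T : ℝ) (a : ℕ → X) : L2Time X T :=
  if hm : MemLp (fun t => a (timeIdx τ t)) 2 ((volume : Measure ℝ).restrict (Icc 0 T))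
  then hm.toLp else 0

theorem coeFn_stepTime {X : Type} [NormedAddCommGroup X] {τ : ℝ} (hτ : 0 < τ) (T : ℝ) (a : ℕ → X) :
    stepTime τ T a =ᵐ[(volume : Measure ℝ).restrict (Icc 0 T)] fun t => a (timeIdx τ t) := by
  rw [stepTime, dif_pos (memLp_comp_timeIdx hτ a)]
  exact MemLp.coeFn_toLp _

theorem integrableOn_comp_timeIdx {τ T : ℝ} (hτ : 0 < τ) (g : ℕ → ℝ) :
    IntegrableOn (fun t => g (timeIdx τ t)) (Icc 0 T) :=
  (memLp_comp_timeIdx hτ g).integrable (by norm_num)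

/-- Only an inequality, since the last time interval extends beyond `T`. -/
theorem integral_comp_timeIdx_le {τ T : ℝ} (hτ : 0 < τ) {N : ℕ} (hN : T < τ * N) {g : ℕ → ℝ}
    (hg : ∀ n, 0 ≤ g n) :
    ∫ t in Icc 0 T, g (timeIdx τ t) ≤ ∑ n ∈ Finset.range N, τ * g (n + 1) := by
  have hi : ∀ S, IntegrableOn (fun t => g (timeIdx τ t)) (Icc 0 S) := fun S =>
    integrableOn_comp_timeIdx hτ g
  have h1 : ∫ t in Icc 0 T, g (timeIdx τ t) ≤ ∫ t in Icc 0 (τ * N), g (timeIdx τ t) :=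
    setIntegral_mono_set (hi _) (Eventually.of_forall fun t => hg _)
      (Icc_subset_Icc_right hN.le).eventuallyLE
  have h2 : ∀ k : ℕ, ∫ t in (τ * k)..(τ * (k + 1)), g (timeIdx τ t) = τ * g (k + 1) := by
    intro k
    rw [intervalIntegral.integral_of_le (by nlinarith),
      setIntegral_congr_fun (g := fun _ => g (k + 1)) measurableSet_Ioc fun t ht => by
        simp only [timeIdx_eq hτ ht], setIntegral_const, smul_eq_mul]
    congr 1
    rw [Measure.real, Real.volume_Ioc, ENNReal.toReal_ofReal] <;> nlinarith
  have h3 := intervalIntegral.sum_integral_adjacent_intervals (f := fun t => g (timeIdx τ t))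
    (μ := volume) (a := fun n : ℕ => τ * n) (n := N) fun k _ => by
      rw [intervalIntegrable_iff_integrableOn_Icc_of_le (by push_cast; nlinarith)]
      exact (hi _).mono_set (Icc_subset_Icc_left (by positivity))
  push_cast at h3
  simp_rw [h2] at h3
  rw [mul_zero, intervalIntegral.integral_of_le (by positivity), ← integral_Icc_eq_integral_Ioc]
    at h3
  linarith

theorem norm_stepTime_sq_le {X : Type} [NormedAddCommGroup X] [InnerProductSpace ℝ X] {τ T : ℝ}
    (hτ : 0 < τ) {N : ℕ} (hN : T < τ * N) (a : ℕ → X) :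
    ‖stepTime τ T a‖ ^ 2 ≤ ∑ n ∈ Finset.range N, τ * ‖a (n + 1)‖ ^ 2 := by
  refine le_trans (le_of_eq ?_) (integral_comp_timeIdx_le hτ hN (g := fun n => ‖a n‖ ^ 2)
    fun n => sq_nonneg _)
  rw [← real_inner_self_eq_norm_sq, L2.inner_def]
  exact integral_congr_ae ((coeFn_stepTime hτ T a).mono fun x hx => by
    simp only [hx, real_inner_self_eq_norm_sq])

theorem stepTime_sub {X : Type} [NormedAddCommGroup X] {τ : ℝ} (hτ : 0 < τ) (T : ℝ) (a b : ℕ → X) :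
    stepTime τ T a - stepTime τ T b = stepTime τ T (fun n => a n - b n) := by
  refine Lp.ext ?_
  filter_upwards [Lp.coeFn_sub (stepTime τ T a) (stepTime τ T b), coeFn_stepTime hτ T a,
    coeFn_stepTime hτ T b, coeFn_stepTime hτ T fun n => a n - b n] with t h1 h2 h3 h4
  rw [h1, h4, Pi.sub_apply, h2, h3]

theorem compLp_stepTime {X Y : Type} [NormedAddCommGroup X] [NormedSpace ℝ X]
    [NormedAddCommGroup Y] [NormedSpace ℝ Y] (L : X →L[ℝ] Y) {τ : ℝ} (hτ : 0 < τ) (T : ℝ)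
    (a : ℕ → X) : L.compLp (stepTime τ T a) = stepTime τ T fun n => L (a n) := by
  refine Lp.ext ?_
  filter_upwards [L.coeFn_compLp (stepTime τ T a), coeFn_stepTime hτ T a,
    coeFn_stepTime hτ T fun n => L (a n)] with t h1 h2 h3
  rw [h1, h2, h3]

theorem abs_inner_indicator_stepTime_le {X : Type} [NormedAddCommGroup X] [InnerProductSpace ℝ X]
    {τ T : ℝ} (hτ : 0 < τ) {N : ℕ} (hN : T < τ * N) (a : ℕ → X) {A : Set ℝ}
    (hA : MeasurableSet A) (hA' : (volume : Measure ℝ).restrict (Icc 0 T) A ≠ ⊤) (c : X) :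
    |inner ℝ (indicatorConstLp 2 hA hA' c : L2Time X T) (stepTime τ T a)|
      ≤ ∑ n ∈ Finset.range N, τ * |inner ℝ c (a (n + 1))| := by
  have hint : IntegrableOn (fun t => |inner ℝ c (a (timeIdx τ t))|) (Icc 0 T) :=
    integrableOn_comp_timeIdx hτ fun n => |inner ℝ c (a n)|
  rw [L2.inner_indicatorConstLp_eq_setIntegral_inner, integral_congr_ae (ae_restrict_of_ae
    ((coeFn_stepTime hτ T a).mono fun t ht => by rw [ht]))]
  refine abs_integral_le_integral_abs.trans ?_
  refine le_trans ?_ (integral_comp_timeIdx_le hτ hN (g := fun n => |inner ℝ c (a n)|)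
    fun n => abs_nonneg _)
  exact setIntegral_le_integral hint (Eventually.of_forall fun t => abs_nonneg _)

/-! ### Passage to the limit -/

open Classical in
/-- The grid function that agrees with `a` on `G` and has the value `c` elsewhere. -/
def extendGrid {E : Type} (G : Set Idx) (c : E) (a : Idx → E) (z : Idx) : E :=
  if z ∈ G then a z else c

theorem extendGrid_eq_self {E : Type} [Zero E] {G : Set Idx} {a : Idx → E}
    (ha : ∀ z, z ∉ G → a z = 0) : extendGrid G 0 a = a := by
  ext z
  rw [extendGrid]
  split_ifs with hz
  · rfl
  · exact (ha z hz).symm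

theorem exists_bound_extendGrid {E : Type} [NormedAddCommGroup E] {G : Set Idx} (hG : G.Finite)
    (c : E) (a : Idx → E) : ∃ C, ∀ z, ‖extendGrid G c a z‖ ≤ C := by
  obtain ⟨C, hC⟩ := (hG.image fun z => ‖a z‖).bddAbove
  refine ⟨max C ‖c‖, fun z => ?_⟩
  rw [extendGrid]
  split_ifs with hz
  · exact (hC ⟨z, hz, rfl⟩).trans (le_max_left _ _)
  · exact le_max_right _ _

/-- The element of `L²(0,T;L²(Ω;E))` defined by a step function. -/
def stepL2 {E : Type} [NormedAddCommGroup E] (Ω : Set E3) (c : E) (h τ T : ℝ) (a : ℕ → Idx → E) :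
    L2Time (L2On E Ω) T :=
  stepTime τ T fun n => gridL2 Ω h (extendGrid (grid Ω h) c (a n))

theorem coeFn_stepL2 {E : Type} [NormedAddCommGroup E] {Ω : Set E3} (hΩ : Bornology.IsBounded Ω)
    (c : E) {h τ : ℝ} (hh : 0 < h) (hτ : 0 < τ) (T : ℝ) (a : ℕ → Idx → E) :
    ∀ᵐ t ∂((volume : Measure ℝ).restrict (Icc 0 T)),
      (stepL2 Ω c h τ T a t : E3 → E) =ᵐ[volume.restrict Ω] stepFun (grid Ω h) c h τ a t := by
  filter_upwards [coeFn_stepTime hτ T fun n => gridL2 Ω h (extendGrid (grid Ω h) c (a n))]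
    with t ht
  obtain ⟨C, hC⟩ := exists_bound_extendGrid (finite_grid hΩ hh) c (a (timeIdx τ t))
  rw [stepL2, ht]
  exact coeFn_gridL2 hΩ.measure_lt_top.ne h hC

theorem norm_gridL2_sq_le_of_bound {E : Type} [NormedAddCommGroup E] [InnerProductSpace ℝ E]
    {Ω : Set E3} (hΩ : volume Ω ≠ ⊤) (h : ℝ) {a : Idx → E} {C : ℝ} (ha : ∀ z, ‖a z‖ ≤ C) :
    ‖gridL2 Ω h a‖ ^ 2 ≤ C ^ 2 * (volume : Measure E3).real Ω := by
  have : IsFiniteMeasure (volume.restrict Ω) := ⟨by simpa using hΩ.lt_top⟩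
  rw [norm_L2On_sq (coeFn_gridL2 hΩ h ha)]
  calc ∫ x in Ω, ‖a (cellIdx h x)‖ ^ 2 ≤ ∫ _ in Ω, C ^ 2 :=
        integral_mono_of_nonneg (Eventually.of_forall fun x => sq_nonneg _) (integrable_const _)
          (Eventually.of_forall fun x => pow_le_pow_left₀ (norm_nonneg _) (ha _) 2)
    _ = _ := by
        rw [setIntegral_const, smul_eq_mul, mul_comm]

theorem norm_le_of_sq_le {x C : ℝ} (hC : 0 ≤ C) (h : x ^ 2 ≤ C) : x ≤ C + 1 := by
  nlinarith [sq_nonneg (x - 1)]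

set_option maxHeartbeats 2000000 in
/-- Smoothed and unsmoothed step functions have the same weak limits. -/
theorem weakly_null_smear_sub {Ω : Set E3} (hΩ : Bornology.IsBounded Ω) {T : ℝ} {h τ : ℕ → ℝ}
    {N : ℕ → ℕ} (hh : ∀ m, 0 < h m) (hlim : Tendsto h atTop (𝓝 0)) (hτ : ∀ m, 0 < τ m)
    (hN : ∀ m, T < τ m * N m) (hN' : ∀ m, τ m * N m ≤ T + 1) {Θ : Fin 3 → E3 → ℝ}
    (hΘ : ∀ i, IsKernel (Θ i)) {a : ℕ → ℕ → Idx → E3} {F : ℕ → ℕ → L2On E3 Ω}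
    (ha : ∀ m, ∀ n < N m, ∀ z, z ∉ grid Ω (h m) → a m (n + 1) z = 0)
    (hoff : ∀ m, ∀ n < N m, ∀ x, x ∉ Ω → smear (h m) Θ (a m (n + 1)) x = 0)
    (hF : ∀ m, ∀ n < N m, F m (n + 1) =ᵐ[volume.restrict Ω] smear (h m) Θ (a m (n + 1)))
    {C : ℝ} (haC : ∀ m, ∑ n ∈ Finset.range (N m),
      τ m * (h m ^ 3 * ∑' z, ‖a m (n + 1) z‖ ^ 2) ≤ C)
    (hFC : ∀ m, ∑ n ∈ Finset.range (N m), τ m * ‖F m (n + 1)‖ ^ 2 ≤ C)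
    (ψ : L2Time (L2On E3 Ω) T) :
    Tendsto (fun m => inner ℝ ψ (stepTime (τ m) T (F m) - stepL2 Ω 0 (h m) (τ m) T (a m)))
      atTop (𝓝 0) := by
  have hΩv : volume Ω ≠ ⊤ := hΩ.measure_lt_top.ne
  have hG := fun m => finite_grid hΩ (hh m)
  have hC0 : 0 ≤ C := (Finset.sum_nonneg fun n _ => mul_nonneg (hτ 0).le (sq_nonneg _)).trans
    (hFC 0)
  have hT0 : ∀ m, 0 ≤ T + 1 := fun m => (mul_nonneg (hτ m).le (Nat.cast_nonneg _)).trans (hN' m)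
  have hb1 : ∀ m, ‖stepTime (τ m) T (F m)‖ ≤ C + 1 := fun m =>
    norm_le_of_sq_le hC0 ((norm_stepTime_sq_le (hτ m) (hN m) (F m)).trans (hFC m))
  have hb2 : ∀ m, ‖stepL2 Ω 0 (h m) (τ m) T (a m)‖ ≤ C + 1 := fun m => by
    refine norm_le_of_sq_le hC0 ((norm_stepTime_sq_le (hτ m) (hN m) _).trans
      (le_trans (le_of_eq ?_) (haC m)))
    refine Finset.sum_congr rfl fun n hn => ?_
    have h1 := ha m n (Finset.mem_range.1 hn)
    rw [extendGrid_eq_self h1, norm_gridL2_sq hΩv (hh m) (hG m) h1]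
  refine weakly_null_of_dense (C := (C + 1) + (C + 1))
    (fun m => (norm_sub_le _ _).trans (add_le_add (hb1 m) (hb2 m)))
    (dense_continuous_compactSupport hΩ) ?_ ψ
  rintro c ⟨φ, hφ, hφc, hcφ⟩ A hA hA'
  rw [Metric.tendsto_atTop]
  intro ε hε
  have hT1 := hT0 0
  -- Summing the spatial estimate over the time steps costs at most `T + 1` for the constant part
  -- and `C` for the quadratic part; the last `1` keeps the denominator positive.
  set ε' := ε / (2 * (T + 1 + C + 1)) with hε'def
  have hε' : 0 < ε' := by positivity
  obtain ⟨δ, hδ, hmain⟩ := smear_sub_gridL2_le hΩ hΘ hφ hφc hε'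
  obtain ⟨m₀, hm₀⟩ := eventually_atTop.1 (hlim.eventually (gt_mem_nhds hδ))
  refine ⟨m₀, fun m hm => ?_⟩
  rw [Real.dist_eq, sub_zero, stepL2, stepTime_sub (hτ m)]
  refine (abs_inner_indicator_stepTime_le (hτ m) (hN m) _ hA hA' c).trans_lt ?_
  have h1 : ∀ n ∈ Finset.range (N m),
      τ m * |inner ℝ c (F m (n + 1)
        - gridL2 Ω (h m) (extendGrid (grid Ω (h m)) 0 (a m (n + 1))))|
      ≤ ε' * τ m + ε' * (τ m * (h m ^ 3 * ∑' z, ‖a m (n + 1) z‖ ^ 2)) := fun n hn => by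
    have hn' := Finset.mem_range.1 hn
    have h2 := ha m n hn'
    rw [extendGrid_eq_self h2]
    have h3 := hmain (h m) (hh m) (hm₀ m hm) (a m (n + 1)) h2 (hoff m n hn') (F m (n + 1)) c
      (hF m n hn') hcφ
    have h4 := mul_le_mul_of_nonneg_left h3 (hτ m).le
    linarith
  refine (Finset.sum_le_sum h1).trans_lt ?_
  rw [Finset.sum_add_distrib, Finset.sum_const, Finset.card_range, nsmul_eq_mul,
    ← Finset.mul_sum]
  have h5 : (N m : ℝ) * (ε' * τ m) ≤ ε' * (T + 1) := by
    have := mul_le_mul_of_nonneg_left (hN' m) hε'.le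
    linarith
  have h6 := mul_le_mul_of_nonneg_left (haC m) hε'.le
  have h7 : ε' * (T + 1 + C + 1) = ε / 2 := by
    rw [hε'def]
    field_simp
  linarith

/-- Bounded linear maps preserve weak convergence. -/
theorem tendsto_inner_compLp {X Y : Type} [NormedAddCommGroup X] [InnerProductSpace ℝ X]
    [CompleteSpace X] [NormedAddCommGroup Y] [InnerProductSpace ℝ Y] [CompleteSpace Y] {T : ℝ}
    (L : X →L[ℝ] Y) {x : ℕ → L2Time X T} {y : L2Time X T}
    (hxy : ∀ z, Tendsto (fun n => inner ℝ (x n) z) atTop (𝓝 (inner ℝ y z))) (ψ : L2Time Y T) :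
    Tendsto (fun n => inner ℝ (L.compLp (x n)) ψ) atTop (𝓝 (inner ℝ (L.compLp y) ψ)) := by
  let A : L2Time X T →L[ℝ] L2Time Y T := L.compLpL 2 ((volume : Measure ℝ).restrict (Icc 0 T))
  have e : ∀ x, inner ℝ (L.compLp x) ψ = inner ℝ x (A.adjoint ψ) := fun x =>
    (ContinuousLinearMap.adjoint_inner_right A x ψ).symm
  simp_rw [e]
  exact hxy _

/-- A sequence that differs from the image of a weakly convergent one by a weakly null sequence
converges weakly. -/
theorem tendsto_inner_of_weakly_null {X Y : Type} [NormedAddCommGroup X] [InnerProductSpace ℝ X]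
    [CompleteSpace X] [NormedAddCommGroup Y] [InnerProductSpace ℝ Y] [CompleteSpace Y] {T : ℝ}
    (L : X →L[ℝ] Y) {τ : ℕ → ℝ} (hτ : ∀ l, 0 < τ l) {U : ℕ → ℕ → X} {v : L2Time X T}
    (hv : ∀ z, Tendsto (fun l => inner ℝ (stepTime (τ l) T (U l)) z) atTop (𝓝 (inner ℝ v z)))
    {y : ℕ → L2Time Y T}
    (hy : ∀ ψ, Tendsto (fun l => inner ℝ ψ (stepTime (τ l) T (fun n => L (U l n)) - y l))
      atTop (𝓝 0)) (ψ : L2Time Y T) :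
    Tendsto (fun l => inner ℝ (y l) ψ) atTop (𝓝 (inner ℝ (L.compLp v) ψ)) := by
  have h := (tendsto_inner_compLp L hv ψ).sub (hy ψ)
  rw [sub_zero] at h
  refine h.congr fun l => ?_
  rw [compLp_stepTime L (hτ l), real_inner_comm, inner_sub_right, sub_sub_cancel, real_inner_comm]

theorem jetComponent_sq_le {Ω : Set E3} (o : Option (Fin 3)) (U : H10sigma Ω) :
    ‖jetComponent Ω o U‖ ^ 2 ≤ ‖U‖ ^ 2 := by
  rw [norm_jet_sq U]
  have h2 : 0 ≤ ∑ j, ‖jetComponent Ω (some j) U‖ ^ 2 := Finset.sum_nonneg fun j _ => sq_nonneg _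
  rcases o with _ | j
  · linarith
  · have h3 := Finset.single_le_sum (f := fun j => ‖jetComponent Ω (some j) U‖ ^ 2)
      (fun j _ => sq_nonneg _) (Finset.mem_univ j)
    have h4 := sq_nonneg ‖jetComponent Ω none U‖
    linarith

theorem sum_norm_dPlus_le {Ω : Set E3} (hΩ : Bornology.IsBounded Ω) {h : ℝ} (hh : 0 < h)
    {a : Idx → E3} (ha : ∀ z, z ∉ grid Ω h → a z = 0) (j : Fin 3) :
    h ^ 3 * ∑' z, ‖dPlus h j a z‖ ^ 2 ≤ h ^ 3 * ∑' z, ∑ j, ‖dPlus h j a z‖ ^ 2 := by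
  have hfin := finite_support_of_grid (finite_grid hΩ hh) ha
  have hs : ∀ j, Summable fun z => ‖dPlus h j a z‖ ^ 2 := fun j =>
    summable_of_imp_field (finite_support_dPlus h j hfin) fun z hz => by simp [hz]
  exact mul_le_mul_of_nonneg_left ((hs j).tsum_le_tsum (fun z => Finset.single_le_sum
    (f := fun j => ‖dPlus h j a z‖ ^ 2) (fun j _ => sq_nonneg _)
    (Finset.mem_univ j)) (summable_sum fun j _ => hs j)) (pow_nonneg hh.le 3)

set_option maxHeartbeats 1000000 in
/-- Discrete solenoidal fields that are bounded in the discrete `L²(0,T;H¹)` norm converge weakly,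
together with their differences, along a subsequence. -/
theorem exists_velocity_limit {Ω : Set E3} (hΩ : Bornology.IsBounded Ω) {T : ℝ} {h τ : ℕ → ℝ}
    {N : ℕ → ℕ} (hh : ∀ m, 0 < h m) (hlim : Tendsto h atTop (𝓝 0)) (hτ : ∀ m, 0 < τ m)
    (hN : ∀ m, T < τ m * N m) (hN' : ∀ m, τ m * N m ≤ T + 1) {u : ℕ → ℕ → Idx → E3}
    (hsupp : ∀ m, ∀ n < N m, ∀ z, z ∉ grid Ω (h m) \ gridBoundary (grid Ω (h m)) →
      u m (n + 1) z = 0)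
    (hdiv : ∀ m, ∀ n < N m, ∀ z, dDiv (h m) (u m (n + 1)) z = 0) {C : ℝ} (hC0 : 0 ≤ C)
    (hvel : ∀ m, ∑ n ∈ Finset.range (N m), τ m * (h m ^ 3 * ∑' z, ‖u m (n + 1) z‖ ^ 2) ≤ C)
    (hgrad : ∀ m, ∑ n ∈ Finset.range (N m),
      τ m * (h m ^ 3 * ∑' z, ∑ j, ‖dPlus (h m) j (u m (n + 1)) z‖ ^ 2) ≤ C) :
    ∃ s : ℕ → ℕ, StrictMono s ∧ ∃ v : L2Time (H10sigma Ω) T,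
      (∀ ψ, Tendsto (fun l => inner ℝ (stepL2 Ω 0 (h (s l)) (τ (s l)) T (u (s l))) ψ) atTop
        (𝓝 (inner ℝ ((jetComponent Ω none).compLp v) ψ))) ∧
      ∀ i ψ, Tendsto (fun l => inner ℝ (stepL2 Ω 0 (h (s l)) (τ (s l)) T
        fun n => dPlus (h (s l)) i (u (s l) n)) ψ) atTop
        (𝓝 (inner ℝ ((jetComponent Ω (some i)).compLp v) ψ)) := by
  obtain ⟨K, hK0, hK⟩ := exists_smoothed_velocity hΩ
  have hex : ∀ m, ∃ U : ℕ → H10sigma Ω, ∀ n < N m,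
      jetComponent Ω none (U (n + 1)) =ᵐ[volume.restrict Ω] smear (h m) velKernel (u m (n + 1)) ∧
      (∀ j, jetComponent Ω (some j) (U (n + 1)) =ᵐ[volume.restrict Ω]
        smear (h m) (gradKernel j) (dPlus (h m) j (u m (n + 1)))) ∧
      (∀ x, x ∉ Ω → smear (h m) velKernel (u m (n + 1)) x = 0) ∧
      (∀ j x, x ∉ Ω → smear (h m) (gradKernel j) (dPlus (h m) j (u m (n + 1))) x = 0) ∧
      ‖U (n + 1)‖ ^ 2 ≤ K * (h m ^ 3 * ∑' z, ‖u m (n + 1) z‖ ^ 2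
        + h m ^ 3 * ∑' z, ∑ j, ‖dPlus (h m) j (u m (n + 1)) z‖ ^ 2) := fun m => by
    choose! W hW using fun n hn => hK (h m) (hh m) (u m (n + 1)) (hsupp m n hn) (hdiv m n hn)
    -- Step functions in time read the sequence from index one on, so the jet built for step `n` is
    -- stored at `n + 1`.
    exact ⟨fun n => W (n - 1), hW⟩
  choose U hU using hex
  have hUC : ∀ m, ∑ n ∈ Finset.range (N m), τ m * ‖U m (n + 1)‖ ^ 2 ≤ K * (C + C) := fun m => by
    calc ∑ n ∈ Finset.range (N m), τ m * ‖U m (n + 1)‖ ^ 2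
        ≤ ∑ n ∈ Finset.range (N m), K * (τ m * (h m ^ 3 * ∑' z, ‖u m (n + 1) z‖ ^ 2)
            + τ m * (h m ^ 3 * ∑' z, ∑ j, ‖dPlus (h m) j (u m (n + 1)) z‖ ^ 2)) :=
          Finset.sum_le_sum fun n hn => by
            have h2 := (hU m n (Finset.mem_range.1 hn)).2.2.2.2
            have h3 := mul_le_mul_of_nonneg_left h2 (hτ m).le
            linarith
      _ ≤ K * (C + C) := by
          rw [← Finset.mul_sum, Finset.sum_add_distrib]
          exact mul_le_mul_of_nonneg_left (add_le_add (hvel m) (hgrad m)) hK0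
  have hKC : 0 ≤ K * (C + C) := by positivity
  have hcomp : ∀ o m, ∑ n ∈ Finset.range (N m), τ m * ‖jetComponent Ω o (U m (n + 1))‖ ^ 2
      ≤ K * (C + C) + C := fun o m =>
    ((Finset.sum_le_sum fun n _ => mul_le_mul_of_nonneg_left (jetComponent_sq_le o _)
      (hτ m).le).trans (hUC m)).trans (by linarith)
  have hV : ∀ m, ‖stepTime (τ m) T (U m)‖ ≤ K * (C + C) + 1 := fun m =>
    norm_le_of_sq_le hKC ((norm_stepTime_sq_le (hτ m) (hN m) _).trans (hUC m))
  -- The limit is taken in the space of solenoidal jets, so its components already are a function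
  -- and its weak derivatives. What remains is to replace the smoothed fields by the step functions.
  obtain ⟨s, hs, v, hv⟩ := exists_weakly_convergent_subseq (H := L2Time (H10sigma Ω) T) hV
  have hlim' : Tendsto (fun l => h (s l)) atTop (𝓝 0) := hlim.comp hs.tendsto_atTop
  refine ⟨s, hs, v, ?_, fun i => ?_⟩
  · refine tendsto_inner_of_weakly_null (jetComponent Ω none) (fun l => hτ (s l)) hv ?_
    exact weakly_null_smear_sub (h := fun l => h (s l)) (τ := fun l => τ (s l))
      (N := fun l => N (s l)) (a := fun l => u (s l))
      (F := fun l n => jetComponent Ω none (U (s l) n)) (C := K * (C + C) + C) hΩ (fun l => hh _)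
      hlim' (fun l => hτ _) (fun l => hN _) (fun l => hN' _) isKernel_velKernel
      (fun l n hn z hz => hsupp _ n hn z fun h => hz h.1)
      (fun l n hn => (hU _ n hn).2.2.1) (fun l n hn => (hU _ n hn).1)
      (fun l => (hvel _).trans (by linarith)) (fun l => hcomp none _)
  · refine tendsto_inner_of_weakly_null (jetComponent Ω (some i)) (fun l => hτ (s l)) hv ?_
    exact weakly_null_smear_sub (h := fun l => h (s l)) (τ := fun l => τ (s l))
      (N := fun l => N (s l)) (a := fun l n => dPlus (h (s l)) i (u (s l) n))
      (F := fun l n => jetComponent Ω (some i) (U (s l) n)) (C := K * (C + C) + C) hΩ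
      (fun l => hh _) hlim' (fun l => hτ _) (fun l => hN _) (fun l => hN' _)
      (isKernel_gradKernel i) (fun l n hn z hz => dPlus_eq_zero (h (s l)) (hsupp _ n hn) i hz)
      (fun l n hn => (hU _ n hn).2.2.2.1 i) (fun l n hn => (hU _ n hn).2.1 i)
      (fun l => ((Finset.sum_le_sum fun n hn => mul_le_mul_of_nonneg_left
        (sum_norm_dPlus_le hΩ (hh _) (fun z hz => hsupp _ n (Finset.mem_range.1 hn) z
          fun h => hz h.1) i) (hτ _).le).trans (hgrad _)).trans (by linarith))
      (fun l => hcomp (some i) _)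

theorem sum_const_mul_le {τ T c : ℝ} {N : ℕ} (hN : τ * N ≤ T) (hc : 0 ≤ c) :
    ∑ _n ∈ Finset.range N, τ * c ≤ T * c := by
  rw [Finset.sum_const, Finset.card_range, nsmul_eq_mul, ← mul_assoc, mul_comm (N : ℝ)]
  exact mul_le_mul_of_nonneg_right hN hc

theorem norm_stepL2_density_le {Ω : Set E3} (hΩ : Bornology.IsBounded Ω) {h τ T : ℝ} {N : ℕ}
    (hτ : 0 < τ) (hT : 0 ≤ T) (hN : T < τ * N) (hN' : τ * N ≤ T + 1) {r M : ℝ} (hr : 0 < r)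
    (hrM : r ≤ M) {η : ℕ → Idx → ℝ} (hη : ∀ n < N, ∀ z ∈ grid Ω h, η (n + 1) z ∈ Icc r M) :
    ‖stepL2 Ω r h τ T η‖ ≤ (T + 1) * (M ^ 2 * (volume : Measure E3).real Ω) + 1 := by
  refine norm_le_of_sq_le (by positivity) ((norm_stepTime_sq_le hτ hN _).trans
    ((Finset.sum_le_sum fun n hn => mul_le_mul_of_nonneg_left ?_ hτ.le).trans
      (sum_const_mul_le hN' (by positivity))))
  refine norm_gridL2_sq_le_of_bound hΩ.measure_lt_top.ne _ fun z => ?_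
  rw [extendGrid]
  split_ifs with hz
  · have h2 := hη n (Finset.mem_range.1 hn) z hz
    rw [Real.norm_eq_abs, abs_of_nonneg (hr.le.trans h2.1)]
    exact h2.2
  · rw [Real.norm_eq_abs, abs_of_pos hr]
    exact hrM

theorem norm_stepL2_smul_le {Ω : Set E3} (hΩ : Bornology.IsBounded Ω) {h τ T : ℝ} {N : ℕ}
    (hh : 0 < h) (hτ : 0 < τ) (hN : T < τ * N) {M C : ℝ} {η : ℕ → Idx → ℝ}
    (hη : ∀ n < N, ∀ z ∈ grid Ω h, η (n + 1) z ∈ Icc 0 M) {u : ℕ → Idx → E3}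
    (hu : ∀ n, ∀ z, z ∉ grid Ω h → u n z = 0) (hC0 : 0 ≤ C)
    (hC : ∑ n ∈ Finset.range N, τ * (h ^ 3 * ∑' z, ‖u (n + 1) z‖ ^ 2) ≤ C) :
    ‖stepL2 Ω 0 h τ T fun n z => η n z • u n z‖ ≤ M ^ 2 * C + 1 := by
  have hG := finite_grid hΩ hh
  refine norm_le_of_sq_le (by positivity) ((norm_stepTime_sq_le hτ hN _).trans
    (le_trans ?_ (mul_le_mul_of_nonneg_left hC (sq_nonneg M))))
  rw [Finset.mul_sum]
  refine Finset.sum_le_sum fun n hn => ?_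
  have h2 : ∀ z, z ∉ grid Ω h → η (n + 1) z • u (n + 1) z = 0 := fun z hz => by
    rw [hu _ z hz, smul_zero]
  rw [extendGrid_eq_self h2, norm_gridL2_sq hΩ.measure_lt_top.ne hh hG h2, mul_left_comm (M ^ 2),
    mul_left_comm (M ^ 2), ← tsum_mul_left (a := M ^ 2)]
  have hfin := finite_support_of_grid hG (hu (n + 1))
  refine mul_le_mul_of_nonneg_left (mul_le_mul_of_nonneg_left (Summable.tsum_le_tsum
    (fun z => ?_) (summable_of_imp_field hfin fun z hz => by simp [hz])
    (summable_of_imp_field hfin fun z hz => by simp [hz])) (pow_nonneg hh.le 3)) hτ.le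
  by_cases hz : z ∈ grid Ω h
  · have h3 := hη n (Finset.mem_range.1 hn) z hz
    rw [norm_smul, mul_pow, Real.norm_eq_abs, abs_of_nonneg h3.1]
    exact mul_le_mul_of_nonneg_right (pow_le_pow_left₀ h3.1 h3.2 2) (sq_nonneg _)
  · simp [hu (n + 1) z hz]

set_option maxHeartbeats 1000000 in
-- Three successive extractions: the velocity with its differences, the density, and the momentum.
-- The limit of the momentum is not identified as a product, so boundedness is all that is needed
-- there.
theorem exists_weak_limits {Ω Ω' : Set E3} (hΩ_open : IsOpen Ω) (hΩ : Bornology.IsBounded Ω)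
    (hΩ' : Bornology.IsBounded Ω')
    {ε₀ : ℝ} (hΩΩ' : ∀ x ∈ Ω, Metric.closedBall x ε₀ ⊆ Ω') {μ : ℝ → ℝ}
    (hμ_cont : ContinuousOn μ (Ici 0)) (hμ : ∀ r, 0 ≤ r → 0 < μ r) {f : ℝ → L2On E3 Ω}
    (hf : ∀ S : ℝ, MemLp f 2 (volume.restrict (Icc 0 S))) (v0 : L2On E3 Ω)
    {ρ0 : Lp ℝ ⊤ (volume.restrict Ω)} {ρlo ρhi : ℝ} (hρlo : 0 < ρlo)
    (hρ0 : ∀ᵐ x ∂(volume.restrict Ω), ρlo ≤ ρ0 x ∧ ρ0 x ≤ ρhi) {α T : ℝ} (hα : α < 1)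
    (hT : 0 ≤ T) {h : ℕ → ℝ} (hh : ∀ m, 0 < h m) (hε : ∀ m, 6 * h m ≤ ε₀) (h1 : ∀ m, h m ≤ 1)
    (hlim : Tendsto h atTop (𝓝 0)) {η : ℕ → ℕ → Idx → ℝ} {u ũ : ℕ → ℕ → Idx → E3}
    {q : ℕ → ℕ → Idx → ℝ}
    (S : ∀ m, IsDiscreteSolution Ω Ω' μ f v0 ρ0 ρlo α T (h m) (η m) (u m) (ũ m) (q m)) :
    ∃ s : ℕ → ℕ, StrictMono s ∧ ∃ (ρ : L2Time (L2On ℝ Ω') T) (v : L2Time (H10sigma Ω) T)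
      (vt : L2Time (L2On E3 Ω) T),
      WeaklyConverges (fun l => rhoStep Ω' ρlo α (h (s l)) (η (s l))) ρ ∧
      WeaklyConverges (fun l => velStep Ω α (h (s l)) (u (s l))) (valueL2 v) ∧
      WeaklyConverges (fun l t x => rhoStep Ω' ρlo α (h (s l)) (η (s l)) t x •
        velStep Ω α (h (s l)) (u (s l)) t x) vt ∧
      ∀ i : Fin 3, WeaklyConverges (fun l => gradStep Ω α (h (s l)) i (u (s l))) (derivL2 i v) := by
  obtain ⟨C, hC0, hC⟩ := exists_uniform_bound hΩ_open hΩ hΩΩ' hμ_cont hμ hf v0 hρlo hρ0 hα hT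
  have hτ : ∀ m, 0 < timeStep α (h m) := fun m => timeStep_pos α (hh m)
  have hN : ∀ m, T < timeStep α (h m) * numSteps α (h m) T := fun m =>
    (timeStep_mul_numSteps (hh m) hT).1
  have hN' : ∀ m, timeStep α (h m) * numSteps α (h m) T ≤ T + 1 := fun m =>
    (timeStep_mul_numSteps (hh m) hT).2.trans (by
      have := timeStep_le_one hα (hh m) (h1 m)
      linarith)
  have hGG' := fun m => grid_subset_interior hΩΩ' (hh m) (hε m)
  have hCm := fun m => hC (h m) (hh m) (hε m) (h1 m) _ _ _ _ (S m)
  have hTC : 0 ≤ (T + 1) * C := by positivity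
  have hvel : ∀ m, ∑ n ∈ Finset.range (numSteps α (h m) T),
      timeStep α (h m) * (h m ^ 3 * ∑' z, ‖u m (n + 1) z‖ ^ 2) ≤ (T + 1) * C + C := fun m =>
    ((Finset.sum_le_sum fun n hn => mul_le_mul_of_nonneg_left
      ((hCm m).1 n (Finset.mem_range.1 hn)) (hτ m).le).trans
        (sum_const_mul_le (hN' m) hC0)).trans (by linarith)
  have hdens : ∀ m, ∀ n < numSteps α (h m) T, ∀ z ∈ grid Ω' (h m),
      η m (n + 1) z ∈ Icc ρlo (max ρlo ρhi) :=
    fun m n hn => (S m).density_mem_Icc hΩ_open hΩ (hh m) hρ0 (n := n + 1) hn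
  obtain ⟨s₁, hs₁, v, hv, hw⟩ := exists_velocity_limit hΩ hh hlim hτ hN hN'
    (fun m n hn => (S m).velocity_support hn) (fun m n hn => (S m).velocity_solenoidal hn)
    (add_nonneg hTC hC0) hvel fun m => (hCm m).2.trans (by linarith)
  have hR : ∀ m, ‖stepL2 Ω' ρlo (h (s₁ m)) (timeStep α (h (s₁ m))) T (η (s₁ m))‖
      ≤ (T + 1) * (max ρlo ρhi ^ 2 * (volume : Measure E3).real Ω') + 1 := fun m =>
    norm_stepL2_density_le hΩ' (hτ _) hT (hN _) (hN' _) hρlo (le_max_left _ _) (hdens _)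
  obtain ⟨s₂, hs₂, ρ, hρ⟩ := exists_weakly_convergent_subseq (H := L2Time (L2On ℝ Ω') T) hR
  have hP : ∀ m, ‖stepL2 Ω 0 (h (s₁ (s₂ m))) (timeStep α (h (s₁ (s₂ m)))) T
      fun n z => η (s₁ (s₂ m)) n z • u (s₁ (s₂ m)) n z‖
      ≤ max ρlo ρhi ^ 2 * ((T + 1) * C + C) + 1 := fun m =>
    norm_stepL2_smul_le hΩ (hh _) (hτ _) (hN _) (fun n hn z hz =>
      Icc_subset_Icc_left hρlo.le (hdens _ n hn z (hGG' _ hz).1)) (S _).zero_outside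
      (add_nonneg hTC hC0) (hvel _)
  obtain ⟨s₃, hs₃, vt, hvt⟩ := exists_weakly_convergent_subseq (H := L2Time (L2On E3 Ω) T) hP
  refine ⟨fun l => s₁ (s₂ (s₃ l)), hs₁.comp (hs₂.comp hs₃), ρ, v, vt,
    ⟨_, fun l => coeFn_stepL2 hΩ' ρlo (hh _) (hτ _) T _, fun ψ => (hρ ψ).comp hs₃.tendsto_atTop⟩,
    ⟨_, fun l => coeFn_stepL2 hΩ 0 (hh _) (hτ _) T _,
      fun ψ => (hv ψ).comp (hs₂.comp hs₃).tendsto_atTop⟩, ⟨_, fun l => ?_, hvt⟩, fun i =>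
    ⟨_, fun l => coeFn_stepL2 hΩ 0 (hh _) (hτ _) T _,
      fun ψ => (hw i ψ).comp (hs₂.comp hs₃).tendsto_atTop⟩⟩
  filter_upwards [coeFn_stepL2 hΩ (0 : E3) (hh (s₁ (s₂ (s₃ l)))) (hτ (s₁ (s₂ (s₃ l)))) T
    fun n z => η (s₁ (s₂ (s₃ l))) n z • u (s₁ (s₂ (s₃ l))) n z] with t ht
  refine ht.trans (Eventually.of_forall fun x => ?_)
  simp only [rhoStep, velStep, stepFun]
  -- The product of the step functions is the step function of the products: on velocity cells the
  -- density is also a grid value, since the grid of `Ω` lies in that of `Ω'`, and elsewhere the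
  -- velocity is zero.
  by_cases hx : cellIdx (h (s₁ (s₂ (s₃ l)))) x ∈ grid Ω (h (s₁ (s₂ (s₃ l))))
  · rw [if_pos hx, if_pos hx, if_pos (hGG' _ hx).1]
  · rw [if_neg hx, if_neg hx, smul_zero]

theorem exists_strictAnti_subseq {h : ℕ → ℝ} (hh : ∀ m, 0 < h m) (hlim : Tendsto h atTop (𝓝 0))
    {ε : ℝ} (hε : 0 < ε) :
    ∃ s : ℕ → ℕ, StrictMono s ∧ StrictAnti (h ∘ s) ∧ ∀ l, h (s l) ≤ ε := by
  have hev : ∀ r > 0, ∀ k, ∃ k' > k, h k' < r := fun r hr k =>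
    ((eventually_gt_atTop k).and (hlim.eventually (gt_mem_nhds hr))).exists
  obtain ⟨k₀, -, hk₀⟩ := hev ε hε 0
  obtain ⟨s, hs0, hs⟩ := exists_seq_of_step (fun _ => True) (fun _ k k' => k < k' ∧ h k' < h k) k₀
    trivial fun _ k _ => by
      obtain ⟨k', h1, h2⟩ := hev (h k) (hh k) k
      exact ⟨k', trivial, h1, h2⟩
  have hanti : StrictAnti (h ∘ s) := strictAnti_nat_of_succ_lt fun n => (hs n).2
  refine ⟨s, strictMono_nat_of_lt_succ fun n => (hs n).1, hanti, fun l => ?_⟩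
  refine (hanti.antitone (Nat.zero_le l)).trans ?_
  rw [Function.comp_apply, hs0]
  exact hk₀.le

end FDNavierStokes

end

/-! ### Conclusion: solvability for small mesh sizes and weak compactness -/

set_option maxHeartbeats 2000000 in
theorem mainTheorem5
    (Ω Ω' : Set FDNavierStokes.E3)
    (hΩ_open : IsOpen Ω) (hΩ_conn : IsConnected Ω) (hΩ_bdd : Bornology.IsBounded Ω)
    (hΩ_lip : FDNavierStokes.HasLipschitzBoundary Ω)
    (hΩ'_open : IsOpen Ω') (hΩ'_conn : IsConnected Ω') (hΩ'_bdd : Bornology.IsBounded Ω')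
    (ε₀ : ℝ) (hε₀ : 0 < ε₀) (hΩΩ' : ∀ x ∈ Ω, Metric.closedBall x ε₀ ⊆ Ω')
    (μ : ℝ → ℝ) (hμ_cont : ContinuousOn μ (Set.Ici 0)) (hμ_pos : ∀ r, 0 ≤ r → 0 < μ r)
    (f : ℝ → FDNavierStokes.L2On FDNavierStokes.E3 Ω)
    (hf : ∀ S : ℝ, MeasureTheory.MemLp f 2 (MeasureTheory.volume.restrict (Set.Icc 0 S)))
    (v0 : FDNavierStokes.L2On FDNavierStokes.E3 Ω)
    (ρ0 : MeasureTheory.Lp ℝ ⊤ (MeasureTheory.volume.restrict Ω))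
    (ρlo ρhi : ℝ) (hρlo : 0 < ρlo)
    (hρ0 : ∀ᵐ x ∂(MeasureTheory.volume.restrict Ω), ρlo ≤ ρ0 x ∧ ρ0 x ≤ ρhi)
    (α : ℝ) (hα0 : 0 < α) (hα1 : α < 1) (T : ℝ) (hT : 0 < T) :
    (∀ᶠ h in 𝓝[>] (0 : ℝ), ∃ η u ũ q,
      FDNavierStokes.IsDiscreteSolution Ω Ω' μ f v0 ρ0 ρlo α T h η u ũ q) ∧
    ∀ (h : ℕ → ℝ), (∀ m, 0 < h m) → Tendsto h atTop (𝓝 0) →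
      ∀ (η : ℕ → ℕ → FDNavierStokes.Idx → ℝ)
        (u ũ : ℕ → ℕ → FDNavierStokes.Idx → FDNavierStokes.E3)
        (q : ℕ → ℕ → FDNavierStokes.Idx → ℝ),
      (∀ m, FDNavierStokes.IsDiscreteSolution Ω Ω' μ f v0 ρ0 ρlo α T (h m)
        (η m) (u m) (ũ m) (q m)) →
      ∃ s : ℕ → ℕ, StrictMono s ∧ StrictAnti (h ∘ s) ∧
        ∃ (ρ : FDNavierStokes.L2Time (FDNavierStokes.L2On ℝ Ω') T)
          (v : FDNavierStokes.L2Time (FDNavierStokes.H10sigma Ω) T)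
          (vt : FDNavierStokes.L2Time (FDNavierStokes.L2On FDNavierStokes.E3 Ω) T),
          FDNavierStokes.WeaklyConverges
            (fun l => FDNavierStokes.rhoStep Ω' ρlo α (h (s l)) (η (s l))) ρ ∧
          FDNavierStokes.WeaklyConverges
            (fun l => FDNavierStokes.velStep Ω α (h (s l)) (u (s l)))
            (FDNavierStokes.valueL2 v) ∧
          FDNavierStokes.WeaklyConverges
            (fun l t x => FDNavierStokes.rhoStep Ω' ρlo α (h (s l)) (η (s l)) t x •
              FDNavierStokes.velStep Ω α (h (s l)) (u (s l)) t x) vt ∧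
          ∀ i : Fin 3, FDNavierStokes.WeaklyConverges
            (fun l => FDNavierStokes.gradStep Ω α (h (s l)) i (u (s l)))
            (FDNavierStokes.derivL2 i v) := by
  refine ⟨?_, fun h hh hlim η u ũ q S => ?_⟩
  · filter_upwards [Ioo_mem_nhdsGT (show (0 : ℝ) < ε₀ / 6 by positivity)] with h hh
    exact FDNavierStokes.exists_discreteSolution hΩ_open hΩ_bdd hΩΩ' hμ_pos f v0 hρlo hρ0 α T hh.1
      (by linarith [hh.2])
  -- The sequence is first thinned to strictly decreasing mesh sizes below `ε₀ / 6` and `1`, so that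
  -- the estimates hold for every index; later extractions keep strict monotonicity.
  · obtain ⟨s₀, hs₀, hanti, hsmall⟩ := FDNavierStokes.exists_strictAnti_subseq hh hlim
      (show 0 < min (ε₀ / 6) 1 by positivity)
    obtain ⟨s, hs, ρ, v, vt, H⟩ := FDNavierStokes.exists_weak_limits hΩ_open hΩ_bdd hΩ'_bdd hΩΩ'
      hμ_cont hμ_pos hf v0 hρlo hρ0 hα1 hT.le (h := h ∘ s₀) (fun m => hh _)
      (fun m => by
        have := (hsmall m).trans (min_le_left _ _)
        simp only [Function.comp_apply]
        linarith)
      (fun m => (hsmall m).trans (min_le_right _ _)) (hlim.comp hs₀.tendsto_atTop)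
      (η := η ∘ s₀) (u := u ∘ s₀) (ũ := ũ ∘ s₀) (q := q ∘ s₀) fun m => S (s₀ m)
    exact ⟨s₀ ∘ s, hs₀.comp hs, hanti.comp_strictMono hs, ρ, v, vt, H⟩
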